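/- Let $\mathbb S^2\subset\mathbb R^3$ be the unit sphere with surface measure $\lambda$, let $Y_{lm}$ ($l\ge 0$, $|m|\le l$) be the complex spherical harmonics, orthonormal in $L^2(\mathbb S^2,\lambda)$ (with the usual phase convention $Y_{l,-m}=(-1)^mY_{lm}^*$), and put $\mu_l=l(l+1)$. *Space operator.* Let $b\ge 0$, let $M$ be a measure on $(0,\infty)$ with $\int (1\wedge z)\,M(dz)<\infty$, and put $\Psi(r)=br+\int_0^\infty(1-e^{-rz})\,M(dz)$. Let $(P_s)_{s>0}$ be the transition semigroup of rotational Brownian motion on $\mathbb S^2$, $P_sf(x)=\int_{\mathbb S^2} f(y)\,p_s(x,y)\,\lambda(dy)$ with $p_s(x,y)=\sum_l\sum_{|m|\le l} e^{-s\mu_l}Y_{lm}(y)Y_{lm}^*(x)$, acting on the space variable of functions in $L^2(dP\times d\lambda)$, and let $\Delta$ be its $L^2$-generator. With the sign convention of the Phillips formula, $$\Psi(-\Delta_{\mathbb S^2})U=b\,\Delta U+\int_0^\infty (P_sU-U)\,M(ds),$$ on those $U\in L^2(dP\times d\lambda)$ for which $\Delta U$ exists (required only if $b\ne 0$) and the integral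 exists weakly in $L^2(dP\times d\lambda)$; so $\Psi(-\Delta_{\mathbb S^2})$ is the nonpositive generator of the subordinate Brownian motion. *Time operator.* Let $\Pi$ be a measure on $(0,\infty)$ with $\int(1\wedge z)\,\Pi(dz)<\infty$ and $\Pi((0,\infty))=\infty$, whose tail $\overline\Pi(s)=\Pi((s,\infty))$ is absolutely continuous on every $[r,s]\subset(0,\infty)$. Put $\Phi(r)=\int_0^\infty(1-e^{-rz})\,\Pi(dz)$, let $H$ be a subordinator with Laplace exponent $\Phi$, $L_t=\inf\{s\ge 0: H_s>t\}$ and $\tilde l(t,r)=\mathbf E[e^{-rL_t}]$. For a scalar function $u$ absolutely continuous on $[0,t]$ let $\mathfrak D^\Phi_tu(t)=\int_0^tu'(t-s)\,\overline\Pi(s)\,ds$ (the integral being absolutely convergent). For $X:[0,\infty)\to L^2(dP\times d\lambda)$, $\mathfrak D^\Phi_tX_t$ is the element $D$ of $L^2(dP\times d\lambda)$ with $\langle D,V\rangle=\mathfrak D^\Phi_t\langle X_\cdot,V\rangle(t)$ for all $V\in L^2(dP\times d\lambda)$, each $\langle X_\cdot,V\rangle$ being absolutely continuous on $[0,t]$.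 **Theorem.** Let $T$ be a real, jointly measurable, square integrable, zero-mean, isotropic Gaussian random field on $\mathbb S^2$, and let $\gamma>0$. Call $X:[0,\infty)\to L^2(dP\times d\lambda)$ a solution if $X_0=T$ and, for every $t>0$, $\Psi(-\Delta_{\mathbb S^2})X_t$ and $\mathfrak D^\Phi_tX_t$ exist and $$\bigl(\gamma-\Psi(-\Delta_{\mathbb S^2})+\mathfrak D^\Phi_t\bigr)X_t=0\quad\text{in }L^2(dP\times d\lambda).$$ Then a solution exists, and it may be chosen real-valued. Moreover $X$ is a solution if and only if, for every $t\ge 0$, $$X_t(x)=\sum_{l=0}^\infty\sum_{m=-l}^{l}a_{lm}\,\tilde l\bigl(t,\gamma+\Psi(\mu_l)\bigr)\,Y_{lm}(x),\qquad a_{lm}=\int_{\mathbb S^2}T(x)Y_{lm}^*(x)\,\lambda(dx),$$ the sum over $l$ converging in $L^2(dP\times d\lambda)$. In particular the solution is unique. -/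

import Mathlib

open MeasureTheory ProbabilityTheory Filter Topology Set
open scoped NNReal ENNReal ComplexConjugate Matrix

namespace SphereField

noncomputable section

/-! ### Lévy measures, Laplace exponents, subordinators and their inverses -/

/-- `M` is the Lévy measure of a subordinator: it lives on `(0, ∞)` and `∫ (1 ∧ z) M(dz) < ∞`. -/
structure IsSubordinatorLevyMeasure (M : Measure ℝ) : Prop where
  nonpos_null : M (Iic 0) = 0
  lintegral_min_lt_top : ∫⁻ z, min 1 (ENNReal.ofReal z) ∂M < ∞

/-- The Bernstein function `r ↦ b r + ∫ (1 - e^{-r z}) M(dz)`. -/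
def laplaceExponent (b : ℝ) (M : Measure ℝ) (r : ℝ) : ℝ :=
  b * r + ∫ z in Ioi (0 : ℝ), (1 - Real.exp (-(r * z))) ∂M

/-- The tail `s ↦ M((s, ∞))` of a Lévy measure. -/
def levyTail (M : Measure ℝ) (s : ℝ) : ℝ := (M (Ioi s)).toReal

/-- `H` is a subordinator with Laplace exponent `Φ`: almost surely it starts at `0` and has
nondecreasing right-continuous paths, its increments are independent and stationary, and
`E[exp(-r H_t)] = exp(-t Φ(r))`. -/
structure IsSubordinator {Ω : Type*} [MeasurableSpace Ω] (H : ℝ≥0 → Ω → ℝ) (Q : Measure Ω)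
    (Φ : ℝ → ℝ) : Prop where
  measurable : ∀ t, Measurable (H t)
  zero : ∀ᵐ ω ∂Q, H 0 ω = 0
  monotone : ∀ᵐ ω ∂Q, Monotone fun t => H t ω
  rightContinuous : ∀ᵐ ω ∂Q, ∀ t, ContinuousWithinAt (fun s => H s ω) (Ici t) t
  indepIncrements : HasIndepIncrements H Q
  stationary : ∀ s t : ℝ≥0, IdentDistrib (fun ω => H (s + t) ω - H s ω) (H t) Q Q
  laplace : ∀ t : ℝ≥0, ∀ r : ℝ, 0 ≤ r →
    ∫ ω, Real.exp (-(r * H t ω)) ∂Q = Real.exp (-((t : ℝ) * Φ r))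

/-- The inverse process `L_t = inf {s ≥ 0 : H_s > t}`. -/
def inverseProcess {Ω : Type*} (H : ℝ≥0 → Ω → ℝ) (t : ℝ) (ω : Ω) : ℝ :=
  ((sInf {s : ℝ≥0 | t < H s ω} : ℝ≥0) : ℝ)

/-- The Laplace transform `E[exp(-r L_t)]` of the inverse process. -/
def inverseLaplace {Ω : Type*} [MeasurableSpace Ω] (H : ℝ≥0 → Ω → ℝ) (Q : Measure Ω)
    (t r : ℝ) : ℝ :=
  ∫ ω, Real.exp (-(r * inverseProcess H t ω)) ∂Q

/-! ### The unit sphere and the spherical harmonics -/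

/-- The unit sphere of `ℝ³`. -/
abbrev S2 : Type := Metric.sphere (0 : EuclideanSpace ℝ (Fin 3)) 1

/-- Lebesgue (surface) measure on the unit sphere, of total mass `4π`. -/
def surface : Measure S2 := (volume : Measure (EuclideanSpace ℝ (Fin 3))).toSphere

instance : IsFiniteMeasure surface := by unfold surface; infer_instance

/-- The Legendre polynomial given by the Rodrigues formula. -/
def legendre (l : ℕ) : Polynomial ℝ :=
  Polynomial.C (1 / (2 ^ l * (l.factorial : ℝ))) *
    Polynomial.derivative^[l] ((Polynomial.X ^ 2 - 1) ^ l)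

/-- The associated Legendre function
`(-1)^m (1 - z²)^{m/2} (d/dz)^m Q_l(z)` for `m ≥ 0`. -/
def assocLegendre (l m : ℕ) (z : ℝ) : ℝ :=
  (-1) ^ m * Real.sqrt (1 - z ^ 2) ^ m * (Polynomial.derivative^[m] (legendre l)).eval z

/-- The longitude of a point of the sphere (the value at the two poles plays no role). -/
def longitude (x : S2) : ℝ := Complex.arg ⟨x.1 0, x.1 1⟩

/-- The spherical harmonic `Y_{lm}` for `0 ≤ m ≤ l`; note that `x.1 2 = cos ϑ`. -/
def harmonicNonneg (l m : ℕ) (x : S2) : ℂ :=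
  ((Real.sqrt ((2 * (l : ℝ) + 1) / (4 * Real.pi) *
      (((l - m).factorial : ℝ) / ((l + m).factorial : ℝ))) * assocLegendre l m (x.1 2) : ℝ) : ℂ) *
    Complex.exp (Complex.I * ((m : ℝ) * longitude x : ℝ))

/-- The spherical harmonic `Y_{lm}` for `-l ≤ m ≤ l`, with
`Y_{l,-m} = (-1)^m (Y_{lm})^*`. -/
def harmonic (l : ℕ) (m : ℤ) (x : S2) : ℂ :=
  if 0 ≤ m then harmonicNonneg l m.natAbs x
  else (-1) ^ m.natAbs * conj (harmonicNonneg l m.natAbs x)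

/-- The orders `m = -l, …, l`. -/
def orders (l : ℕ) : Finset ℤ := Finset.Icc (-(l : ℤ)) l

/-- The eigenvalue `μ_l = l (l + 1)`. -/
def mu (l : ℕ) : ℝ := (l : ℝ) * ((l : ℝ) + 1)

/-- The Fourier coefficient `∫ f Y_{lm}^* dλ`. -/
def coeff (f : S2 → ℂ) (l : ℕ) (m : ℤ) : ℂ := ∫ x, f x * conj (harmonic l m x) ∂surface

/-- The transition density at time `s > 0` of rotational Brownian motion on the sphere. -/
def heatKernel (s : ℝ) (x y : S2) : ℂ :=
  ∑' l : ℕ, ∑ m ∈ orders l,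
    (Real.exp (-(s * mu l)) : ℂ) * harmonic l m y * conj (harmonic l m x)

/-! ### Operators on `L²(dP × dλ)`

Elements of `L²(dP × dλ)` are represented by functions `Ω × S2 → ℂ`. -/

section Operators

variable {Ω : Type*} [MeasurableSpace Ω]

/-- The inner product `∫ U V^* d(P × λ)`. -/
def pairing (P : Measure Ω) (U V : Ω × S2 → ℂ) : ℂ := ∫ p, U p * conj (V p) ∂(P.prod surface)

/-- The transition semigroup of rotational Brownian motion, acting on the space variable. -/
def heatOp (s : ℝ) (U : Ω × S2 → ℂ) (p : Ω × S2) : ℂ :=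
  ∫ y, U (p.1, y) * heatKernel s p.2 y ∂surface

/-- `D = ΔU`: `D` is the value at `U` of the `L²`-generator of the transition semigroup of
rotational Brownian motion. -/
def HasLaplacian (P : Measure Ω) (U D : Ω × S2 → ℂ) : Prop :=
  Tendsto (fun h : ℝ =>
      eLpNorm (fun p => ((h⁻¹ : ℝ) : ℂ) * (heatOp h U p - U p) - D p) 2 (P.prod surface))
    (𝓝[>] 0) (𝓝 0)

/-- `A = Ψ(-Δ) U` for `Ψ` with drift `b` and Lévy measure `M`:
`A = b ΔU + ∫ (P_s U - U) M(ds)` in `L²(dP × dλ)`, the integral being a weak integral.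
The Laplacian is only required to exist when `b ≠ 0`. -/
def HasSubordinateLaplacian (b : ℝ) (M : Measure ℝ) (P : Measure Ω) (U A : Ω × S2 → ℂ) : Prop :=
  MemLp A 2 (P.prod surface) ∧
  ∃ D : Ω × S2 → ℂ, MemLp D 2 (P.prod surface) ∧ (b ≠ 0 → HasLaplacian P U D) ∧
    ∀ V : Ω × S2 → ℂ, MemLp V 2 (P.prod surface) →
      IntegrableOn (fun s : ℝ => pairing P (fun p => heatOp s U p - U p) V) (Ioi 0) M ∧
      pairing P A V = b * pairing P D V +
        ∫ s in Ioi (0 : ℝ), pairing P (fun p => heatOp s U p - U p) V ∂M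

/-- The convolution-type derivative of a scalar function: `u` is absolutely continuous on
`[0, t]`, the integral `∫₀ᵗ u'(t - s) Π((s, ∞)) ds` converges, and its value is `d`. -/
def HasConvDeriv (Lm : Measure ℝ) (u : ℝ → ℂ) (t : ℝ) (d : ℂ) : Prop :=
  AbsolutelyContinuousOnInterval u 0 t ∧
  IntervalIntegrable (fun s => deriv u (t - s) * (levyTail Lm s : ℂ)) volume 0 t ∧
  ∫ s in (0 : ℝ)..t, deriv u (t - s) * (levyTail Lm s : ℂ) = d

/-- The convolution-type derivative at time `t` of `X : [0, ∞) → L²(dP × dλ)`, taken weakly in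
`L²(dP × dλ)`. -/
def HasConvDerivL2 (Lm : Measure ℝ) (P : Measure Ω) (X : ℝ → Ω × S2 → ℂ) (t : ℝ)
    (D : Ω × S2 → ℂ) : Prop :=
  MemLp D 2 (P.prod surface) ∧
  ∀ V : Ω × S2 → ℂ, MemLp V 2 (P.prod surface) →
    HasConvDeriv Lm (fun r => pairing P (X r) V) t (pairing P D V)

/-- `X` is a solution in `L²(dP × dλ)` of `(γ - Ψ(-Δ) + 𝔇^Φ_t) X_t = 0`, `t > 0`, with
`X_0 = T`, where `Ψ` has drift `b` and Lévy measure `M`, and `Φ` has Lévy measure `Lm`. -/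
structure IsSolution (γ b : ℝ) (M Lm : Measure ℝ) (P : Measure Ω) (T : Ω → S2 → ℝ)
    (X : ℝ → Ω × S2 → ℂ) : Prop where
  memLp : ∀ t, 0 ≤ t → MemLp (X t) 2 (P.prod surface)
  initial : X 0 =ᵐ[P.prod surface] fun p => (T p.1 p.2 : ℂ)
  equation : ∀ t, 0 < t → ∃ A D : Ω × S2 → ℂ,
    HasSubordinateLaplacian b M P (X t) A ∧ HasConvDerivL2 Lm P X t D ∧
    (fun p => (γ : ℂ) * X t p - A p + D p) =ᵐ[P.prod surface] fun _ => 0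

/-- A real, centered, isotropic Gaussian random field on the sphere, jointly measurable. -/
structure IsIsotropicGaussianField (P : Measure Ω) (T : Ω → S2 → ℝ) : Prop where
  measurable : Measurable fun p : Ω × S2 => T p.1 p.2
  gaussian : IsGaussianProcess (fun x ω => T ω x) P
  memLp : ∀ x, MemLp (fun ω => T ω x) 2 P
  centered : ∀ x, ∫ ω, T ω x ∂P = 0
  isotropic : ∀ g ∈ Matrix.specialOrthogonalGroup (Fin 3) ℝ, ∀ x y gx gy : S2,
    gx.1.ofLp = g *ᵥ x.1.ofLp → gy.1.ofLp = g *ᵥ y.1.ofLp →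
      ∫ ω, T ω gx * T ω gy ∂P = ∫ ω, T ω x * T ω y ∂P

/-- The random Fourier coefficient `a_{lm} = ∫ T Y_{lm}^* dλ`. -/
def fieldCoeff (T : Ω → S2 → ℝ) (l : ℕ) (m : ℤ) (ω : Ω) : ℂ := coeff (fun x => (T ω x : ℂ)) l m

/-- The partial sum over `l < N` and `|m| ≤ l` of
`∑ a_{lm} E[exp(-(γ + Ψ(μ_l)) L_t)] Y_{lm}(x)`. -/
def seriesPartialSum {Ω' : Type*} [MeasurableSpace Ω'] (γ b : ℝ) (M : Measure ℝ)
    (T : Ω → S2 → ℝ) (H : ℝ≥0 → Ω' → ℝ) (Q : Measure Ω') (t : ℝ) (N : ℕ) (p : Ω × S2) : ℂ :=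
  ∑ l ∈ Finset.range N, ∑ m ∈ orders l,
    fieldCoeff T l m p.1 * (inverseLaplace H Q t (γ + laplaceExponent b M (mu l)) : ℂ) *
      harmonic l m p.2

/-- `X_t = ∑_l ∑_m a_{lm} E[exp(-(γ + Ψ(μ_l)) L_t)] Y_{lm}` with convergence in
`L²(dP × dλ)`. -/
def HasSeriesRepresentation {Ω' : Type*} [MeasurableSpace Ω'] (γ b : ℝ) (M : Measure ℝ)
    (P : Measure Ω) (T : Ω → S2 → ℝ) (H : ℝ≥0 → Ω' → ℝ) (Q : Measure Ω') (t : ℝ)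
    (Z : Ω × S2 → ℂ) : Prop :=
  MemLp Z 2 (P.prod surface) ∧
  Tendsto (fun N : ℕ =>
      eLpNorm (fun p => Z p - seriesPartialSum γ b M T H Q t N p) 2 (P.prod surface))
    atTop (𝓝 0)

end Operators

end

end SphereField

open SphereField

/-!
Everything is diagonal in the spherical harmonics. With `û_i(ω) = ∫ U(ω, y) Y_i^*(y) λ(dy)`, the
map `U ↦ (û_i)_i` is unitary from `L²(dP × dλ)` onto the Hilbert sum of copies of `L²(P)`
(`coord`). In these coordinates the semigroup multiplies `û_{lm}` by `e^{-s μ_l}`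
(`heatOp_ae_eq`), the Laplacian by `-μ_l` (`hasLaplacian_iff`), and the subordinate operator by
`-Ψ(μ_l)`, its domain consisting of the `U` for which the result is square summable
(`HasSubordinateLaplacian.coord_eq`, `hasSubordinateLaplacian_of_coord_eq`). Hence, paired with an
element `h ⊗ Y_{lm}`, the equation becomes the scalar relaxation equation `𝔇 f = -r f` with `r = γ
+ Ψ(μ_l)`, and the claim amounts to saying that `f(t) = f(0) E[e^{-r L_t}]` is its only solution,
with enough uniformity in `r` to sum the series.

The scalar equation rests on the potential measure `U_r = ∫ e^{-r s} P(H_s ∈ ·) ds`. Comparison of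
Laplace transforms gives the renewal equation `∫ κ(t - y) U_r(dy) = 1` for almost every `t > 0`,
where `κ(s) = Π((s, ∞)) + r`. Splitting `U_r` at a level `x` where it holds shows that beyond `x`
the measure `U_r` is a convolution with the absolutely continuous measure `Π`, so that `U_r` has a
density (`absolutelyContinuous_of_renewal`); then the renewal equation holds for every `t > 0`
(`lintegral_renewalKernel_eq_one`). As `E[e^{-r L_t}] = r U_r((t, ∞))`
(`IsSubordinator.inverseLaplace_eq`), this is the relaxation equation for `E[e^{-r L_t}]`.
Convolving `𝔇 f = -r f` with `U_r` gives uniqueness (`IsDiffuseSubordinator.eq_of_hasConvDeriv`).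
The bound of `r E[e^{-r L_t}]` uniformly in `r` (`IsDiffuseSubordinator.mul_inverseLaplace_le`)
makes the termwise derivative of the series converge (`IsDiffuseSubordinator.hasConvDeriv_tsum`)
and puts the series for `t > 0` into the domain of the space operator.

On the sphere, surface measure in spherical coordinates (`surface_eq_map`) and repeated
integration by parts in the Rodrigues formula give orthonormality (`integral_harmonic_mul_conj`).
Completeness (`ae_eq_zero_of_coeff_eq_zero`) follows from the Stone–Weierstrass theorem: the span
of the harmonics contains all monomials in `x₀ ± i x₁` and `x₂`. No pointwise bound on the
harmonics is needed for the heat kernel: its series converges almost everywhere against a square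
integrable function, because `∑ e^{-s μ_l} ‖Y_i‖₁ < ∞`.

The field `T` enters only through its square integrability, which comes from the transitivity of
the rotation group (`IsIsotropicGaussianField.memLp_prod`), and through its being real, which
makes the partial sums of the series real.
-/

namespace SphereField

/-! ### Laplace transforms of measures on the half-line -/

/-- The Laplace transform `s ↦ ∫ e^{-s x} μ(dx)`, with values in `[0, ∞]`. -/
noncomputable def laplaceTransform (μ : Measure ℝ) (s : ℝ) : ℝ≥0∞ :=
  ∫⁻ x, ENNReal.ofReal (Real.exp (-(s * x))) ∂μ

lemma laplaceTransform_conv (μ ν : Measure ℝ) [SFinite ν] (s : ℝ) :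
    laplaceTransform (μ ∗ ν) s = laplaceTransform μ s * laplaceTransform ν s := by
  unfold laplaceTransform
  rw [Measure.lintegral_conv (by fun_prop)]
  have h : ∀ x y : ℝ, ENNReal.ofReal (Real.exp (-(s * (x + y)))) =
      ENNReal.ofReal (Real.exp (-(s * x))) * ENNReal.ofReal (Real.exp (-(s * y))) := by
    intro x y
    rw [← ENNReal.ofReal_mul (Real.exp_pos _).le, ← Real.exp_add]
    ring_nf
  simp_rw [h]
  simp_rw [lintegral_const_mul _ (show Measurable fun y : ℝ =>
    ENNReal.ofReal (Real.exp (-(s * y))) by fun_prop)]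
  rw [lintegral_mul_const _ (by fun_prop)]

/-- Tilting a measure by `e^{-x}`; this turns a measure with finite Laplace transform into a finite
measure. -/
noncomputable def expTilt (μ : Measure ℝ) : Measure ℝ :=
  μ.withDensity fun x => ENNReal.ofReal (Real.exp (-x))

lemma expTilt_injective {μ ν : Measure ℝ} (h : expTilt μ = expTilt ν) : μ = ν := by
  have key : ∀ μ : Measure ℝ,
      (expTilt μ).withDensity (fun x => ENNReal.ofReal (Real.exp x)) = μ := by
    intro μ
    unfold expTilt
    rw [← withDensity_mul _ (by fun_prop) (by fun_prop)]
    have : (fun x => ENNReal.ofReal (Real.exp (-x))) * (fun x => ENNReal.ofReal (Real.exp x)) =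
        (1 : ℝ → ℝ≥0∞) := by
      ext x
      simp only [Pi.mul_apply, Pi.one_apply]
      rw [← ENNReal.ofReal_mul (Real.exp_pos _).le, ← Real.exp_add]
      simp
    rw [this, withDensity_one]
  rw [← key μ, ← key ν, h]

lemma integrable_exp_mul_expTilt {μ : Measure ℝ}
    (hf : ∀ s, 0 < s → laplaceTransform μ s ≠ ∞) {t : ℝ} (ht : t < 1) :
    Integrable (fun x => Real.exp (t * x)) (expTilt μ) := by
  refine ⟨by fun_prop, ?_⟩
  unfold HasFiniteIntegral expTilt
  rw [lintegral_withDensity_eq_lintegral_mul _ (by fun_prop) (by fun_prop)]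
  refine lt_of_le_of_lt (le_of_eq ?_) (hf (1 - t) (by linarith)).lt_top
  unfold laplaceTransform
  congr 1
  ext x
  simp only [Pi.mul_apply]
  rw [Real.enorm_of_nonneg (Real.exp_pos _).le, ← ENNReal.ofReal_mul (Real.exp_pos _).le,
    ← Real.exp_add]
  ring_nf

lemma mgf_expTilt {μ : Measure ℝ} (t : ℝ) :
    mgf id (expTilt μ) t = (laplaceTransform μ (1 - t)).toReal := by
  unfold mgf
  rw [integral_eq_lintegral_of_nonneg_ae (ae_of_all _ fun x => (Real.exp_pos _).le) (by fun_prop)]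
  congr 1
  unfold expTilt laplaceTransform
  rw [lintegral_withDensity_eq_lintegral_mul _ (by fun_prop) (by fun_prop)]
  congr 1
  ext x
  simp only [Pi.mul_apply, id]
  rw [← ENNReal.ofReal_mul (Real.exp_pos _).le, ← Real.exp_add]
  ring_nf

/-- The Laplace transform on `(0, ∞)`, when it is finite there, determines the measure. -/
theorem eq_of_laplaceTransform_eq {μ ν : Measure ℝ}
    (hf : ∀ s, 0 < s → laplaceTransform μ s ≠ ∞)
    (h : ∀ s, 0 < s → laplaceTransform μ s = laplaceTransform ν s) : μ = ν := by
  have hf' : ∀ s, 0 < s → laplaceTransform ν s ≠ ∞ := fun s hs => h s hs ▸ hf s hs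
  have fin : ∀ {μ : Measure ℝ}, (∀ s, 0 < s → laplaceTransform μ s ≠ ∞) →
      IsFiniteMeasure (expTilt μ) := by
    intro μ hf
    refine ⟨?_⟩
    have := hf 1 one_pos
    unfold expTilt
    rw [withDensity_apply _ MeasurableSet.univ, Measure.restrict_univ]
    simpa [laplaceTransform] using this.lt_top
  have := fin hf
  have := fin hf'
  apply expTilt_injective
  have hsub : ∀ {μ : Measure ℝ}, (∀ s, 0 < s → laplaceTransform μ s ≠ ∞) →
      ∀ z : ℂ, z.re < 1 → z.re ∈ interior (integrableExpSet id (expTilt μ)) := by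
    intro μ hf z hz
    have : Iio (1 : ℝ) ⊆ integrableExpSet id (expTilt μ) := fun t ht =>
      integrable_exp_mul_expTilt hf ht
    exact interior_mono this (by rw [isOpen_Iio.interior_eq]; exact hz)
  have hana : ∀ {μ : Measure ℝ}, (∀ s, 0 < s → laplaceTransform μ s ≠ ∞) →
      AnalyticOnNhd ℂ (complexMGF id (expTilt μ)) {z : ℂ | z.re < 1} :=
    fun hf z hz => analyticAt_complexMGF (hsub hf z hz)
  have hconn : IsPreconnected {z : ℂ | z.re < 1} :=
    (convex_halfSpace_re_lt 1).isPreconnected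
  have heq : EqOn (complexMGF id (expTilt μ)) (complexMGF id (expTilt ν)) {z : ℂ | z.re < 1} := by
    refine (hana hf).eqOn_of_preconnected_of_frequently_eq (hana hf') hconn
      (z₀ := 0) (by simp) ?_
    have hreal : ∀ t : ℝ, t < 1 →
        complexMGF id (expTilt μ) (t : ℂ) = complexMGF id (expTilt ν) (t : ℂ) := by
      intro t ht
      rw [complexMGF_ofReal, complexMGF_ofReal, mgf_expTilt, mgf_expTilt, h _ (by linarith)]
    have hlim : Tendsto (fun n : ℕ => (((-1 / ((n : ℝ) + 1) : ℝ)) : ℂ)) atTop (𝓝[≠] 0) := by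
      refine tendsto_nhdsWithin_iff.2 ⟨?_, Eventually.of_forall fun n => ?_⟩
      · have h1 : Tendsto (fun n : ℕ => (-1 / ((n : ℝ) + 1) : ℝ)) atTop (𝓝 0) := by
          have := (tendsto_one_div_add_atTop_nhds_zero_nat (𝕜 := ℝ)).neg
          simpa [neg_div] using this
        exact (Complex.continuous_ofReal.tendsto' 0 0 (by simp)).comp h1
      · simp only [mem_compl_iff, mem_singleton_iff, Complex.ofReal_eq_zero]
        have : (n : ℝ) + 1 ≠ 0 := by positivity
        simp [this]
    refine hlim.frequently (Frequently.of_forall fun n => hreal _ ?_)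
    have : 0 < (n : ℝ) + 1 := by positivity
    calc -1 / ((n : ℝ) + 1) ≤ 0 := by
          rw [neg_div]; simp only [Left.neg_nonpos_iff]; positivity
      _ < 1 := one_pos
  refine Measure.ext_of_charFun ?_
  ext t
  rw [← complexMGF_id_mul_I, ← complexMGF_id_mul_I]
  exact heq (by simp)

/-- Convolution with an absolutely continuous measure, in terms of densities. -/
lemma conv_withDensity (μ : Measure ℝ) [SFinite μ] {κ : ℝ → ℝ≥0∞} (hκ : Measurable κ)
    [SFinite ((volume : Measure ℝ).withDensity κ)] :
    μ ∗ ((volume : Measure ℝ).withDensity κ) =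
      (volume : Measure ℝ).withDensity fun t => ∫⁻ y, κ (t - y) ∂μ := by
  refine Measure.ext_of_lintegral _ fun f hf => ?_
  rw [Measure.lintegral_conv hf, lintegral_withDensity_eq_lintegral_mul _ ?_ hf]
  · calc ∫⁻ x, ∫⁻ y, f (x + y) ∂(volume.withDensity κ) ∂μ
        = ∫⁻ x, (∫⁻ t, κ (t - x) * f t ∂volume) ∂μ := by
          refine lintegral_congr fun x => ?_
          rw [lintegral_withDensity_eq_lintegral_mul _ hκ (by fun_prop),
            ← lintegral_add_right_eq_self (μ := (volume : Measure ℝ))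
              (fun t => κ (t - x) * f t) x]
          refine lintegral_congr fun y => ?_
          simp [add_comm]
      _ = ∫⁻ t, (∫⁻ x, κ (t - x) * f t ∂μ) ∂volume := by
          refine lintegral_lintegral_swap (Measurable.aemeasurable ?_)
          unfold Function.uncurry
          fun_prop
      _ = _ := by
          refine lintegral_congr fun t => ?_
          rw [lintegral_mul_const _ (by fun_prop)]
          rfl
  · exact Measurable.lintegral_prod_right' (f := fun p : ℝ × ℝ => κ (p.1 - p.2)) (by fun_prop)

/-! ### Lévy measures of subordinators -/

section LevyMeasure

variable {M : Measure ℝ}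

lemma IsSubordinatorLevyMeasure.measure_Ioi_lt_top (hM : IsSubordinatorLevyMeasure M) {s : ℝ}
    (hs : 0 < s) : M (Ioi s) < ∞ := by
  have h1 : ENNReal.ofReal (min 1 s) * M (Ioi s) ≤ ∫⁻ z, min 1 (ENNReal.ofReal z) ∂M := by
    calc ENNReal.ofReal (min 1 s) * M (Ioi s) = ∫⁻ _ in Ioi s, ENNReal.ofReal (min 1 s) ∂M := by
          simp
      _ ≤ ∫⁻ z in Ioi s, min 1 (ENNReal.ofReal z) ∂M := by
          refine setLIntegral_mono (by fun_prop) fun z hz => ?_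
          rw [← ENNReal.ofReal_one, ← ENNReal.ofReal_min]
          exact ENNReal.ofReal_le_ofReal (min_le_min le_rfl (le_of_lt hz))
      _ ≤ _ := setLIntegral_le_lintegral _ _
  have h2 := h1.trans_lt hM.lintegral_min_lt_top
  have h3 : ENNReal.ofReal (min 1 s) ≠ 0 := by
    simp [hs]
  by_contra hcon
  rw [not_lt, top_le_iff] at hcon
  rw [hcon, ENNReal.mul_top h3] at h2
  exact lt_irrefl _ h2

lemma IsSubordinatorLevyMeasure.sigmaFinite (hM : IsSubordinatorLevyMeasure M) :
    SigmaFinite M := by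
  refine ⟨⟨⟨fun n => Iic 0 ∪ Ioi (1 / ((n : ℝ) + 1)), fun _ => trivial, fun n => ?_, ?_⟩⟩⟩
  · refine (measure_union_le _ _).trans_lt ?_
    rw [hM.nonpos_null, zero_add]
    exact hM.measure_Ioi_lt_top (by positivity)
  · refine eq_univ_of_forall fun x => ?_
    rcases le_or_gt x 0 with hx | hx
    · exact mem_iUnion.2 ⟨0, Or.inl hx⟩
    · obtain ⟨n, hn⟩ := exists_nat_one_div_lt hx
      exact mem_iUnion.2 ⟨n, Or.inr hn⟩

lemma IsSubordinatorLevyMeasure.ae_pos (hM : IsSubordinatorLevyMeasure M) :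
    ∀ᵐ z ∂M, 0 < z := by
  rw [ae_iff]
  simpa [Iic_def] using hM.nonpos_null

lemma IsSubordinatorLevyMeasure.restrict_Ioi (hM : IsSubordinatorLevyMeasure M) :
    M.restrict (Ioi 0) = M :=
  Measure.restrict_eq_self_of_ae_mem hM.ae_pos

lemma one_sub_exp_neg_nonneg {r z : ℝ} (hr : 0 ≤ r) (hz : 0 ≤ z) :
    0 ≤ 1 - Real.exp (-(r * z)) := by
  have : Real.exp (-(r * z)) ≤ 1 := Real.exp_le_one_iff.2 (by simp; positivity)
  linarith

lemma IsSubordinatorLevyMeasure.integrable_one_sub_exp (hM : IsSubordinatorLevyMeasure M)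
    {r : ℝ} (hr : 0 ≤ r) : Integrable (fun z => 1 - Real.exp (-(r * z))) M := by
  refine ⟨by fun_prop, ?_⟩
  unfold HasFiniteIntegral
  calc ∫⁻ z, ‖1 - Real.exp (-(r * z))‖ₑ ∂M
      ≤ ∫⁻ z, ENNReal.ofReal (1 + r) * min 1 (ENNReal.ofReal z) ∂M := by
        refine lintegral_mono_ae ?_
        filter_upwards [hM.ae_pos] with z hz
        rw [Real.enorm_of_nonneg (one_sub_exp_neg_nonneg hr hz.le), ← ENNReal.ofReal_one,
          ← ENNReal.ofReal_min, ← ENNReal.ofReal_mul (by positivity)]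
        refine ENNReal.ofReal_le_ofReal ?_
        have h1 : 1 - r * z ≤ Real.exp (-(r * z)) := by
          linarith [Real.add_one_le_exp (-(r * z))]
        have h2 := Real.exp_pos (-(r * z))
        rcases le_total 1 z with h | h
        · rw [min_eq_left h]; nlinarith
        · rw [min_eq_right h]; nlinarith
    _ = ENNReal.ofReal (1 + r) * ∫⁻ z, min 1 (ENNReal.ofReal z) ∂M := by
        rw [lintegral_const_mul _ (by fun_prop)]
    _ < ∞ := ENNReal.mul_lt_top ENNReal.ofReal_lt_top hM.lintegral_min_lt_top

lemma IsSubordinatorLevyMeasure.laplaceExponent_eq (hM : IsSubordinatorLevyMeasure M) (b r : ℝ) :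
    laplaceExponent b M r = b * r + ∫ z, (1 - Real.exp (-(r * z))) ∂M := by
  unfold laplaceExponent
  rw [hM.restrict_Ioi]

lemma IsSubordinatorLevyMeasure.integral_one_sub_exp_nonneg (hM : IsSubordinatorLevyMeasure M)
    {r : ℝ} (hr : 0 ≤ r) : 0 ≤ ∫ z, (1 - Real.exp (-(r * z))) ∂M := by
  refine integral_nonneg_of_ae ?_
  filter_upwards [hM.ae_pos] with z hz using one_sub_exp_neg_nonneg hr hz.le

lemma IsSubordinatorLevyMeasure.laplaceExponent_nonneg (hM : IsSubordinatorLevyMeasure M)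
    {b r : ℝ} (hb : 0 ≤ b) (hr : 0 ≤ r) : 0 ≤ laplaceExponent b M r := by
  rw [hM.laplaceExponent_eq]
  have := hM.integral_one_sub_exp_nonneg hr
  positivity

lemma IsSubordinatorLevyMeasure.ofReal_laplaceExponent (hM : IsSubordinatorLevyMeasure M)
    {r : ℝ} (hr : 0 ≤ r) : ENNReal.ofReal (laplaceExponent 0 M r) =
      ∫⁻ z, ENNReal.ofReal (1 - Real.exp (-(r * z))) ∂M := by
  rw [hM.laplaceExponent_eq, zero_mul, zero_add,
    ofReal_integral_eq_lintegral_ofReal (hM.integrable_one_sub_exp hr)]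
  filter_upwards [hM.ae_pos] with z hz using one_sub_exp_neg_nonneg hr hz.le

lemma IsSubordinatorLevyMeasure.laplaceExponent_pos (hM : IsSubordinatorLevyMeasure M)
    (hM0 : M (Ioi 0) ≠ 0) {r : ℝ} (hr : 0 < r) : 0 < laplaceExponent 0 M r := by
  rw [hM.laplaceExponent_eq, zero_mul, zero_add]
  rw [integral_pos_iff_support_of_nonneg_ae ?_ (hM.integrable_one_sub_exp hr.le)]
  · refine (pos_iff_ne_zero.2 hM0).trans_le (measure_mono fun z hz => ?_)
    have hz : 0 < z := hz
    have : Real.exp (-(r * z)) < 1 := by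
      rw [← Real.exp_zero, Real.exp_lt_exp]
      have := mul_pos hr hz
      linarith
    simp only [Function.mem_support]
    linarith
  · filter_upwards [hM.ae_pos] with z hz using one_sub_exp_neg_nonneg hr.le hz.le

lemma lintegral_exp_neg_Ioi {s : ℝ} (hs : 0 < s) (a : ℝ) :
    ∫⁻ x in Ioi a, ENNReal.ofReal (Real.exp (-(s * x))) =
      ENNReal.ofReal (Real.exp (-(s * a)) / s) := by
  have h := integral_exp_mul_Ioi (neg_lt_zero.2 hs) a
  have hi := integrableOn_exp_mul_Ioi (neg_lt_zero.2 hs) a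
  simp only [neg_mul] at h hi
  rw [← ofReal_integral_eq_lintegral_ofReal hi (ae_of_all _ fun x => (Real.exp_pos _).le), h,
    neg_div_neg_eq]

lemma lintegral_exp_neg_Ico {s z : ℝ} (hs : 0 < s) (hz : 0 ≤ z) :
    ∫⁻ x in Ico 0 z, ENNReal.ofReal (Real.exp (-(s * x))) =
      ENNReal.ofReal ((1 - Real.exp (-(s * z))) / s) := by
  have h1 := lintegral_exp_neg_Ioi hs 0
  have h2 := lintegral_exp_neg_Ioi hs z
  have h3 : ∫⁻ x in Ioi 0, ENNReal.ofReal (Real.exp (-(s * x))) =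
      (∫⁻ x in Ico 0 z, ENNReal.ofReal (Real.exp (-(s * x)))) +
        ∫⁻ x in Ioi z, ENNReal.ofReal (Real.exp (-(s * x))) := by
    rw [← Ioc_union_Ioi_eq_Ioi hz, lintegral_union measurableSet_Ioi
      (Ioc_disjoint_Ioi le_rfl)]
    congr 1
    exact setLIntegral_congr Ico_ae_eq_Ioc.symm
  rw [h1, h2] at h3
  rw [sub_div, ENNReal.ofReal_sub _ (by positivity)]
  refine (ENNReal.sub_eq_of_eq_add ENNReal.ofReal_ne_top ?_).symm
  simpa using h3

/-- Integrating the tail of a measure against `e^{-s x}` (Tonelli). -/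
lemma IsSubordinatorLevyMeasure.lintegral_exp_mul_tail (hM : IsSubordinatorLevyMeasure M)
    {s : ℝ} (hs : 0 < s) :
    ∫⁻ x in Ici 0, ENNReal.ofReal (Real.exp (-(s * x))) * M (Ioi x) =
      ENNReal.ofReal (laplaceExponent 0 M s / s) := by
  have := hM.sigmaFinite
  calc ∫⁻ x in Ici 0, ENNReal.ofReal (Real.exp (-(s * x))) * M (Ioi x)
      = ∫⁻ x in Ici 0, (∫⁻ z, (Ioi x).indicator
          (fun _ => ENNReal.ofReal (Real.exp (-(s * x)))) z ∂M) := by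
        refine lintegral_congr fun x => ?_
        rw [lintegral_indicator_const measurableSet_Ioi]
    _ = ∫⁻ z, (∫⁻ x in Ici 0, (Ioi x).indicator
          (fun _ => ENNReal.ofReal (Real.exp (-(s * x)))) z) ∂M := by
        refine lintegral_lintegral_swap (Measurable.aemeasurable ?_)
        have : Function.uncurry (fun (x z : ℝ) => (Ioi x).indicator
          (fun _ => ENNReal.ofReal (Real.exp (-(s * x)))) z) =
          {p : ℝ × ℝ | p.1 < p.2}.indicator
            fun p => ENNReal.ofReal (Real.exp (-(s * p.1))) := by
          ext ⟨x, z⟩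
          simp [Function.uncurry, indicator]
        rw [this]
        exact Measurable.indicator (by fun_prop) (measurableSet_lt measurable_fst measurable_snd)
    _ = ∫⁻ z, ENNReal.ofReal ((1 - Real.exp (-(s * z))) / s) ∂M := by
        refine lintegral_congr_ae ?_
        filter_upwards [hM.ae_pos] with z hz
        rw [← lintegral_exp_neg_Ico hs hz.le, ← lintegral_indicator measurableSet_Ici,
          ← lintegral_indicator measurableSet_Ico]
        refine lintegral_congr fun x => ?_
        by_cases h1 : 0 ≤ x <;> by_cases h2 : x < z <;> simp [indicator, h1, h2]
    _ = _ := by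
        rw [ENNReal.ofReal_div_of_pos hs, hM.ofReal_laplaceExponent hs.le, div_eq_mul_inv,
          ← lintegral_mul_const _ (by fun_prop)]
        refine lintegral_congr fun z => ?_
        rw [ENNReal.ofReal_div_of_pos hs, div_eq_mul_inv]

/-- A Lévy measure whose tail is absolutely continuous away from `0` is absolutely continuous. -/
lemma IsSubordinatorLevyMeasure.absolutelyContinuous (hM : IsSubordinatorLevyMeasure M)
    (hac : ∀ r s : ℝ, 0 < r → r ≤ s → AbsolutelyContinuousOnInterval (levyTail M) r s) :
    M ≪ volume := by
  -- The density is minus the derivative of the tail.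
  set g : ℝ → ℝ≥0∞ := fun x => ENNReal.ofReal (-(deriv (levyTail M) x)) with hg
  have hgm : Measurable g := by
    refine ENNReal.measurable_ofReal.comp (measurable_deriv _).neg
  have htail : ∀ r s : ℝ, 0 < r → r ≤ s → M (Ioc r s) = ∫⁻ x in Ioc r s, g x := by
    intro r s hr hrs
    have hI := (hac r s hr hrs).intervalIntegrable_deriv
    have hF := (hac r s hr hrs).integral_deriv_eq_sub
    have hanti : ∀ x ∈ Ioc r s, deriv (levyTail M) x ≤ 0 := by
      intro x hx
      have hx0 : 0 < x := hr.trans hx.1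
      have hmon : AntitoneOn (levyTail M) (Ioi 0) := fun a ha c _ hac => by
        exact ENNReal.toReal_mono (hM.measure_Ioi_lt_top ha).ne (measure_mono (Ioi_subset_Ioi hac))
      have := hmon.derivWithin_nonpos (x := x)
      rwa [derivWithin_of_isOpen isOpen_Ioi hx0] at this
    have h1 : ∫⁻ x in Ioc r s, g x = ENNReal.ofReal (levyTail M r - levyTail M s) := by
      have hI' := (intervalIntegrable_iff_integrableOn_Ioc_of_le hrs).1 hI
      simp only [hg]
      rw [← ofReal_integral_eq_lintegral_ofReal (f := fun x => -deriv (levyTail M) x) hI'.neg]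
      · rw [integral_neg, ← intervalIntegral.integral_of_le hrs, hF]
        congr 1
        ring
      · filter_upwards [ae_restrict_mem measurableSet_Ioc] with x hx
        simpa using hanti x hx
    have h2 : M (Ioi r) = M (Ioc r s) + M (Ioi s) := by
      rw [← Ioc_union_Ioi_eq_Ioi hrs, measure_union (Ioc_disjoint_Ioi le_rfl) measurableSet_Ioi]
    have hs0 := (hM.measure_Ioi_lt_top (hr.trans_le hrs)).ne
    rw [h1]
    unfold levyTail
    rw [ENNReal.ofReal_sub _ ENNReal.toReal_nonneg,
      ENNReal.ofReal_toReal (hM.measure_Ioi_lt_top hr).ne, ENNReal.ofReal_toReal hs0, h2,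
      ENNReal.add_sub_cancel_right hs0]
  have hloc : ∀ n : ℕ, M.restrict (Ioi (1 / ((n : ℝ) + 1))) =
      (volume.withDensity g).restrict (Ioi (1 / ((n : ℝ) + 1))) := by
    intro n
    have hn : 0 < 1 / ((n : ℝ) + 1) := by positivity
    have : IsFiniteMeasure (M.restrict (Ioi (1 / ((n : ℝ) + 1)))) :=
      ⟨by rw [Measure.restrict_apply_univ]; exact hM.measure_Ioi_lt_top hn⟩
    refine Measure.ext_of_Ioc _ _ fun a c hac => ?_
    rw [Measure.restrict_apply measurableSet_Ioc, Measure.restrict_apply measurableSet_Ioc,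
      Ioc_inter_Ioi, withDensity_apply _ measurableSet_Ioc]
    rcases le_total (a ⊔ (1 / ((n : ℝ) + 1))) c with h | h
    · exact htail _ _ (lt_max_of_lt_right hn) h
    · rw [Ioc_eq_empty (not_lt.2 h)]
      simp
  refine Measure.AbsolutelyContinuous.mk fun A hA hA0 => ?_
  have hcov : A ⊆ Iic 0 ∪ ⋃ n : ℕ, A ∩ Ioi (1 / ((n : ℝ) + 1)) := by
    intro x hx
    rcases le_or_gt x 0 with h | h
    · exact Or.inl h
    · obtain ⟨n, hn⟩ := exists_nat_one_div_lt h
      exact Or.inr (mem_iUnion.2 ⟨n, hx, hn⟩)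
  refine measure_mono_null hcov
    (measure_union_null hM.nonpos_null (measure_iUnion_null fun n => ?_))
  rw [← Measure.restrict_apply hA, hloc n, Measure.restrict_apply hA]
  refine measure_mono_null inter_subset_left ?_
  exact withDensity_absolutelyContinuous _ _ hA0

end LevyMeasure

/-! ### The renewal equation -/

section Renewal

variable {M U : Measure ℝ} {r : ℝ}

/-- The kernel `s ↦ M((s, ∞)) + r` on `[0, ∞)`. At `s = 0` it takes the value `M((0, ∞)) + r`, which
is infinite for an infinite measure; this keeps track of atoms. -/
noncomputable def renewalKernel (M : Measure ℝ) (r : ℝ) : ℝ → ℝ≥0∞ :=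
  (Ici 0).indicator fun s => M (Ioi s) + ENNReal.ofReal r

lemma measurable_measure_Ioi (M : Measure ℝ) : Measurable fun s => M (Ioi s) :=
  Antitone.measurable fun _ _ hxy => measure_mono (Ioi_subset_Ioi hxy)

@[fun_prop]
lemma measurable_renewalKernel (M : Measure ℝ) (r : ℝ) : Measurable (renewalKernel M r) :=
  ((measurable_measure_Ioi M).add_const _).indicator measurableSet_Ici

lemma renewalKernel_of_nonneg {s : ℝ} (hs : 0 ≤ s) :
    renewalKernel M r s = M (Ioi s) + ENNReal.ofReal r := by
  simp [renewalKernel, hs]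

lemma renewalKernel_of_neg {s : ℝ} (hs : s < 0) : renewalKernel M r s = 0 := by
  simp [renewalKernel, hs]

lemma laplaceTransform_withDensity {κ : ℝ → ℝ≥0∞} (hκ : Measurable κ) (s : ℝ) :
    laplaceTransform (volume.withDensity κ) s =
      ∫⁻ x, ENNReal.ofReal (Real.exp (-(s * x))) * κ x := by
  unfold laplaceTransform
  rw [lintegral_withDensity_eq_lintegral_mul _ hκ (by fun_prop)]
  refine lintegral_congr fun x => ?_
  simp [mul_comm]

lemma laplaceTransform_Ici {s : ℝ} (hs : 0 < s) :
    laplaceTransform (volume.withDensity ((Ici (0 : ℝ)).indicator 1)) s =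
      ENNReal.ofReal (1 / s) := by
  rw [laplaceTransform_withDensity (measurable_one.indicator measurableSet_Ici)]
  have := lintegral_exp_neg_Ioi hs 0
  rw [mul_zero, neg_zero, Real.exp_zero] at this
  rw [← this, ← setLIntegral_congr (Ioi_ae_eq_Ici (a := (0 : ℝ))).symm,
    ← lintegral_indicator measurableSet_Ici]
  refine lintegral_congr fun x => ?_
  by_cases h : 0 ≤ x <;> simp [h]

lemma laplaceTransform_renewalKernel (hM : IsSubordinatorLevyMeasure M) (hr : 0 ≤ r) {s : ℝ}
    (hs : 0 < s) : laplaceTransform (volume.withDensity (renewalKernel M r)) s =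
      ENNReal.ofReal ((r + laplaceExponent 0 M s) / s) := by
  rw [laplaceTransform_withDensity (measurable_renewalKernel M r)]
  have h1 : ∀ x, ENNReal.ofReal (Real.exp (-(s * x))) * renewalKernel M r x =
      (Ici 0).indicator (fun x => ENNReal.ofReal (Real.exp (-(s * x))) * M (Ioi x)) x +
      (ENNReal.ofReal (Real.exp (-(s * x))) * (Ici (0 : ℝ)).indicator 1 x) * ENNReal.ofReal r := by
    intro x
    by_cases h : 0 ≤ x <;> simp [h, renewalKernel, mul_add]
  simp_rw [h1]
  have hmeas : Measurable fun x : ℝ => ENNReal.ofReal (Real.exp (-(s * x))) := by fun_prop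
  rw [lintegral_add_left, lintegral_mul_const, lintegral_indicator measurableSet_Ici,
    hM.lintegral_exp_mul_tail hs,
    ← laplaceTransform_withDensity (measurable_one.indicator measurableSet_Ici),
    laplaceTransform_Ici hs, ← ENNReal.ofReal_mul (by positivity), ← ENNReal.ofReal_add]
  · congr 1
    ring
  · have := hM.laplaceExponent_nonneg le_rfl hs.le
    positivity
  · positivity
  · exact hmeas.mul (measurable_one.indicator measurableSet_Ici)
  · exact (hmeas.mul (measurable_measure_Ioi M)).indicator measurableSet_Ici

/-- The Laplace transform `1 / (r + Φ)` characterises the potential measure: its convolution with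
the renewal kernel is Lebesgue measure on the half-line. -/
lemma conv_renewalKernel [SFinite U] (hM : IsSubordinatorLevyMeasure M) (hr : 0 < r)
    (hU : ∀ s, 0 < s → laplaceTransform U s = ENNReal.ofReal (1 / (r + laplaceExponent 0 M s))) :
    U ∗ (volume.withDensity (renewalKernel M r)) =
      volume.withDensity ((Ici (0 : ℝ)).indicator 1) := by
  refine (eq_of_laplaceTransform_eq (fun s hs => ?_) fun s hs => ?_).symm
  · rw [laplaceTransform_Ici hs]
    exact ENNReal.ofReal_ne_top
  · have h0 := hM.laplaceExponent_nonneg le_rfl hs.le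
    rw [laplaceTransform_Ici hs, laplaceTransform_conv, hU s hs,
      laplaceTransform_renewalKernel hM hr.le hs, ← ENNReal.ofReal_mul (by positivity)]
    congr 1
    field_simp

lemma ae_lintegral_renewalKernel [SFinite U] (hM : IsSubordinatorLevyMeasure M) (hr : 0 < r)
    (hU : ∀ s, 0 < s → laplaceTransform U s = ENNReal.ofReal (1 / (r + laplaceExponent 0 M s))) :
    ∀ᵐ t : ℝ, ∫⁻ y, renewalKernel M r (t - y) ∂U = (Ici (0 : ℝ)).indicator 1 t := by
  have h := conv_renewalKernel hM hr hU
  rw [conv_withDensity U (measurable_renewalKernel M r)] at h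
  refine (withDensity_eq_iff_of_sigmaFinite ?_ ?_).1 h
  · exact (Measurable.lintegral_prod_right'
      (f := fun p : ℝ × ℝ => renewalKernel M r (p.1 - p.2)) (by fun_prop)).aemeasurable
  · exact (measurable_one.indicator measurableSet_Ici).aemeasurable

/-- The restriction to `(x, ∞)` of the convolution of `U|_{(-∞, x]}` with `M`. If `U` is the
`r`-potential measure of a subordinator with Lévy measure `M`, this is the law of its position after
the jump across `x`, on the event that the jump occurs before an independent exponential time of
rate `r`. -/
noncomputable def jumpMeasure (M U : Measure ℝ) (x : ℝ) : Measure ℝ :=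
  ((U.restrict (Iic x)) ∗ M).restrict (Ioi x)

lemma jumpMeasure_Ioi [SFinite M] {x t : ℝ} (hxt : x ≤ t) :
    jumpMeasure M U x (Ioi t) = ∫⁻ y in Iic x, M (Ioi (t - y)) ∂U := by
  unfold jumpMeasure
  rw [Measure.restrict_apply measurableSet_Ioi, Ioi_inter_Ioi, sup_eq_left.2 hxt,
    ← lintegral_indicator_one measurableSet_Ioi,
    Measure.lintegral_conv (measurable_one.indicator measurableSet_Ioi)]
  refine lintegral_congr fun y => ?_
  have : (fun z => (Ioi t).indicator (1 : ℝ → ℝ≥0∞) (y + z)) = (Ioi (t - y)).indicator 1 := by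
    ext z
    simp only [indicator, mem_Ioi, sub_lt_iff_lt_add', Pi.one_apply]
  rw [this, lintegral_indicator_one measurableSet_Ioi]

lemma setLIntegral_renewalKernel_Iic [SFinite M] {x t : ℝ} (hxt : x ≤ t) :
    ∫⁻ y in Iic x, renewalKernel M r (t - y) ∂U =
      jumpMeasure M U x (Ioi t) + ENNReal.ofReal r * U (Iic x) := by
  rw [jumpMeasure_Ioi hxt]
  have : ∫⁻ y in Iic x, renewalKernel M r (t - y) ∂U =
      ∫⁻ y in Iic x, (M (Ioi (t - y)) + ENNReal.ofReal r) ∂U := by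
    refine setLIntegral_congr_fun measurableSet_Iic fun y hy => ?_
    have hy : y ≤ x := hy
    exact renewalKernel_of_nonneg (by linarith)
  rw [this, lintegral_add_right _ measurable_const]
  simp

/-- A level `x` is regular if the renewal equation holds at `x`. -/
def IsRegularLevel (M U : Measure ℝ) (r x : ℝ) : Prop :=
  ∫⁻ y, renewalKernel M r (x - y) ∂U = 1

lemma lintegral_renewalKernel_eq_Iic (x : ℝ) :
    ∫⁻ y, renewalKernel M r (x - y) ∂U = ∫⁻ y in Iic x, renewalKernel M r (x - y) ∂U := by
  rw [← lintegral_indicator measurableSet_Iic]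
  refine lintegral_congr fun y => ?_
  by_cases h : y ≤ x
  · simp [h]
  · rw [renewalKernel_of_neg (by linarith)]
    simp [h]

lemma IsRegularLevel.jumpMeasure_univ [SFinite M] {x : ℝ} (hx : IsRegularLevel M U r x) :
    jumpMeasure M U x univ + ENNReal.ofReal r * U (Iic x) = 1 := by
  have h := setLIntegral_renewalKernel_Iic (M := M) (U := U) (r := r) (le_refl x)
  rw [← lintegral_renewalKernel_eq_Iic, hx] at h
  have hG : jumpMeasure M U x univ = jumpMeasure M U x (Ioi x) := by
    unfold jumpMeasure
    rw [Measure.restrict_apply_univ, Measure.restrict_apply measurableSet_Ioi, inter_self]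
  rw [hG, ← h]

lemma IsRegularLevel.isFiniteMeasure_jumpMeasure [SFinite M] {x : ℝ}
    (hx : IsRegularLevel M U r x) : IsFiniteMeasure (jumpMeasure M U x) :=
  ⟨(le_self_add.trans_eq hx.jumpMeasure_univ).trans_lt ENNReal.one_lt_top⟩

lemma jumpMeasure_Iic_self (x : ℝ) : jumpMeasure M U x (Iic x) = 0 := by
  unfold jumpMeasure
  rw [Measure.restrict_apply measurableSet_Iic, Iic_inter_Ioi, Ioc_self, measure_empty]

/-- Renewal at the passage over a regular level: above `x`, the measure `U` is the convolution of
the law of the jump across `x` with `U`. -/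
lemma IsRegularLevel.restrict_Ioi_eq_conv [IsFiniteMeasure U] (hM : IsSubordinatorLevyMeasure M)
    (hr : 0 < r)
    (hU : ∀ s, 0 < s → laplaceTransform U s = ENNReal.ofReal (1 / (r + laplaceExponent 0 M s)))
    {x : ℝ} (hx0 : 0 < x) (hx : IsRegularLevel M U r x) :
    U.restrict (Ioi x) = jumpMeasure M U x ∗ U := by
  have := hM.sigmaFinite
  have := hx.isFiniteMeasure_jumpMeasure
  set G := jumpMeasure M U x with hG
  have hmeas := measurable_renewalKernel M r
  have h1 : (U.restrict (Ioi x)) ∗ (volume.withDensity (renewalKernel M r)) =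
      G ∗ (volume.withDensity ((Ici (0 : ℝ)).indicator 1)) := by
    rw [conv_withDensity _ hmeas,
      conv_withDensity _ (measurable_one.indicator measurableSet_Ici)]
    refine withDensity_congr_ae ?_
    filter_upwards [ae_lintegral_renewalKernel hM hr hU] with t ht
    have hGt : ∫⁻ y, (Ici (0 : ℝ)).indicator 1 (t - y) ∂G = G (Iic t) := by
      rw [← lintegral_indicator_one measurableSet_Iic]
      refine lintegral_congr fun y => ?_
      simp only [indicator, mem_Ici, sub_nonneg, mem_Iic, Pi.one_apply]
    rw [hGt]
    rcases le_or_gt t x with htx | htx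
    · rw [measure_mono_null (Iic_subset_Iic.2 htx) (jumpMeasure_Iic_self x)]
      rw [lintegral_eq_zero_iff (by fun_prop)]
      filter_upwards [ae_restrict_mem measurableSet_Ioi] with y hy
      have hy : x < y := hy
      exact renewalKernel_of_neg (by linarith)
    · have hsplit : ∫⁻ y, renewalKernel M r (t - y) ∂U =
          ∫⁻ y in Iic x, renewalKernel M r (t - y) ∂U +
            ∫⁻ y in Ioi x, renewalKernel M r (t - y) ∂U := by
        rw [← lintegral_add_compl _ (measurableSet_Iic (a := x)), compl_Iic]
      have ht0 : 0 ≤ t := (hx0.trans htx).le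
      rw [hsplit, setLIntegral_renewalKernel_Iic htx.le, indicator_of_mem (by exact ht0),
        Pi.one_apply, ← hx.jumpMeasure_univ] at ht
      have hGsplit : G univ = G (Iic t) + G (Ioi t) := by
        rw [← compl_Iic, measure_add_measure_compl measurableSet_Iic]
      have hfin1 : ENNReal.ofReal r * U (Iic x) ≠ ∞ :=
        ENNReal.mul_ne_top ENNReal.ofReal_ne_top (measure_ne_top _ _)
      have hfin2 : G (Ioi t) ≠ ∞ := measure_ne_top _ _
      rw [← hG, hGsplit] at ht
      have hfin : G (Ioi t) + ENNReal.ofReal r * U (Iic x) ≠ ∞ :=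
        ENNReal.add_ne_top.2 ⟨hfin2, hfin1⟩
      rw [add_comm (G (Iic t)), add_right_comm (G (Ioi t)) (G (Iic t))] at ht
      exact (ENNReal.add_right_inj hfin).1 ht
  rw [← conv_renewalKernel hM hr hU] at h1
  have hLU : ∀ s, 0 < s → laplaceTransform U s ≠ ∞ := fun s hs => by
    rw [hU s hs]; exact ENNReal.ofReal_ne_top
  refine eq_of_laplaceTransform_eq (fun s hs => ?_) fun s hs => ?_
  · refine ne_top_of_le_ne_top (hLU s hs) ?_
    exact lintegral_mono' Measure.restrict_le_self le_rfl
  · have h2 := congrArg (fun μ => laplaceTransform μ s) h1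
    simp only [laplaceTransform_conv] at h2
    rw [← mul_assoc, laplaceTransform_renewalKernel hM hr.le hs] at h2
    have h0 := hM.laplaceExponent_nonneg le_rfl hs.le
    have hpos : 0 < (r + laplaceExponent 0 M s) / s := by positivity
    rw [laplaceTransform_conv]
    exact (ENNReal.mul_left_inj (ENNReal.ofReal_pos.2 hpos).ne' ENNReal.ofReal_ne_top).1 h2

lemma exists_isRegularLevel [SFinite U] (hM : IsSubordinatorLevyMeasure M) (hr : 0 < r)
    (hU : ∀ s, 0 < s → laplaceTransform U s = ENNReal.ofReal (1 / (r + laplaceExponent 0 M s)))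
    {t : ℝ} (ht : 0 < t) : ∃ x, 0 < x ∧ x < t ∧ IsRegularLevel M U r x := by
  have h := ae_lintegral_renewalKernel hM hr hU
  have hpos : volume (Ioo 0 t) ≠ 0 := by simp [ht]
  have hfreq : ∃ᵐ x : ℝ, x ∈ Ioo 0 t := frequently_ae_iff.2 hpos
  obtain ⟨x, hx, hx'⟩ := (hfreq.and_eventually h).exists
  refine ⟨x, hx.1, hx.2, ?_⟩
  unfold IsRegularLevel
  rw [hx', indicator_of_mem (by exact hx.1.le), Pi.one_apply]

lemma jumpMeasure_absolutelyContinuous [SFinite M] (hac : M ≪ volume) (x : ℝ) :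
    jumpMeasure M U x ≪ volume :=
  Measure.restrict_le_self.absolutelyContinuous.trans (Measure.conv_absolutelyContinuous hac)

/-- The potential measure of a driftless subordinator whose infinite Lévy measure is absolutely
continuous is itself absolutely continuous. -/
theorem absolutelyContinuous_of_renewal [IsFiniteMeasure U] (hM : IsSubordinatorLevyMeasure M)
    (hM_top : M (Ioi 0) = ∞) (hac : M ≪ volume) (hr : 0 < r) (hU0 : U (Iio 0) = 0)
    (hU : ∀ s, 0 < s → laplaceTransform U s = ENNReal.ofReal (1 / (r + laplaceExponent 0 M s))) :
    U ≪ volume := by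
  have := hM.sigmaFinite
  have hIoi : ∀ x, 0 < x → IsRegularLevel M U r x → U.restrict (Ioi x) ≪ volume := by
    intro x hx0 hx
    have := hx.isFiniteMeasure_jumpMeasure
    rw [hx.restrict_Ioi_eq_conv hM hr hU hx0, Measure.conv_comm]
    exact Measure.conv_absolutelyContinuous (jumpMeasure_absolutelyContinuous hac x)
  -- The kernel is unbounded at `0`, which rules out an atom of `U` at `0`.
  have hzero : U {0} = 0 := by
    by_contra hne
    have hlim : Tendsto (fun n : ℕ => M (Ioi (1 / ((n : ℝ) + 1)))) atTop (𝓝 (M (Ioi 0))) := by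
      have : Ioi (0 : ℝ) = ⋃ n : ℕ, Ioi (1 / ((n : ℝ) + 1)) := by
        ext x
        simp only [mem_Ioi, mem_iUnion]
        refine ⟨fun hx => exists_nat_one_div_lt hx, fun ⟨n, hn⟩ => lt_trans (by positivity) hn⟩
      rw [this]
      refine tendsto_measure_iUnion_atTop fun m n hmn => Ioi_subset_Ioi ?_
      exact one_div_le_one_div_of_le (by positivity) (by gcongr)
    rw [hM_top] at hlim
    obtain ⟨n, hn⟩ := (hlim.eventually (lt_mem_nhds
      (show (U {0})⁻¹ < ∞ from ENNReal.inv_lt_top.2 (pos_iff_ne_zero.2 hne)))).exists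
    obtain ⟨x, hx0, hxt, hx⟩ := exists_isRegularLevel hM hr hU
      (show 0 < 1 / ((n : ℝ) + 1) by positivity)
    have h1 : M (Ioi x) * U {0} ≤ 1 := by
      rw [← show _ = (1 : ℝ≥0∞) from hx]
      calc M (Ioi x) * U {0} = ∫⁻ _ in {0}, M (Ioi x) ∂U := by simp
        _ ≤ ∫⁻ y in {0}, renewalKernel M r (x - y) ∂U := by
            refine setLIntegral_mono (by fun_prop) fun y hy => ?_
            have hy : y = 0 := hy
            rw [hy, sub_zero, renewalKernel_of_nonneg hx0.le]
            exact le_self_add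
        _ ≤ _ := setLIntegral_le_lintegral _ _
    have h2 : (U {0})⁻¹ < M (Ioi x) :=
      hn.trans_le (measure_mono (Ioi_subset_Ioi hxt.le))
    have h3 : (1 : ℝ≥0∞) < M (Ioi x) * U {0} := by
      rw [← ENNReal.inv_mul_cancel hne (measure_ne_top _ _)]
      exact (ENNReal.mul_lt_mul_iff_left hne (measure_ne_top _ _)).2 h2
    exact absurd h1 (not_le.2 h3)
  have hex : ∀ n : ℕ, ∃ x, 0 < x ∧ x < 1 / ((n : ℝ) + 1) ∧ IsRegularLevel M U r x :=
    fun n => exists_isRegularLevel hM hr hU (by positivity)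
  choose x hx0 hxn hx using hex
  refine Measure.AbsolutelyContinuous.mk fun A hA hA0 => ?_
  have hcov : A ⊆ Iio 0 ∪ ({0} ∪ ⋃ n : ℕ, A ∩ Ioi (x n)) := by
    intro y hy
    rcases lt_trichotomy y 0 with h | h | h
    · exact Or.inl h
    · exact Or.inr (Or.inl h)
    · obtain ⟨n, hn⟩ := exists_nat_one_div_lt h
      exact Or.inr (Or.inr (mem_iUnion.2 ⟨n, hy, (hxn n).trans hn⟩))
  refine measure_mono_null hcov (measure_union_null hU0 (measure_union_null hzero
    (measure_iUnion_null fun n => ?_)))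
  rw [← Measure.restrict_apply hA]
  exact hIoi _ (hx0 n) (hx n) hA0

/-- The renewal equation holds at *every* positive level: the subordinator crosses every fixed
level by a jump. -/
theorem lintegral_renewalKernel_eq_one [IsFiniteMeasure U] (hM : IsSubordinatorLevyMeasure M)
    (hac : M ≪ volume) (hr : 0 < r)
    (hU : ∀ s, 0 < s → laplaceTransform U s = ENNReal.ofReal (1 / (r + laplaceExponent 0 M s)))
    {t : ℝ} (ht : 0 < t) : ∫⁻ y, renewalKernel M r (t - y) ∂U = 1 := by
  have := hM.sigmaFinite
  obtain ⟨x, hx0, hxt, hx⟩ := exists_isRegularLevel hM hr hU ht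
  have := hx.isFiniteMeasure_jumpMeasure
  set G := jumpMeasure M U x with hG
  have hGac : G ≪ volume := jumpMeasure_absolutelyContinuous hac x
  have h2 : ∫⁻ y in Ioi x, renewalKernel M r (t - y) ∂U = G (Iic t) := by
    rw [hx.restrict_Ioi_eq_conv hM hr hU hx0, Measure.lintegral_conv (by fun_prop),
      ← lintegral_indicator_one measurableSet_Iic]
    have hae : ∀ᵐ z ∂G, ∫⁻ y, renewalKernel M r (t - z - y) ∂U =
        (Ici (0 : ℝ)).indicator 1 (t - z) := by
      refine hGac.ae_le ?_
      exact (Measure.measurePreserving_sub_left volume t).quasiMeasurePreserving.ae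
        (ae_lintegral_renewalKernel hM hr hU)
    refine lintegral_congr_ae ?_
    filter_upwards [hae] with z hz
    simp_rw [← sub_sub]
    rw [hz]
    simp only [indicator, mem_Ici, sub_nonneg, mem_Iic, Pi.one_apply]
  rw [← lintegral_add_compl _ (measurableSet_Iic (a := x)), compl_Iic,
    setLIntegral_renewalKernel_Iic hxt.le, h2, ← hx.jumpMeasure_univ, ← hG,
    ← measure_add_measure_compl (μ := G) (measurableSet_Iic (a := t)), compl_Iic]
  ring

end Renewal

/-! ### Potential measures and inverse subordinators -/

lemma inverseProcess_nonneg {Ω : Type*} (H : ℝ≥0 → Ω → ℝ) (t : ℝ) (ω : Ω) :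
    0 ≤ inverseProcess H t ω :=
  NNReal.coe_nonneg _

lemma inverseProcess_le {Ω : Type*} {H : ℝ≥0 → Ω → ℝ} {t : ℝ} {s : ℝ≥0} {ω : Ω}
    (h : t < H s ω) : inverseProcess H t ω ≤ s :=
  NNReal.coe_le_coe.2 (csInf_le (OrderBot.bddBelow _) h)

lemma exists_lt_of_inverseProcess_lt {Ω : Type*} {H : ℝ≥0 → Ω → ℝ} {t : ℝ} {ω : Ω}
    (hne : ∃ s, t < H s ω) {c : ℝ≥0}
    (h : inverseProcess H t ω < c) : ∃ s < c, t < H s ω := by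
  obtain ⟨s, hs, hsc⟩ := exists_lt_of_csInf_lt (s := {s : ℝ≥0 | t < H s ω}) hne
    (NNReal.coe_lt_coe.1 h)
  exact ⟨s, hsc, hs⟩

section Potential

variable {Ω : Type*} [MeasurableSpace Ω] {H : ℝ≥0 → Ω → ℝ} {Q : Measure Ω}
  {M : Measure ℝ} {r t : ℝ}

/-- The `r`-potential measure `A ↦ ∫_0^∞ e^{-r s} P(H_s ∈ A) ds`. -/
noncomputable def potentialMeasure (H : ℝ≥0 → Ω → ℝ) (Q : Measure Ω) (r : ℝ) : Measure ℝ :=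
  ((volume.restrict (Ioi (0 : ℝ))).withDensity fun s => ENNReal.ofReal (Real.exp (-(r * s)))).bind
    fun s => Q.map (H s.toNNReal)

lemma IsSubordinator.antitone_measure_le {Φ : ℝ → ℝ} (hH : IsSubordinator H Q Φ) (t : ℝ) :
    Antitone fun s : ℝ => Q {ω | H s.toNNReal ω ≤ t} := by
  intro s s' hss
  refine measure_mono_ae ?_
  filter_upwards [hH.monotone] with ω hω
  intro (h : H s'.toNNReal ω ≤ t)
  exact (hω (Real.toNNReal_le_toNNReal hss)).trans h

lemma IsSubordinator.measurable_map [IsProbabilityMeasure Q] {Φ : ℝ → ℝ}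
    (hH : IsSubordinator H Q Φ) : Measurable fun s : ℝ => Q.map (H s.toNNReal) := by
  have : ∀ s : ℝ, IsProbabilityMeasure (Q.map (H s.toNNReal)) := fun s =>
    Measure.isProbabilityMeasure_map (hH.measurable _).aemeasurable
  refine .measure_of_isPiSystem_of_isProbabilityMeasure (borel_eq_generateFrom_Iic ℝ)
    isPiSystem_Iic ?_
  rintro _ ⟨t, rfl⟩
  simp_rw [Measure.map_apply (hH.measurable _) measurableSet_Iic]
  exact (hH.antitone_measure_le t).measurable

lemma IsSubordinator.lintegral_potentialMeasure [IsProbabilityMeasure Q] {Φ : ℝ → ℝ}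
    (hH : IsSubordinator H Q Φ) {f : ℝ → ℝ≥0∞} (hf : Measurable f) (r : ℝ) :
    ∫⁻ x, f x ∂(potentialMeasure H Q r) =
      ∫⁻ s in Ioi 0, ENNReal.ofReal (Real.exp (-(r * s))) * ∫⁻ ω, f (H s.toNNReal ω) ∂Q := by
  unfold potentialMeasure
  rw [Measure.lintegral_bind hH.measurable_map.aemeasurable hf.aemeasurable,
    lintegral_withDensity_eq_lintegral_mul _ (by fun_prop)
      (show Measurable fun s : ℝ => ∫⁻ x, f x ∂(Q.map (H s.toNNReal)) from
        (Measure.measurable_lintegral hf).comp hH.measurable_map)]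
  refine lintegral_congr fun s => ?_
  simp only [Pi.mul_apply]
  rw [lintegral_map hf (hH.measurable _)]

lemma IsSubordinator.potentialMeasure_apply [IsProbabilityMeasure Q] {Φ : ℝ → ℝ}
    (hH : IsSubordinator H Q Φ) {A : Set ℝ} (hA : MeasurableSet A) (r : ℝ) :
    potentialMeasure H Q r A =
      ∫⁻ s in Ioi 0, ENNReal.ofReal (Real.exp (-(r * s))) * Q (H s.toNNReal ⁻¹' A) := by
  rw [← lintegral_indicator_one hA, hH.lintegral_potentialMeasure (measurable_one.indicator hA)]
  refine lintegral_congr fun s => ?_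
  rw [← lintegral_indicator_one (hH.measurable _ hA)]
  rfl

lemma IsSubordinator.ae_nonneg {Φ : ℝ → ℝ} (hH : IsSubordinator H Q Φ) :
    ∀ᵐ ω ∂Q, ∀ s, 0 ≤ H s ω := by
  filter_upwards [hH.zero, hH.monotone] with ω h0 hm s
  rw [← h0]
  exact hm (zero_le)

lemma IsSubordinator.potentialMeasure_Iio [IsProbabilityMeasure Q] {Φ : ℝ → ℝ}
    (hH : IsSubordinator H Q Φ) (r : ℝ) : potentialMeasure H Q r (Iio 0) = 0 := by
  rw [hH.potentialMeasure_apply measurableSet_Iio]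
  have : ∀ s : ℝ, Q (H s.toNNReal ⁻¹' Iio 0) = 0 := by
    intro s
    refine measure_mono_null ?_ (ae_iff.1 hH.ae_nonneg)
    intro ω (hω : H _ ω < 0) hcon
    exact absurd (hcon _) (not_le.2 hω)
  simp [this]

lemma IsSubordinator.lintegral_exp_neg [IsProbabilityMeasure Q] {Φ : ℝ → ℝ}
    (hH : IsSubordinator H Q Φ) {s : ℝ} (hs : 0 ≤ s) (u : ℝ≥0) :
    ∫⁻ ω, ENNReal.ofReal (Real.exp (-(s * H u ω))) ∂Q =
      ENNReal.ofReal (Real.exp (-(u * Φ s))) := by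
  rw [← hH.laplace u s hs, ofReal_integral_eq_lintegral_ofReal]
  · refine Integrable.of_bound (C := 1) ?_ ?_
    · have := hH.measurable u
      fun_prop
    · filter_upwards [hH.ae_nonneg] with ω hω
      rw [Real.norm_of_nonneg (Real.exp_pos _).le, Real.exp_le_one_iff]
      have := mul_nonneg hs (hω u)
      linarith
  · exact ae_of_all _ fun ω => (Real.exp_pos _).le

lemma IsSubordinator.laplaceTransform_potentialMeasure [IsProbabilityMeasure Q] {Φ : ℝ → ℝ}
    (hH : IsSubordinator H Q Φ) (hr : 0 < r) {s : ℝ} (hs : 0 ≤ s) (hΦ : 0 ≤ Φ s) :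
    laplaceTransform (potentialMeasure H Q r) s = ENNReal.ofReal (1 / (r + Φ s)) := by
  unfold laplaceTransform
  rw [hH.lintegral_potentialMeasure (by fun_prop)]
  have h := lintegral_exp_neg_Ioi (s := r + Φ s) (by positivity) 0
  rw [mul_zero, neg_zero, Real.exp_zero] at h
  rw [← h]
  refine setLIntegral_congr_fun measurableSet_Ioi fun u hu => ?_
  have hu : 0 < u := hu
  rw [hH.lintegral_exp_neg hs, ← ENNReal.ofReal_mul (Real.exp_pos _).le, ← Real.exp_add,
    Real.coe_toNNReal _ hu.le]
  ring_nf

lemma IsSubordinator.potentialMeasure_univ [IsProbabilityMeasure Q] {Φ : ℝ → ℝ}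
    (hH : IsSubordinator H Q Φ) (hr : 0 < r) (hΦ : Φ 0 = 0) :
    potentialMeasure H Q r univ = ENNReal.ofReal (1 / r) := by
  have := hH.laplaceTransform_potentialMeasure hr (s := 0) le_rfl hΦ.ge
  simpa [laplaceTransform, hΦ] using this

lemma laplaceExponent_zero (b : ℝ) (M : Measure ℝ) : laplaceExponent b M 0 = 0 := by
  unfold laplaceExponent
  simp

lemma IsSubordinator.ae_exists_gt [IsProbabilityMeasure Q] {Φ : ℝ → ℝ}
    (hH : IsSubordinator H Q Φ) (hΦ : 0 < Φ 1) (t : ℝ) : ∀ᵐ ω ∂Q, ∃ s, t < H s ω := by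
  rw [ae_iff]
  simp only [not_exists, not_lt]
  have hle : ∀ n : ℕ, Q {ω | ∀ s, H s ω ≤ t} ≤
      ENNReal.ofReal (Real.exp t) * ENNReal.ofReal (Real.exp (-((n : ℝ) * Φ 1))) := by
    intro n
    have h1 := hH.lintegral_exp_neg (s := 1) zero_le_one (n : ℝ≥0)
    simp only [NNReal.coe_natCast, one_mul] at h1
    rw [← h1, ← lintegral_const_mul _ (by have := hH.measurable (n : ℝ≥0); fun_prop)]
    have h2 : Q {ω | ∀ s, H s ω ≤ t} ≤ Q {ω | H (n : ℝ≥0) ω ≤ t} := measure_mono fun ω hω => hω _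
    refine h2.trans ?_
    have hm : MeasurableSet {ω | H (n : ℝ≥0) ω ≤ t} :=
      measurableSet_le (hH.measurable _) measurable_const
    rw [← lintegral_indicator_one hm]
    refine lintegral_mono fun ω => ?_
    by_cases h : H (n : ℝ≥0) ω ≤ t
    · rw [indicator_of_mem (by exact h), ← ENNReal.ofReal_mul (Real.exp_pos _).le, ← Real.exp_add,
        Pi.one_apply, ← ENNReal.ofReal_one]
      exact ENNReal.ofReal_le_ofReal (Real.one_le_exp (by linarith))
    · rw [indicator_of_notMem (by exact h)]
      exact zero_le
  have hlim : Tendsto (fun n : ℕ => ENNReal.ofReal (Real.exp t) *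
      ENNReal.ofReal (Real.exp (-((n : ℝ) * Φ 1)))) atTop (𝓝 0) := by
    have h1 : Tendsto (fun n : ℕ => Real.exp (-((n : ℝ) * Φ 1))) atTop (𝓝 0) :=
      Real.tendsto_exp_neg_atTop_nhds_zero.comp
        (tendsto_natCast_atTop_atTop.atTop_mul_const hΦ)
    have h2 := ENNReal.Tendsto.const_mul (a := ENNReal.ofReal (Real.exp t))
      (ENNReal.tendsto_ofReal h1) (Or.inr ENNReal.ofReal_ne_top)
    simpa using h2
  exact le_antisymm (ge_of_tendsto' hlim hle) (zero_le)

/-- The inverse process only depends on rational times, hence is measurable up to a null set. -/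
lemma IsSubordinator.aemeasurable_inverseProcess [IsProbabilityMeasure Q] {Φ : ℝ → ℝ}
    (hH : IsSubordinator H Q Φ) (hΦ : 0 < Φ 1) (t : ℝ) : AEMeasurable (inverseProcess H t) Q := by
  classical
  refine ⟨fun ω => (⨅ q : ℚ≥0, if t < H (q : ℝ≥0) ω then ((q : ℝ≥0) : ℝ≥0∞) else ⊤).toReal, ?_, ?_⟩
  · refine (Measurable.iInf fun q => ?_).ennreal_toReal
    exact Measurable.ite (measurableSet_lt measurable_const (hH.measurable _)) measurable_const
      measurable_const
  · filter_upwards [hH.monotone, hH.ae_exists_gt hΦ t] with ω hm hne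
    have : (⨅ q : ℚ≥0, if t < H (q : ℝ≥0) ω then ((q : ℝ≥0) : ℝ≥0∞) else ⊤) =
        ((sInf {s : ℝ≥0 | t < H s ω} : ℝ≥0) : ℝ≥0∞) := by
      refine le_antisymm (le_of_forall_gt_imp_ge_of_dense fun c hc => ?_) (le_iInf fun q => ?_)
      · rcases eq_or_ne c ⊤ with rfl | hc'
        · exact le_top
        lift c to ℝ≥0 using hc'
        obtain ⟨s, hsc, hs⟩ := exists_lt_of_inverseProcess_lt hne
          (NNReal.coe_lt_coe.2 (ENNReal.coe_lt_coe.1 hc))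
        obtain ⟨q, hsq, hqc⟩ := exists_rat_btwn (NNReal.coe_lt_coe.2 hsc)
        have hq0 : 0 ≤ q := by exact_mod_cast (s.coe_nonneg.trans hsq.le)
        lift q to ℚ≥0 using hq0
        have hsq' : s ≤ (q : ℝ≥0) := by
          rw [← NNReal.coe_le_coe]; exact_mod_cast hsq.le
        have hqc' : (q : ℝ≥0) ≤ c := by
          rw [← NNReal.coe_le_coe]; exact_mod_cast hqc.le
        refine (iInf_le _ q).trans ?_
        rw [if_pos (hs.trans_le (hm hsq'))]
        exact_mod_cast hqc'
      · split_ifs with h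
        · exact_mod_cast NNReal.coe_le_coe.1 (inverseProcess_le h)
        · exact le_top
    unfold inverseProcess
    rw [this]
    simp

lemma IsSubordinator.lintegral_exp_inverseProcess [IsProbabilityMeasure Q] {Φ : ℝ → ℝ}
    (hH : IsSubordinator H Q Φ) (hΦ : 0 < Φ 1) (hr : 0 < r) (t : ℝ) :
    ∫⁻ ω, ENNReal.ofReal (Real.exp (-(r * inverseProcess H t ω))) ∂Q =
      ∫⁻ s in Ioi 0, ENNReal.ofReal (Real.exp (-(r * s)) * r) * Q {ω | t < H s.toNNReal ω} := by
  obtain ⟨l, hl, hlL⟩ := hH.aemeasurable_inverseProcess hΦ t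
  -- Layer-cake formulas with strict and weak inequality; they enclose the right-hand side.
  have layer : ∀ R : ℝ → ℝ → Prop, MeasurableSet {p : Ω × ℝ | R (l p.1) p.2} →
      (∀ a, 0 ≤ a → ((Ioi 0 ∩ {s | R a s} : Set ℝ) =ᵐ[volume] Ioi a)) →
      ∫⁻ ω, ENNReal.ofReal (Real.exp (-(r * inverseProcess H t ω))) ∂Q =
      ∫⁻ s in Ioi 0, ENNReal.ofReal (Real.exp (-(r * s)) * r) * Q {ω | R (l ω) s} := by
    intro R hR hRa
    have hRs : ∀ s, MeasurableSet {ω | R (l ω) s} := fun s =>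
      hR.preimage (measurable_id.prodMk measurable_const)
    have hRω : ∀ ω, MeasurableSet {s | R (l ω) s} := fun ω =>
      hR.preimage (measurable_const.prodMk measurable_id)
    calc ∫⁻ ω, ENNReal.ofReal (Real.exp (-(r * inverseProcess H t ω))) ∂Q
        = ∫⁻ ω, (∫⁻ s in Ioi 0, {s | R (l ω) s}.indicator
            (fun s => ENNReal.ofReal (Real.exp (-(r * s)) * r)) s) ∂Q := by
          refine lintegral_congr_ae ?_
          filter_upwards [hlL] with ω hω
          have h0 : 0 ≤ l ω := hω ▸ inverseProcess_nonneg H t ω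
          rw [setLIntegral_indicator (hRω ω), inter_comm, setLIntegral_congr (hRa _ h0), hω]
          have h1 := lintegral_exp_neg_Ioi hr (l ω)
          simp_rw [ENNReal.ofReal_mul (Real.exp_pos _).le]
          rw [lintegral_mul_const _ (by fun_prop), h1, ← ENNReal.ofReal_mul (by positivity)]
          congr 1
          field_simp
      _ = ∫⁻ s in Ioi 0, (∫⁻ ω, {s | R (l ω) s}.indicator
            (fun s => ENNReal.ofReal (Real.exp (-(r * s)) * r)) s ∂Q) := by
          refine lintegral_lintegral_swap (Measurable.aemeasurable ?_)
          have : Function.uncurry (fun (ω : Ω) (s : ℝ) => {s | R (l ω) s}.indicator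
              (fun s => ENNReal.ofReal (Real.exp (-(r * s)) * r)) s) =
              {p : Ω × ℝ | R (l p.1) p.2}.indicator
                fun p => ENNReal.ofReal (Real.exp (-(r * p.2)) * r) := by
            ext ⟨ω, s⟩
            simp [Function.uncurry, indicator]
          rw [this]
          exact Measurable.indicator (by fun_prop) hR
      _ = _ := by
          refine lintegral_congr fun s => ?_
          rw [← lintegral_indicator_one (hRs s),
            ← lintegral_const_mul _ (measurable_one.indicator (hRs s))]
          refine lintegral_congr fun ω => ?_
          by_cases h : R (l ω) s <;> simp [indicator, h]
  refine le_antisymm ?_ ?_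
  · rw [layer (fun a s => a < s) (measurableSet_lt (by fun_prop) (by fun_prop)) fun a ha => ?_]
    · refine setLIntegral_mono_ae' measurableSet_Ioi (ae_of_all _ fun s hs => ?_)
      refine mul_le_mul_right (measure_mono_ae ?_) _
      filter_upwards [hlL, hH.monotone, hH.ae_exists_gt hΦ t] with ω hω hm hne
      intro (h : l ω < s)
      rw [← hω, ← Real.coe_toNNReal s (le_of_lt hs)] at h
      obtain ⟨s', hs', hs''⟩ := exists_lt_of_inverseProcess_lt hne h
      exact hs''.trans_le (hm hs'.le)
    · refine Eq.eventuallyEq ?_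
      ext s
      exact ⟨fun h => h.2, fun h => ⟨ha.trans_lt h, h⟩⟩
  · rw [layer (fun a s => a ≤ s) (measurableSet_le (by fun_prop) (by fun_prop)) fun a ha => ?_]
    · refine setLIntegral_mono_ae' measurableSet_Ioi (ae_of_all _ fun s hs => ?_)
      refine mul_le_mul_right (measure_mono_ae ?_) _
      filter_upwards [hlL] with ω hω
      intro (h : t < H s.toNNReal ω)
      have := inverseProcess_le h
      rw [hω, Real.coe_toNNReal s (le_of_lt hs)] at this
      exact this
    · have h1 : (Ioi (0 : ℝ) ∩ {s | a ≤ s} : Set ℝ) =ᵐ[volume] (Ici 0 ∩ Ici a : Set ℝ) :=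
        Ioi_ae_eq_Ici.inter (ae_eq_refl _)
      rw [Ici_inter_Ici, sup_eq_right.2 ha] at h1
      exact h1.trans Ioi_ae_eq_Ici.symm

lemma IsSubordinator.integrable_exp_inverseProcess [IsProbabilityMeasure Q] {Φ : ℝ → ℝ}
    (hH : IsSubordinator H Q Φ) (hΦ : 0 < Φ 1) (hr : 0 ≤ r) (t : ℝ) :
    Integrable (fun ω => Real.exp (-(r * inverseProcess H t ω))) Q := by
  have := hH.aemeasurable_inverseProcess hΦ t
  refine Integrable.of_bound (C := 1) ?_ (ae_of_all _ fun ω => ?_)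
  · exact (Real.measurable_exp.comp_aemeasurable (this.const_mul r).neg).aestronglyMeasurable
  · rw [Real.norm_of_nonneg (Real.exp_pos _).le, Real.exp_le_one_iff]
    have := mul_nonneg hr (inverseProcess_nonneg H t ω)
    linarith

/-- The Laplace transform of the inverse process in terms of the potential measure. -/
theorem IsSubordinator.inverseLaplace_eq [IsProbabilityMeasure Q] {Φ : ℝ → ℝ}
    (hH : IsSubordinator H Q Φ) (hΦ : 0 < Φ 1) (hr : 0 < r) (t : ℝ) :
    ENNReal.ofReal (inverseLaplace H Q t r) =
      ENNReal.ofReal r * potentialMeasure H Q r (Ioi t) := by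
  unfold inverseLaplace
  rw [ofReal_integral_eq_lintegral_ofReal (hH.integrable_exp_inverseProcess hΦ hr.le t)
    (ae_of_all _ fun ω => (Real.exp_pos _).le), hH.lintegral_exp_inverseProcess hΦ hr,
    hH.potentialMeasure_apply measurableSet_Ioi, ← lintegral_const_mul']
  · refine lintegral_congr fun s => ?_
    rw [ENNReal.ofReal_mul (Real.exp_pos _).le]
    simp only [preimage, mem_Ioi]
    ring
  · exact ENNReal.ofReal_ne_top

lemma inverseLaplace_nonneg (H : ℝ≥0 → Ω → ℝ) (Q : Measure Ω) (t r : ℝ) :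
    0 ≤ inverseLaplace H Q t r :=
  integral_nonneg fun _ => (Real.exp_pos _).le

end Potential

/-! ### Absolutely continuous complex functions -/

section AbsolutelyContinuous

open AbsolutelyContinuousOnInterval

lemma absolutelyContinuousOnInterval_of_dist_le {X Y : Type*} [PseudoMetricSpace X]
    [PseudoMetricSpace Y] {f : ℝ → X} {g : ℝ → Y} {a b : ℝ}
    (hf : AbsolutelyContinuousOnInterval f a b)
    (h : ∀ x ∈ uIcc a b, ∀ y ∈ uIcc a b, dist (g x) (g y) ≤ dist (f x) (f y)) :
    AbsolutelyContinuousOnInterval g a b := by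
  refine squeeze_zero' (Eventually.of_forall fun E => Finset.sum_nonneg fun _ _ => dist_nonneg)
    ?_ hf
  have : ∀ᶠ E in totalLengthFilter ⊓ 𝓟 (disjWithin a b), E ∈ disjWithin a b :=
    eventually_inf_principal.2 (Eventually.of_forall fun _ h => h)
  filter_upwards [this] with E hE
  obtain ⟨h1, -⟩ := hE
  exact Finset.sum_le_sum fun i hi => h _ (h1 i hi).1 _ (h1 i hi).2

lemma absolutelyContinuousOnInterval_re {f : ℝ → ℂ} {a b : ℝ}
    (hf : AbsolutelyContinuousOnInterval f a b) :
    AbsolutelyContinuousOnInterval (fun x => (f x).re) a b :=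
  absolutelyContinuousOnInterval_of_dist_le hf fun x _ y _ => by
    rw [Real.dist_eq, Complex.dist_eq, ← Complex.sub_re]
    exact Complex.abs_re_le_norm _

lemma absolutelyContinuousOnInterval_im {f : ℝ → ℂ} {a b : ℝ}
    (hf : AbsolutelyContinuousOnInterval f a b) :
    AbsolutelyContinuousOnInterval (fun x => (f x).im) a b :=
  absolutelyContinuousOnInterval_of_dist_le hf fun x _ y _ => by
    rw [Real.dist_eq, Complex.dist_eq, ← Complex.sub_im]
    exact Complex.abs_im_le_norm _

lemma absolutelyContinuousOnInterval_of_re_im {f : ℝ → ℂ} {a b : ℝ}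
    (hre : AbsolutelyContinuousOnInterval (fun x => (f x).re) a b)
    (him : AbsolutelyContinuousOnInterval (fun x => (f x).im) a b) :
    AbsolutelyContinuousOnInterval f a b := by
  have h := Tendsto.add hre him
  rw [add_zero] at h
  refine squeeze_zero (fun E => Finset.sum_nonneg fun _ _ => dist_nonneg) (fun E => ?_) h
  rw [← Finset.sum_add_distrib]
  refine Finset.sum_le_sum fun i _ => ?_
  rw [Real.dist_eq, Real.dist_eq, Complex.dist_eq, ← Complex.sub_re, ← Complex.sub_im]
  exact Complex.norm_le_abs_re_add_abs_im _

lemma absolutelyContinuousOnInterval_integral {w : ℝ → ℂ} {a b : ℝ}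
    (hw : IntervalIntegrable w volume a b) :
    AbsolutelyContinuousOnInterval (fun x => ∫ y in a..x, w y) a b := by
  have hsub : ∀ x ∈ uIcc a b, IntervalIntegrable w volume a x := fun x hx =>
    hw.mono_set (uIcc_subset_uIcc_left hx)
  have hre : IntervalIntegrable (fun x => (w x).re) volume a b := ⟨hw.1.re, hw.2.re⟩
  have him : IntervalIntegrable (fun x => (w x).im) volume a b := ⟨hw.1.im, hw.2.im⟩
  refine absolutelyContinuousOnInterval_of_re_im ?_ ?_
  · refine absolutelyContinuousOnInterval_of_dist_le
      (hre.absolutelyContinuousOnInterval_intervalIntegral left_mem_uIcc) fun x hx y hy => ?_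
    have h : ∀ x ∈ uIcc a b, (∫ y in a..x, w y).re = ∫ y in a..x, (w y).re := fun x hx =>
      ((Complex.reCLM.intervalIntegral_comp_comm (hsub x hx))).symm
    rw [h x hx, h y hy]
  · refine absolutelyContinuousOnInterval_of_dist_le
      (him.absolutelyContinuousOnInterval_intervalIntegral left_mem_uIcc) fun x hx y hy => ?_
    have h : ∀ x ∈ uIcc a b, (∫ y in a..x, w y).im = ∫ y in a..x, (w y).im := fun x hx =>
      ((Complex.imCLM.intervalIntegral_comp_comm (hsub x hx))).symm
    rw [h x hx, h y hy]

lemma ae_deriv_eq_of_absolutelyContinuous {f : ℝ → ℂ} {a b : ℝ}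
    (hf : AbsolutelyContinuousOnInterval f a b) :
    ∀ᵐ x : ℝ, x ∈ uIcc a b →
      deriv f x = deriv (fun x => (f x).re) x + deriv (fun x => (f x).im) x * Complex.I := by
  filter_upwards [(absolutelyContinuousOnInterval_re hf).ae_differentiableAt,
    (absolutelyContinuousOnInterval_im hf).ae_differentiableAt] with x h1 h2 hx
  have h := ((h1 hx).hasDerivAt.ofReal_comp).add
    ((h2 hx).hasDerivAt.ofReal_comp.mul_const Complex.I)
  have h' : HasDerivAt f (deriv (fun x => (f x).re) x + deriv (fun x => (f x).im) x * Complex.I)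
      x := by
    refine h.congr_of_eventuallyEq (Eventually.of_forall fun y => ?_)
    exact (Complex.re_add_im (f y)).symm
  exact h'.deriv

lemma intervalIntegrable_deriv_of_absolutelyContinuous {f : ℝ → ℂ} {a b : ℝ}
    (hf : AbsolutelyContinuousOnInterval f a b) : IntervalIntegrable (deriv f) volume a b := by
  have h1 : IntervalIntegrable (fun x => ((deriv (fun x => (f x).re) x : ℝ) : ℂ)) volume a b :=
    ⟨(absolutelyContinuousOnInterval_re hf).intervalIntegrable_deriv.1.ofReal,
      (absolutelyContinuousOnInterval_re hf).intervalIntegrable_deriv.2.ofReal⟩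
  have h2 : IntervalIntegrable (fun x => ((deriv (fun x => (f x).im) x : ℝ) : ℂ)) volume a b :=
    ⟨(absolutelyContinuousOnInterval_im hf).intervalIntegrable_deriv.1.ofReal,
      (absolutelyContinuousOnInterval_im hf).intervalIntegrable_deriv.2.ofReal⟩
  refine (h1.add (h2.mul_const Complex.I)).congr_ae ?_
  rw [EventuallyEq, ae_restrict_iff' measurableSet_uIoc]
  filter_upwards [ae_deriv_eq_of_absolutelyContinuous hf] with x hx hxI
  exact (hx (uIoc_subset_uIcc hxI)).symm

lemma integral_deriv_of_absolutelyContinuous {f : ℝ → ℂ} {a b : ℝ}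
    (hf : AbsolutelyContinuousOnInterval f a b) : ∫ x in a..b, deriv f x = f b - f a := by
  have hre := absolutelyContinuousOnInterval_re hf
  have him := absolutelyContinuousOnInterval_im hf
  have h1 : IntervalIntegrable (fun x => ((deriv (fun x => (f x).re) x : ℝ) : ℂ)) volume a b :=
    ⟨hre.intervalIntegrable_deriv.1.ofReal, hre.intervalIntegrable_deriv.2.ofReal⟩
  have h2 : IntervalIntegrable (fun x => ((deriv (fun x => (f x).im) x : ℝ) : ℂ)) volume a b :=
    ⟨him.intervalIntegrable_deriv.1.ofReal, him.intervalIntegrable_deriv.2.ofReal⟩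
  rw [intervalIntegral.integral_congr_ae (g := fun x =>
    ((deriv (fun x => (f x).re) x : ℝ) : ℂ) +
      ((deriv (fun x => (f x).im) x : ℝ) : ℂ) * Complex.I),
    intervalIntegral.integral_add h1 (h2.mul_const _), intervalIntegral.integral_mul_const,
    intervalIntegral.integral_ofReal, intervalIntegral.integral_ofReal, hre.integral_deriv_eq_sub,
    him.integral_deriv_eq_sub]
  · apply Complex.ext <;> simp
  · filter_upwards [ae_deriv_eq_of_absolutelyContinuous hf] with x hx hxI
    exact hx (uIoc_subset_uIcc hxI)

end AbsolutelyContinuous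

lemma integrable_tsum_of_summable_integral_norm {α ι : Type*} [MeasurableSpace α] {μ : Measure α}
    [Countable ι] {F : ι → α → ℂ} (hF : ∀ i, Integrable (F i) μ)
    (hsum : Summable fun i => ∫ a, ‖F i a‖ ∂μ) :
    Integrable (fun a => ∑' i, F i a) μ ∧ ∀ᵐ a ∂μ, Summable fun i => ‖F i a‖ := by
  have hlt : ∫⁻ a, ∑' i, ‖F i a‖ₑ ∂μ < ∞ := by
    rw [lintegral_tsum fun i => (hF i).1.enorm]
    have h1 : ∀ i, ∫⁻ a, ‖F i a‖ₑ ∂μ = ENNReal.ofReal (∫ a, ‖F i a‖ ∂μ) := fun i =>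
      (ofReal_integral_norm_eq_lintegral_enorm (hF i)).symm
    simp_rw [h1]
    rw [← ENNReal.ofReal_tsum_of_nonneg (fun i => integral_nonneg fun a => norm_nonneg _) hsum]
    exact ENNReal.ofReal_lt_top
  have hae : ∀ᵐ a ∂μ, Summable fun i => ‖F i a‖ := by
    filter_upwards [ae_lt_top' (AEMeasurable.tsum fun i => (hF i).1.enorm) hlt.ne]
      with a ha
    have h2 : ∑' i, (‖F i a‖₊ : ℝ≥0∞) ≠ ∞ := ha.ne
    exact NNReal.summable_coe.2 (ENNReal.tsum_coe_ne_top_iff_summable.1 h2)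
  refine ⟨⟨?_, ?_⟩, hae⟩
  · refine aestronglyMeasurable_of_tendsto_ae (atTop : Filter (Finset ι))
      (f := fun s a => ∑ i ∈ s, F i a) (fun s => ?_) ?_
    · exact Finset.aestronglyMeasurable_fun_sum s fun i _ => (hF i).1
    · filter_upwards [hae] with a ha
      exact ha.of_norm.hasSum
  · refine lt_of_le_of_lt (lintegral_mono fun a => ?_) hlt
    by_cases h : Summable fun i => ‖F i a‖
    · rw [← ofReal_norm]
      have : ∑' i, ‖F i a‖ₑ = ENNReal.ofReal (∑' i, ‖F i a‖) := by
        rw [ENNReal.ofReal_tsum_of_nonneg (fun i => norm_nonneg _) h]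
        simp_rw [ofReal_norm]
      rw [this]
      exact ENNReal.ofReal_le_ofReal (norm_tsum_le_tsum_norm h)
    · have : ∑' i, ‖F i a‖ₑ = ∞ := by
        by_contra hne
        have hne : ∑' i, (‖F i a‖₊ : ℝ≥0∞) ≠ ∞ := hne
        exact h (NNReal.summable_coe.2 (ENNReal.tsum_coe_ne_top_iff_summable.1 hne))
      rw [this]
      exact le_top

/-! ### The scalar relaxation equation -/

/-- `H` is a driftless subordinator with infinite, absolutely continuous Lévy measure `M`. -/
structure IsDiffuseSubordinator {Ω : Type*} [MeasurableSpace Ω] (H : ℝ≥0 → Ω → ℝ)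
    (Q : Measure Ω) (M : Measure ℝ) : Prop where
  levy : IsSubordinatorLevyMeasure M
  top : M (Ioi 0) = ∞
  ac : M ≪ volume
  subordinator : IsSubordinator H Q (laplaceExponent 0 M)

/-- The density of the potential measure. -/
noncomputable def potentialDensity {Ω : Type*} [MeasurableSpace Ω] (H : ℝ≥0 → Ω → ℝ)
    (Q : Measure Ω) (r x : ℝ) : ℝ :=
  ((potentialMeasure H Q r).rnDeriv volume x).toReal

lemma measurable_potentialDensity {Ω : Type*} [MeasurableSpace Ω] {H : ℝ≥0 → Ω → ℝ}
    {Q : Measure Ω} {r : ℝ} :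
    Measurable (potentialDensity H Q r) :=
  (Measure.measurable_rnDeriv _ _).ennreal_toReal

lemma potentialDensity_nonneg {Ω : Type*} [MeasurableSpace Ω] {H : ℝ≥0 → Ω → ℝ}
    {Q : Measure Ω} {r : ℝ}
    (x : ℝ) : 0 ≤ potentialDensity H Q r x := ENNReal.toReal_nonneg

lemma IsDiffuseSubordinator.exponent_one_pos {Ω : Type*} [MeasurableSpace Ω] {H : ℝ≥0 → Ω → ℝ}
    {Q : Measure Ω} {M : Measure ℝ} (S : IsDiffuseSubordinator H Q M) :
    0 < laplaceExponent 0 M 1 :=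
  S.levy.laplaceExponent_pos (by rw [S.top]; exact ENNReal.top_ne_zero) one_pos

section Relaxation

variable {Ω : Type*} [MeasurableSpace Ω] {H : ℝ≥0 → Ω → ℝ} {Q : Measure Ω}
  [IsProbabilityMeasure Q] {M : Measure ℝ} {r t : ℝ}

namespace IsDiffuseSubordinator

lemma potentialMeasure_univ (S : IsDiffuseSubordinator H Q M) (hr : 0 < r) :
    potentialMeasure H Q r univ = ENNReal.ofReal (1 / r) :=
  S.subordinator.potentialMeasure_univ hr (laplaceExponent_zero _ _)

lemma isFiniteMeasure_potentialMeasure (S : IsDiffuseSubordinator H Q M) (hr : 0 < r) :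
    IsFiniteMeasure (potentialMeasure H Q r) :=
  ⟨by rw [S.potentialMeasure_univ hr]; exact ENNReal.ofReal_lt_top⟩

lemma laplaceTransform_potentialMeasure (S : IsDiffuseSubordinator H Q M) (hr : 0 < r) {s : ℝ}
    (hs : 0 ≤ s) :
    laplaceTransform (potentialMeasure H Q r) s =
      ENNReal.ofReal (1 / (r + laplaceExponent 0 M s)) :=
  S.subordinator.laplaceTransform_potentialMeasure hr hs (S.levy.laplaceExponent_nonneg le_rfl hs)

lemma potentialMeasure_absolutelyContinuous (S : IsDiffuseSubordinator H Q M) (hr : 0 < r) :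
    potentialMeasure H Q r ≪ volume := by
  have := S.isFiniteMeasure_potentialMeasure hr
  exact absolutelyContinuous_of_renewal S.levy S.top S.ac hr
    (S.subordinator.potentialMeasure_Iio r)
    fun s hs => S.laplaceTransform_potentialMeasure hr hs.le

lemma lintegral_renewalKernel (S : IsDiffuseSubordinator H Q M) (hr : 0 < r) (ht : 0 < t) :
    ∫⁻ y, renewalKernel M r (t - y) ∂(potentialMeasure H Q r) = 1 := by
  have := S.isFiniteMeasure_potentialMeasure hr
  exact lintegral_renewalKernel_eq_one S.levy S.ac hr
    (fun s hs => S.laplaceTransform_potentialMeasure hr hs.le) ht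

lemma potentialMeasure_Iic_zero (S : IsDiffuseSubordinator H Q M) (hr : 0 < r) :
    potentialMeasure H Q r (Iic 0) = 0 := by
  have h0 : potentialMeasure H Q r {0} = 0 :=
    S.potentialMeasure_absolutelyContinuous hr Real.volume_singleton
  rw [← Iio_union_right]
  exact measure_union_null (S.subordinator.potentialMeasure_Iio r) h0

lemma potentialMeasure_eq_withDensity (S : IsDiffuseSubordinator H Q M) (hr : 0 < r) :
    potentialMeasure H Q r =
      volume.withDensity fun x => ENNReal.ofReal (potentialDensity H Q r x) := by
  have := S.isFiniteMeasure_potentialMeasure hr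
  conv_lhs => rw [← Measure.withDensity_rnDeriv_eq _ _ (S.potentialMeasure_absolutelyContinuous hr)]
  refine withDensity_congr_ae ?_
  filter_upwards [Measure.rnDeriv_lt_top (potentialMeasure H Q r) volume] with x hx
  exact (ENNReal.ofReal_toReal hx.ne).symm

lemma potentialMeasure_Iic (S : IsDiffuseSubordinator H Q M) (hr : 0 < r) (ht : 0 ≤ t) :
    potentialMeasure H Q r (Iic t) =
    ∫⁻ x in Ioc 0 t, ENNReal.ofReal (potentialDensity H Q r x) := by
  rw [← Iic_union_Ioc_eq_Iic ht, measure_union (Iic_disjoint_Ioc le_rfl) measurableSet_Ioc,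
    S.potentialMeasure_Iic_zero hr, zero_add]
  conv_lhs => rw [S.potentialMeasure_eq_withDensity hr]
  rw [withDensity_apply _ measurableSet_Ioc]

lemma integrableOn_potentialDensity (S : IsDiffuseSubordinator H Q M) (hr : 0 < r) (t : ℝ) :
    IntegrableOn (potentialDensity H Q r) (Ioc 0 t) := by
  refine ⟨measurable_potentialDensity.aestronglyMeasurable, ?_⟩
  unfold HasFiniteIntegral
  have := S.isFiniteMeasure_potentialMeasure hr
  refine lt_of_eq_of_lt ?_ (measure_lt_top (potentialMeasure H Q r) (Ioc 0 t))
  conv_rhs => rw [S.potentialMeasure_eq_withDensity hr]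
  rw [withDensity_apply _ measurableSet_Ioc]
  refine lintegral_congr fun x => ?_
  rw [Real.enorm_of_nonneg (potentialDensity_nonneg x)]

/-- `E[e^{-r L_t}] = 1 - r ∫₀ᵗ v`, where `v` is the potential density. -/
lemma inverseLaplace_eq (S : IsDiffuseSubordinator H Q M) (hr : 0 < r) (ht : 0 ≤ t) :
    inverseLaplace H Q t r = 1 - r * ∫ x in Ioc 0 t, potentialDensity H Q r x := by
  have := S.isFiniteMeasure_potentialMeasure hr
  have h1 := S.subordinator.inverseLaplace_eq S.exponent_one_pos hr t
  have h2 : potentialMeasure H Q r (Iic t) + potentialMeasure H Q r (Ioi t) =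
      ENNReal.ofReal (1 / r) := by
    rw [← compl_Iic, measure_add_measure_compl measurableSet_Iic, S.potentialMeasure_univ hr]
  have h3 : ∫ x in Ioc 0 t, potentialDensity H Q r x = (potentialMeasure H Q r (Iic t)).toReal := by
    rw [integral_eq_lintegral_of_nonneg_ae (ae_of_all _ fun x => potentialDensity_nonneg x)
      (measurable_potentialDensity.aestronglyMeasurable), S.potentialMeasure_Iic hr ht]
  have h4 := congrArg ENNReal.toReal h1
  have h5 := congrArg ENNReal.toReal h2
  rw [ENNReal.toReal_ofReal (inverseLaplace_nonneg _ _ _ _), ENNReal.toReal_mul,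
    ENNReal.toReal_ofReal hr.le] at h4
  rw [ENNReal.toReal_add (measure_ne_top _ _) (measure_ne_top _ _),
    ENNReal.toReal_ofReal (by positivity)] at h5
  rw [h3, h4]
  field_simp at h5
  linarith

lemma inverseLaplace_zero (S : IsDiffuseSubordinator H Q M) (hr : 0 < r) :
    inverseLaplace H Q 0 r = 1 := by
  rw [S.inverseLaplace_eq hr le_rfl]
  simp

lemma inverseLaplace_le_one (S : IsDiffuseSubordinator H Q M) (hr : 0 < r) (ht : 0 ≤ t) :
    inverseLaplace H Q t r ≤ 1 := by
  rw [S.inverseLaplace_eq hr ht]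
  have : 0 ≤ ∫ x in Ioc 0 t, potentialDensity H Q r x :=
    integral_nonneg fun x => potentialDensity_nonneg x
  nlinarith

/-- Markov's inequality for the potential measure: `E[e^{-r L_t}] = O(1 / r)`. -/
lemma mul_inverseLaplace_le (S : IsDiffuseSubordinator H Q M) (hr : 0 < r) (ht : 0 < t) :
    r * inverseLaplace H Q t r ≤ laplaceExponent 0 M 1 / (1 - Real.exp (-t)) := by
  have := S.isFiniteMeasure_potentialMeasure hr
  set U := potentialMeasure H Q r with hU
  set φ := laplaceExponent 0 M 1 with hφ
  have hφ0 : 0 < φ := S.exponent_one_pos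
  have he : 0 < 1 - Real.exp (-t) := by
    have : Real.exp (-t) < 1 := by rw [← Real.exp_zero, Real.exp_lt_exp]; linarith
    linarith
  have h1 : laplaceTransform U 1 + ENNReal.ofReal (1 - Real.exp (-t)) * U (Ioi t) ≤ U univ := by
    have : ENNReal.ofReal (1 - Real.exp (-t)) * U (Ioi t) =
        ∫⁻ x, (Ioi t).indicator (fun _ => ENNReal.ofReal (1 - Real.exp (-t))) x ∂U := by
      rw [lintegral_indicator_const measurableSet_Ioi]
    rw [this]
    unfold laplaceTransform
    rw [← lintegral_add_left (by fun_prop), ← lintegral_one]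
    refine lintegral_mono_ae ?_
    have hpos : ∀ᵐ x ∂U, 0 < x := by
      rw [ae_iff]
      simpa [Iic_def] using S.potentialMeasure_Iic_zero hr
    filter_upwards [hpos] with x hx
    by_cases hxt : t < x
    · rw [indicator_of_mem (by exact hxt), ← ENNReal.ofReal_add (Real.exp_pos _).le he.le,
        ← ENNReal.ofReal_one]
      refine ENNReal.ofReal_le_ofReal ?_
      have : Real.exp (-(1 * x)) ≤ Real.exp (-t) := Real.exp_le_exp.2 (by linarith)
      linarith
    · rw [indicator_of_notMem (by exact hxt), add_zero, ← ENNReal.ofReal_one]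
      refine ENNReal.ofReal_le_ofReal ?_
      rw [Real.exp_le_one_iff]
      linarith
  rw [S.laplaceTransform_potentialMeasure hr zero_le_one, S.potentialMeasure_univ hr, ← hφ] at h1
  have h2 := ENNReal.toReal_mono ENNReal.ofReal_ne_top h1
  rw [ENNReal.toReal_add ENNReal.ofReal_ne_top
    (ENNReal.mul_ne_top ENNReal.ofReal_ne_top (measure_ne_top _ _)), ENNReal.toReal_mul,
    ENNReal.toReal_ofReal (by positivity), ENNReal.toReal_ofReal he.le,
    ENNReal.toReal_ofReal (by positivity)] at h2
  have h4 := congrArg ENNReal.toReal (S.subordinator.inverseLaplace_eq S.exponent_one_pos hr t)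
  rw [ENNReal.toReal_ofReal (inverseLaplace_nonneg _ _ _ _), ENNReal.toReal_mul,
    ENNReal.toReal_ofReal hr.le, ← hU] at h4
  rw [h4, le_div_iff₀ he]
  have h5 : (1 - Real.exp (-t)) * (U (Ioi t)).toReal ≤ φ / (r * r) := by
    have : 1 / r - 1 / (r + φ) ≤ φ / (r * r) := by
      rw [div_sub_div _ _ hr.ne' (by positivity), div_le_div_iff₀ (by positivity) (by positivity)]
      nlinarith [mul_pos hr hφ0, mul_pos (mul_pos hr hφ0) hφ0, mul_pos (mul_pos hr hr) hφ0]
    linarith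
  calc r * (r * (U (Ioi t)).toReal) * (1 - Real.exp (-t))
      = (r * r) * ((1 - Real.exp (-t)) * (U (Ioi t)).toReal) := by ring
    _ ≤ (r * r) * (φ / (r * r)) := by gcongr
    _ = φ := by field_simp

/-- The relaxation equation `v * M̄ = E[e^{-r L}]`, as a Lebesgue integral. -/
lemma lintegral_density_mul_tail (S : IsDiffuseSubordinator H Q M) (hr : 0 < r) (ht : 0 < t) :
    ∫⁻ s in Ioc 0 t, ENNReal.ofReal (potentialDensity H Q r (t - s)) * M (Ioi s) =
      ENNReal.ofReal (inverseLaplace H Q t r) := by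
  have := S.isFiniteMeasure_potentialMeasure hr
  have hd := S.potentialMeasure_eq_withDensity hr
  have hm : Measurable fun x => ENNReal.ofReal (potentialDensity H Q r x) :=
    measurable_potentialDensity.ennreal_ofReal
  have h1 := S.lintegral_renewalKernel hr ht
  have h2 : ∫⁻ y, renewalKernel M r (t - y) ∂(potentialMeasure H Q r) =
      ENNReal.ofReal r * potentialMeasure H Q r (Iic t) +
        ∫⁻ y in Iic t, M (Ioi (t - y)) ∂(potentialMeasure H Q r) := by
    rw [lintegral_renewalKernel_eq_Iic]
    have : ∫⁻ y in Iic t, renewalKernel M r (t - y) ∂(potentialMeasure H Q r) =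
        ∫⁻ y in Iic t, (ENNReal.ofReal r + M (Ioi (t - y))) ∂(potentialMeasure H Q r) := by
      refine setLIntegral_congr_fun measurableSet_Iic fun y hy => ?_
      have hy : y ≤ t := hy
      rw [renewalKernel_of_nonneg (by linarith), add_comm]
    rw [this, lintegral_add_left measurable_const]
    simp
  have h3 : ∫⁻ y in Iic t, M (Ioi (t - y)) ∂(potentialMeasure H Q r) =
      ∫⁻ s in Ioc 0 t, ENNReal.ofReal (potentialDensity H Q r (t - s)) * M (Ioi s) := by
    have e1 : ∫⁻ y in Iic t, M (Ioi (t - y)) ∂(potentialMeasure H Q r) =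
        ∫⁻ y in Ico 0 t, M (Ioi (t - y)) ∂(potentialMeasure H Q r) := by
      refine setLIntegral_congr (EventuallyLE.antisymm ?_ (Eventually.of_forall
        fun y hy => show y ≤ t from hy.2.le))
      have hpos : ∀ᵐ x ∂(potentialMeasure H Q r), x ∉ Iic (0 : ℝ) :=
        measure_eq_zero_iff_ae_notMem.1 (S.potentialMeasure_Iic_zero hr)
      have hne : ∀ᵐ x ∂(potentialMeasure H Q r), x ∉ ({t} : Set ℝ) :=
        measure_eq_zero_iff_ae_notMem.1
          (S.potentialMeasure_absolutelyContinuous hr Real.volume_singleton)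
      filter_upwards [hpos, hne] with y h1 h2 h3
      have h3 : y ≤ t := h3
      exact ⟨(not_le.1 h1).le, lt_of_le_of_ne h3 h2⟩
    have hm2 : Measurable fun y => M (Ioi (t - y)) :=
      (measurable_measure_Ioi M).comp (by fun_prop : Measurable fun y : ℝ => t - y)
    rw [e1]
    conv_lhs => rw [hd]
    rw [setLIntegral_withDensity_eq_setLIntegral_mul _ hm hm2 measurableSet_Ico,
      ← lintegral_indicator measurableSet_Ico, ← lintegral_indicator measurableSet_Ioc,
      ← lintegral_sub_left_eq_self _ t]
    refine lintegral_congr fun s => ?_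
    by_cases h : s ∈ Ioc 0 t
    · have h' : t - s ∈ Ico 0 t := ⟨by linarith [h.2], by linarith [h.1]⟩
      rw [indicator_of_mem h, indicator_of_mem h']
      simp
    · have h' : t - s ∉ Ico 0 t := fun hc => h ⟨by linarith [hc.2], by linarith [hc.1]⟩
      rw [indicator_of_notMem h, indicator_of_notMem h']
  have h4 : ENNReal.ofReal r * potentialMeasure H Q r (Iic t) +
      ENNReal.ofReal (inverseLaplace H Q t r) = 1 := by
    rw [S.subordinator.inverseLaplace_eq S.exponent_one_pos hr t, ← mul_add, ← compl_Iic,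
      measure_add_measure_compl measurableSet_Iic, S.potentialMeasure_univ hr,
      ← ENNReal.ofReal_mul hr.le, mul_one_div_cancel hr.ne', ENNReal.ofReal_one]
  rw [h2, h3, ← h4] at h1
  exact (ENNReal.add_right_inj
    (ENNReal.mul_ne_top ENNReal.ofReal_ne_top (measure_ne_top _ _))).1 h1

lemma integrableOn_density_mul_tail (S : IsDiffuseSubordinator H Q M) (hr : 0 < r) (ht : 0 < t) :
    IntegrableOn (fun s => potentialDensity H Q r (t - s) * levyTail M s) (Ioc 0 t) ∧
      ∫ s in Ioc 0 t, potentialDensity H Q r (t - s) * levyTail M s = inverseLaplace H Q t r := by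
  have hm : Measurable fun s => potentialDensity H Q r (t - s) * levyTail M s :=
    (measurable_potentialDensity.comp (by fun_prop : Measurable fun s : ℝ => t - s)).mul
      (measurable_measure_Ioi M).ennreal_toReal
  have hnn : ∀ s, 0 ≤ potentialDensity H Q r (t - s) * levyTail M s := fun s =>
    mul_nonneg (potentialDensity_nonneg _) ENNReal.toReal_nonneg
  have h1 : ∫⁻ s in Ioc 0 t, ENNReal.ofReal (potentialDensity H Q r (t - s) * levyTail M s) =
      ENNReal.ofReal (inverseLaplace H Q t r) := by
    rw [← S.lintegral_density_mul_tail hr ht]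
    refine setLIntegral_congr_fun measurableSet_Ioc fun s hs => ?_
    rw [ENNReal.ofReal_mul (potentialDensity_nonneg _), levyTail,
      ENNReal.ofReal_toReal (S.levy.measure_Ioi_lt_top hs.1).ne]
  constructor
  · refine ⟨hm.aestronglyMeasurable, ?_⟩
    unfold HasFiniteIntegral
    simp_rw [Real.enorm_of_nonneg (hnn _)]
    rw [h1]
    exact ENNReal.ofReal_lt_top
  · rw [integral_eq_lintegral_of_nonneg_ae (ae_of_all _ hnn) hm.aestronglyMeasurable, h1,
      ENNReal.toReal_ofReal (inverseLaplace_nonneg _ _ _ _)]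

end IsDiffuseSubordinator

end Relaxation

section Relaxation

variable {Ω : Type*} [MeasurableSpace Ω] {H : ℝ≥0 → Ω → ℝ} {Q : Measure Ω}
  [IsProbabilityMeasure Q] {M : Measure ℝ} {r t : ℝ}

namespace IsDiffuseSubordinator

/-- Superpositions of the relaxation functions `t ↦ E[e^{-r L_t}]` can be differentiated termwise
in the sense of the convolution-type derivative. -/
theorem hasConvDeriv_tsum (S : IsDiffuseSubordinator H Q M) {ι : Type*} [Countable ι] {c : ι → ℂ}
    {r : ι → ℝ} (hc : Summable fun i => ‖c i‖) (hr : ∀ i, 0 < r i) (ht : 0 < t) {f : ℝ → ℂ}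
    (hf : ∀ s, 0 ≤ s → f s = ∑' i, c i * inverseLaplace H Q s (r i)) :
    HasConvDeriv M f t (-∑' i, c i * (r i * inverseLaplace H Q t (r i) : ℝ)) := by
  set v : ι → ℝ → ℝ := fun i => potentialDensity H Q (r i) with hv
  set F : ι → ℝ → ℂ := fun i x => c i * (r i * v i x : ℝ) with hF
  set w : ℝ → ℂ := fun x => ∑' i, F i x with hw
  have hv0 : ∀ i x, 0 ≤ r i * v i x := fun i x => mul_nonneg (hr i).le (potentialDensity_nonneg x)
  have hvI : ∀ i s, IntegrableOn (fun x => r i * v i x) (Ioc 0 s) := fun i s =>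
    (S.integrableOn_potentialDensity (hr i) s).const_mul _
  have hvint : ∀ i s, 0 ≤ s → ∫ x in Ioc 0 s, r i * v i x = 1 - inverseLaplace H Q s (r i) := by
    intro i s hs
    rw [integral_const_mul, S.inverseLaplace_eq (hr i) hs]
    ring
  have hFI : ∀ i s, IntegrableOn (F i) (Ioc 0 s) := fun i s => (hvI i s).ofReal.const_mul _
  have hFn : ∀ i x, ‖F i x‖ = ‖c i‖ * (r i * v i x) := fun i x => by
    simp only [hF]
    rw [norm_mul, Complex.norm_real, Real.norm_of_nonneg (hv0 i x)]
  have hle : ∀ i s, 0 ≤ s → ‖c i‖ * (1 - inverseLaplace H Q s (r i)) ≤ ‖c i‖ := fun i s hs => by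
    have := inverseLaplace_nonneg H Q s (r i)
    have := norm_nonneg (c i)
    nlinarith
  have hFsum : ∀ s, 0 ≤ s → Summable fun i => ∫ x in Ioc 0 s, ‖F i x‖ := by
    intro s hs
    have hint : ∀ i, ∫ x in Ioc 0 s, ‖F i x‖ = ‖c i‖ * (1 - inverseLaplace H Q s (r i)) := by
      intro i
      simp_rw [hFn]
      rw [integral_const_mul, hvint i s hs]
    simp_rw [hint]
    refine hc.of_nonneg_of_le (fun i => ?_) fun i => ?_
    · have := S.inverseLaplace_le_one (hr i) hs
      exact mul_nonneg (norm_nonneg _) (by linarith)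
    · exact hle i s hs
  have hwI : ∀ s, 0 ≤ s → IntegrableOn w (Ioc 0 s) := fun s hs =>
    (integrable_tsum_of_summable_integral_norm (fun i => hFI i s) (hFsum s hs)).1
  have hcu : ∀ s, 0 ≤ s → Summable fun i => c i * inverseLaplace H Q s (r i) := by
    intro s hs
    refine Summable.of_norm (hc.of_nonneg_of_le (fun i => norm_nonneg _) fun i => ?_)
    rw [norm_mul, Complex.norm_real, Real.norm_of_nonneg (inverseLaplace_nonneg _ _ _ _)]
    exact mul_le_of_le_one_right (norm_nonneg _) (S.inverseLaplace_le_one (hr i) hs)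
  have hfw : ∀ s, 0 ≤ s → f s = (∑' i, c i) - ∫ x in (0 : ℝ)..s, w x := by
    intro s hs
    have h1 := hasSum_integral_of_summable_integral_norm (fun i => hFI i s) (hFsum s hs)
    have h2 : ∀ i, ∫ x in Ioc 0 s, F i x = c i - c i * inverseLaplace H Q s (r i) := by
      intro i
      simp only [hF]
      rw [integral_const_mul, integral_complex_ofReal, hvint i s hs]
      push_cast
      ring
    rw [intervalIntegral.integral_of_le hs, ← h1.tsum_eq, hf s hs]
    simp_rw [h2]
    rw [(hc.of_norm).tsum_sub (hcu s hs)]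
    ring
  have hwII : IntervalIntegrable w volume 0 t :=
    (intervalIntegrable_iff_integrableOn_Ioc_of_le ht.le).2 (hwI t ht.le)
  have hac : AbsolutelyContinuousOnInterval f 0 t := by
    refine absolutelyContinuousOnInterval_of_dist_le (absolutelyContinuousOnInterval_integral hwII)
      fun x hx y hy => ?_
    rw [uIcc_of_le ht.le] at hx hy
    rw [hfw x hx.1, hfw y hy.1, dist_sub_left]
  have hderiv : ∀ᵐ x : ℝ, x ∈ Ioo 0 t → deriv f x = -w x := by
    filter_upwards [hwII.ae_hasDerivAt_integral] with x hx hx'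
    have h1 := hx (by rw [uIcc_of_le ht.le]; exact ⟨hx'.1.le, hx'.2.le⟩) 0 left_mem_uIcc
    have h2 : HasDerivAt f (-w x) x := by
      refine (h1.const_sub (∑' i, c i)).congr_of_eventuallyEq ?_
      filter_upwards [lt_mem_nhds hx'.1] with y hy using hfw y (le_of_lt hy)
    exact h2.deriv
  -- Termwise convolution with the tail.
  set G : ι → ℝ → ℂ := fun i s => (c i * r i) * (v i (t - s) * levyTail M s : ℝ) with hG
  have hGI : ∀ i, IntegrableOn (G i) (Ioc 0 t) := fun i =>
    (S.integrableOn_density_mul_tail (hr i) ht).1.ofReal.const_mul _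
  have hGint : ∀ i, ∫ s in Ioc 0 t, G i s = c i * (r i * inverseLaplace H Q t (r i) : ℝ) := by
    intro i
    simp only [hG]
    rw [integral_const_mul, integral_complex_ofReal,
      (S.integrableOn_density_mul_tail (hr i) ht).2]
    push_cast
    ring
  have hGsum : Summable fun i => ∫ s in Ioc 0 t, ‖G i s‖ := by
    have : ∀ i, ∫ s in Ioc 0 t, ‖G i s‖ = ‖c i‖ * (r i * inverseLaplace H Q t (r i)) := by
      intro i
      have h1 : ∀ s, ‖G i s‖ = ‖c i‖ * r i * (v i (t - s) * levyTail M s) := by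
        intro s
        simp only [hG]
        rw [norm_mul, norm_mul, Complex.norm_real, Complex.norm_real, Real.norm_of_nonneg (hr i).le,
          Real.norm_of_nonneg]
        exact mul_nonneg (potentialDensity_nonneg _) ENNReal.toReal_nonneg
      simp_rw [h1]
      rw [integral_const_mul, (S.integrableOn_density_mul_tail (hr i) ht).2]
      ring
    simp_rw [this]
    refine (hc.mul_right (laplaceExponent 0 M 1 / (1 - Real.exp (-t)))).of_nonneg_of_le
      (fun i => ?_) fun i => ?_
    · exact mul_nonneg (norm_nonneg _) (mul_nonneg (hr i).le (inverseLaplace_nonneg _ _ _ _))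
    · exact mul_le_mul_of_nonneg_left (S.mul_inverseLaplace_le (hr i) ht) (norm_nonneg _)
  have hGw : ∀ᵐ s : ℝ, s ∈ Ioc 0 t → deriv f (t - s) * (levyTail M s : ℂ) = -∑' i, G i s := by
    have h1 := (Measure.measurePreserving_sub_left volume t).quasiMeasurePreserving.ae hderiv
    have h2 : ∀ᵐ s : ℝ, s ≠ t := by
      rw [ae_iff]; simp
    filter_upwards [h1, h2] with s hs hst hsI
    rw [hs ⟨by linarith [lt_of_le_of_ne hsI.2 hst], by linarith [hsI.1]⟩, neg_mul, hw]
    simp only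
    rw [← tsum_mul_right]
    congr 1
    refine tsum_congr fun i => ?_
    simp only [hF, hG]
    push_cast
    ring
  refine ⟨hac, ?_, ?_⟩
  · rw [intervalIntegrable_iff_integrableOn_Ioc_of_le ht.le]
    refine (integrable_tsum_of_summable_integral_norm hGI hGsum).1.neg.congr ?_
    rw [EventuallyEq, ae_restrict_iff' measurableSet_Ioc]
    filter_upwards [hGw] with s hs hsI using (hs hsI).symm
  · rw [intervalIntegral.integral_of_le ht.le, setIntegral_congr_ae measurableSet_Ioc hGw,
      integral_neg, ← (hasSum_integral_of_summable_integral_norm hGI hGsum).tsum_eq]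
    simp_rw [hGint]

/-- Uniqueness for the relaxation equation: convolving it with the potential measure inverts the
convolution with the renewal kernel. -/
theorem eq_of_hasConvDeriv (S : IsDiffuseSubordinator H Q M) (hr : 0 < r) {f : ℝ → ℂ}
    (hf : ∀ t, 0 < t → HasConvDeriv M f t (-(r * f t))) (ht : 0 ≤ t) :
    f t = f 0 * inverseLaplace H Q t r := by
  rcases ht.eq_or_lt with rfl | ht
  · rw [S.inverseLaplace_zero hr]
    simp
  have := S.isFiniteMeasure_potentialMeasure hr
  set U := potentialMeasure H Q r with hU
  set k : ℝ → ℝ := fun s => (renewalKernel M r s).toReal with hk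
  have hkm : Measurable k := (measurable_renewalKernel M r).ennreal_toReal
  set φ : ℝ → ℂ := deriv f with hφ
  have hφm : Measurable φ := measurable_deriv f
  have hφI : ∀ s, 0 < s → IntegrableOn φ (Ioc 0 s) := fun s hs =>
    (intervalIntegrable_iff_integrableOn_Ioc_of_le hs.le).1
      (intervalIntegrable_deriv_of_absolutelyContinuous (hf s hs).1)
  have hftc : ∀ s, 0 < s → ∫ a in Ioc 0 s, φ a = f s - f 0 := fun s hs => by
    rw [← intervalIntegral.integral_of_le hs.le]
    exact integral_deriv_of_absolutelyContinuous (hf s hs).1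
  have hpos : ∀ᵐ y ∂U, 0 < y := by
    rw [ae_iff]
    simpa [Iic_def] using S.potentialMeasure_Iic_zero hr
  -- The kernel integrates to one against the potential measure.
  have hk1 : ∀ s, 0 < s → ∫ y, k (s - y) ∂U = 1 := by
    intro s hs
    have h1 := S.lintegral_renewalKernel hr hs
    have hm : Measurable fun y => renewalKernel M r (s - y) := by fun_prop
    simp only [hk]
    rw [integral_toReal hm.aemeasurable (ae_lt_top hm (by rw [h1]; exact ENNReal.one_ne_top)), h1,
      ENNReal.toReal_one]
  have hIoo : ∀ᵐ a ∂(volume.restrict (Ioc 0 t)), a ∈ Ioo 0 t := by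
    rw [← restrict_Ioo_eq_restrict_Ioc]
    exact ae_restrict_mem measurableSet_Ioo
  have hint : Integrable (Function.uncurry fun a y => φ a * (k (t - a - y) : ℂ))
      ((volume.restrict (Ioc 0 t)).prod U) := by
    refine ⟨?_, ?_⟩
    · refine Measurable.aestronglyMeasurable ?_
      unfold Function.uncurry
      fun_prop
    · unfold HasFiniteIntegral
      rw [lintegral_prod _ (by unfold Function.uncurry; fun_prop)]
      refine lt_of_le_of_lt ?_ (hφI t ht).2
      refine lintegral_mono_ae ?_
      filter_upwards [hIoo] with a ha
      simp only [Function.uncurry, enorm_mul]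
      rw [lintegral_const_mul _ (by fun_prop)]
      refine mul_le_of_le_one_right' ?_
      rw [← S.lintegral_renewalKernel hr (show 0 < t - a by linarith [ha.2])]
      refine lintegral_mono fun y => ?_
      simp only [hk]
      rw [← ofReal_norm, Complex.norm_real, Real.norm_of_nonneg ENNReal.toReal_nonneg]
      exact ENNReal.ofReal_toReal_le
  have hswap := integral_integral_swap hint
  have hL : ∫ a in Ioc 0 t, ∫ y, φ a * (k (t - a - y) : ℂ) ∂U = f t - f 0 := by
    rw [← hftc t ht]
    refine integral_congr_ae ?_
    filter_upwards [hIoo] with a ha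
    rw [integral_const_mul, integral_complex_ofReal, hk1 _ (by linarith [ha.2])]
    simp
  have hR : ∀ᵐ y ∂U, ∫ a in Ioc 0 t, φ a * (k (t - a - y) : ℂ) =
      (Iic t).indicator (fun _ => -(r * f 0)) y := by
    have hne : ∀ᵐ y ∂U, y ∉ ({t} : Set ℝ) := measure_eq_zero_iff_ae_notMem.1
      (S.potentialMeasure_absolutelyContinuous hr Real.volume_singleton)
    filter_upwards [hpos, hne] with y hy hyt
    rcases lt_or_gt_of_ne (show y ≠ t from hyt) with hyt | hyt
    · have hτ : 0 < t - y := by linarith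
      rw [indicator_of_mem (by exact hyt.le)]
      have h1 : ∫ a in Ioc 0 t, φ a * (k (t - a - y) : ℂ) =
          ∫ a in Ioc 0 (t - y), φ a * (k (t - a - y) : ℂ) := by
        refine setIntegral_eq_of_subset_of_forall_sdiff_eq_zero measurableSet_Ioc
          (Ioc_subset_Ioc_right (by linarith)) fun a ha => ?_
        have : t - y < a := by
          by_contra hcon
          exact ha.2 ⟨ha.1.1, not_lt.1 hcon⟩
        have h0 : k (t - a - y) = 0 := by
          simp only [hk]
          rw [renewalKernel_of_neg (by linarith), ENNReal.toReal_zero]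
        rw [h0]
        simp
      obtain ⟨-, hi, he⟩ := hf (t - y) hτ
      have h2 : IntervalIntegrable (fun a => φ a * (levyTail M (t - y - a) : ℂ)) volume 0 (t - y) :=
        by
        have := hi.comp_sub_left (t - y)
        simp only [sub_sub_cancel, sub_self, sub_zero] at this
        exact this.symm
      have h3 : ∫ a in (0 : ℝ)..(t - y), φ a * (levyTail M (t - y - a) : ℂ) =
          -(r * f (t - y)) := by
        have := intervalIntegral.integral_comp_sub_left (a := 0) (b := t - y)
          (fun a => φ a * (levyTail M (t - y - a) : ℂ)) (t - y)
        simp only [sub_sub_cancel, sub_self, sub_zero] at this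
        rw [← he, ← this]
      have h4 : ∫ a in Ioc 0 (t - y), φ a * (k (t - a - y) : ℂ) =
          ∫ a in Ioc 0 (t - y), (φ a * (levyTail M (t - y - a) : ℂ) + φ a * r) := by
        refine setIntegral_congr_ae measurableSet_Ioc ?_
        have hne : ∀ᵐ a : ℝ, a ≠ t - y := by
          rw [ae_iff]; simp
        filter_upwards [hne] with a ha haI
        have hlt : 0 < t - a - y := by
          have := lt_of_le_of_ne haI.2 ha
          linarith
        simp only [hk, levyTail]
        rw [renewalKernel_of_nonneg hlt.le, ENNReal.toReal_add
          (S.levy.measure_Ioi_lt_top hlt).ne ENNReal.ofReal_ne_top, ENNReal.toReal_ofReal hr.le,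
          sub_right_comm]
        push_cast
        ring
      rw [intervalIntegrable_iff_integrableOn_Ioc_of_le hτ.le] at h2
      rw [h1, h4, integral_add h2 ((hφI _ hτ).mul_const _),
        ← intervalIntegral.integral_of_le hτ.le, h3, integral_mul_const, hftc _ hτ]
      ring
    · rw [indicator_of_notMem (by exact not_le.2 hyt)]
      refine integral_eq_zero_of_ae ?_
      filter_upwards [hIoo] with a ha
      have h0 : k (t - a - y) = 0 := by
        simp only [hk]
        rw [renewalKernel_of_neg (by linarith [ha.1]), ENNReal.toReal_zero]
      simp [h0]
  have hUr : inverseLaplace H Q t r = 1 - r * U.real (Iic t) := by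
    rw [S.inverseLaplace_eq hr ht.le, integral_eq_lintegral_of_nonneg_ae
      (ae_of_all _ fun x => potentialDensity_nonneg x)
      (measurable_potentialDensity.aestronglyMeasurable), ← S.potentialMeasure_Iic hr ht.le]
    rfl
  rw [hL, integral_congr_ae hR, integral_indicator_const _ measurableSet_Iic] at hswap
  rw [hUr]
  rw [Complex.real_smul] at hswap
  push_cast
  linear_combination hswap

end IsDiffuseSubordinator

end Relaxation

/-! ### Surface measure in spherical coordinates -/

lemma lintegral_euclideanSpace_three {F : EuclideanSpace ℝ (Fin 3) → ℝ≥0∞} (hF : Measurable F) :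
    ∫⁻ x, F x = ∫⁻ z : ℝ, ∫⁻ p : ℝ × ℝ, F !₂[p.1, p.2, z] := by
  rw [← (PiLp.volume_preserving_toLp (Fin 3)).lintegral_comp hF]
  rw [← ((volume_preserving_piFinSuccAbove (fun _ : Fin 3 => ℝ) 2).symm).lintegral_comp
    (by fun_prop)]
  rw [Measure.volume_eq_prod, lintegral_prod _ (by fun_prop)]
  refine lintegral_congr fun z => ?_
  rw [← ((volume_preserving_finTwoArrow ℝ).symm).lintegral_comp (by fun_prop)]
  refine lintegral_congr fun p => ?_
  congr 2
  ext i
  fin_cases i <;> rfl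

lemma lintegral_polar {f : ℝ × ℝ → ℝ≥0∞} (hf : Measurable f) :
    ∫⁻ p : ℝ × ℝ, f p = ∫⁻ φ in Ioo (-Real.pi) Real.pi, ∫⁻ ρ in Ioi 0,
      ENNReal.ofReal ρ * f (ρ * Real.cos φ, ρ * Real.sin φ) := by
  rw [← lintegral_comp_polarCoord_symm]
  simp only [polarCoord, smul_eq_mul]
  change ∫⁻ p in Ioi (0 : ℝ) ×ˢ Ioo (-Real.pi) Real.pi,
    ENNReal.ofReal p.1 * f (p.1 * Real.cos p.2, p.1 * Real.sin p.2) = _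
  rw [Measure.volume_eq_prod, ← Measure.prod_restrict, lintegral_prod_symm' _ (by fun_prop)]

/-- The point of the unit sphere with colatitude `p.1` and longitude `p.2`. -/
noncomputable def spherePoint (p : ℝ × ℝ) : S2 :=
  ⟨!₂[Real.sin p.1 * Real.cos p.2, Real.sin p.1 * Real.sin p.2, Real.cos p.1], by
    rw [mem_sphere_zero_iff_norm, EuclideanSpace.norm_eq, Real.sqrt_eq_one, Fin.sum_univ_three]
    simp only [Real.norm_eq_abs, sq_abs]
    change (Real.sin p.1 * Real.cos p.2) ^ 2 + (Real.sin p.1 * Real.sin p.2) ^ 2 +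
      Real.cos p.1 ^ 2 = 1
    linear_combination Real.sin p.1 ^ 2 * Real.sin_sq_add_cos_sq p.2 + Real.sin_sq_add_cos_sq p.1⟩

lemma measurable_spherePoint : Measurable spherePoint := by
  refine Measurable.subtype_mk (Continuous.measurable ?_)
  refine (PiLp.continuous_toLp 2 _).comp (continuous_pi fun i => ?_)
  fin_cases i <;> simp <;> fun_prop

open scoped Pointwise in
/-- The cone over a subset of the sphere, with apex removed. -/
def cone (s : Set S2) : Set (EuclideanSpace ℝ (Fin 3)) :=
  Ioo (0 : ℝ) 1 • (Subtype.val '' s)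

open scoped Pointwise in
lemma mem_cone_iff {s : Set S2} {x : EuclideanSpace ℝ (Fin 3)} :
    x ∈ cone s ↔ (0 < ‖x‖ ∧ ‖x‖ < 1) ∧ ‖x‖⁻¹ • x ∈ ((↑) '' s : Set (EuclideanSpace ℝ (Fin 3))) := by
  unfold cone
  rw [Set.mem_smul]
  constructor
  · rintro ⟨R, hR, _, ⟨u, hu, rfl⟩, rfl⟩
    have h1 : ‖R • (u : EuclideanSpace ℝ (Fin 3))‖ = R := by
      rw [norm_smul, norm_eq_of_mem_sphere, mul_one, Real.norm_of_nonneg hR.1.le]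
    rw [h1, smul_smul, inv_mul_cancel₀ hR.1.ne', one_smul]
    exact ⟨hR, u, hu, rfl⟩
  · rintro ⟨hR, u, hu, he⟩
    refine ⟨‖x‖, hR, u, ⟨u, hu, rfl⟩, ?_⟩
    rw [he, smul_smul, mul_inv_cancel₀ hR.1.ne', one_smul]

lemma measurableSet_cone {s : Set S2} (hs : MeasurableSet s) : MeasurableSet (cone s) := by
  have : cone s = {x | (0 < ‖x‖ ∧ ‖x‖ < 1)} ∩
      (fun x : EuclideanSpace ℝ (Fin 3) => ‖x‖⁻¹ • x) ⁻¹' ((↑) '' s) := by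
    ext x
    exact mem_cone_iff
  rw [this]
  refine MeasurableSet.inter ?_ ?_
  · exact (measurableSet_lt measurable_const measurable_norm).inter
      (measurableSet_lt measurable_norm measurable_const)
  · exact (by fun_prop : Measurable fun x : EuclideanSpace ℝ (Fin 3) => ‖x‖⁻¹ • x)
      (MeasurableSet.subtype_image Metric.isClosed_sphere.measurableSet hs)

lemma smul_mem_cone_iff {s : Set S2} {R : ℝ} (hR : 0 < R) (u : S2) :
    R • (u : EuclideanSpace ℝ (Fin 3)) ∈ cone s ↔ R < 1 ∧ u ∈ s := by
  have h1 : ‖R • (u : EuclideanSpace ℝ (Fin 3))‖ = R := by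
    rw [norm_smul, norm_eq_of_mem_sphere, mul_one, Real.norm_of_nonneg hR.le]
  rw [mem_cone_iff, h1, smul_smul, inv_mul_cancel₀ hR.ne', one_smul]
  constructor
  · rintro ⟨h, v, hv, he⟩
    exact ⟨h.2, Subtype.ext he ▸ hv⟩
  · rintro ⟨h, hu⟩
    exact ⟨⟨hR, h⟩, u, hu, rfl⟩

/-- The measure `sin θ dθ dφ` on colatitudes and longitudes. -/
noncomputable def angleMeasure : Measure (ℝ × ℝ) :=
  ((volume.restrict (Ioo 0 Real.pi)).withDensity fun θ => ENNReal.ofReal (Real.sin θ)).prod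
    (volume.restrict (Ioo (-Real.pi) Real.pi))

lemma lintegral_sq_Ioo : ∫⁻ R in Ioo (0 : ℝ) 1, ENNReal.ofReal (R * R) = 3⁻¹ := by
  rw [restrict_Ioo_eq_restrict_Ioc, ← ofReal_integral_eq_lintegral_ofReal]
  · rw [← intervalIntegral.integral_of_le zero_le_one]
    have : ∫ x in (0 : ℝ)..1, x * x = 3⁻¹ := by
      simp_rw [← pow_two]
      rw [integral_pow]
      norm_num
    rw [this, ENNReal.ofReal_inv_of_pos (by norm_num)]
    norm_num
  · exact (intervalIntegrable_iff_integrableOn_Ioc_of_le zero_le_one).1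
      ((by fun_prop : Continuous fun x : ℝ => x * x).intervalIntegrable 0 1)
  · exact ae_of_all _ fun x => mul_self_nonneg x

/-- Surface measure in spherical coordinates. The volume of a cone is computed with polar
coordinates in the horizontal plane, and then in the half-plane spanned by the axis and the
distance from the axis. -/
theorem surface_eq_map : surface = angleMeasure.map spherePoint := by
  ext s hs
  rw [surface, Measure.toSphere_apply' _ hs, finrank_euclideanSpace_fin]
  change _ * volume (cone s) = _
  have hC := measurableSet_cone hs
  set F : EuclideanSpace ℝ (Fin 3) → ℝ≥0∞ := (cone s).indicator 1 with hF
  have hFm : Measurable F := measurable_one.indicator hC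
  set D : Set (ℝ × ℝ) := spherePoint ⁻¹' s with hD
  have hDm : MeasurableSet D := measurable_spherePoint hs
  have hvec : Measurable fun q : ℝ × ℝ × ℝ => F !₂[q.1, q.2.1, q.2.2] := by
    refine hFm.comp (Continuous.measurable ?_)
    refine (PiLp.continuous_toLp 2 _).comp (continuous_pi fun i => ?_)
    fin_cases i <;> simp <;> fun_prop
  have hvol : volume (cone s) = ∫⁻ φ in Ioo (-Real.pi) Real.pi, ∫⁻ θ in Ioo 0 Real.pi,
      3⁻¹ * (ENNReal.ofReal (Real.sin θ) * D.indicator 1 (θ, φ)) := by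
    calc volume (cone s) = ∫⁻ x, F x := (lintegral_indicator_one hC).symm
      _ = ∫⁻ z : ℝ, ∫⁻ p : ℝ × ℝ, F !₂[p.1, p.2, z] := lintegral_euclideanSpace_three hFm
      _ = ∫⁻ z : ℝ, ∫⁻ φ in Ioo (-Real.pi) Real.pi, ∫⁻ ρ in Ioi 0,
            ENNReal.ofReal ρ * F !₂[ρ * Real.cos φ, ρ * Real.sin φ, z] := by
          refine lintegral_congr fun z => ?_
          exact lintegral_polar (hvec.comp (by fun_prop :
            Measurable fun p : ℝ × ℝ => ((p.1, p.2, z) : ℝ × ℝ × ℝ)))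
      _ = ∫⁻ φ in Ioo (-Real.pi) Real.pi, ∫⁻ z : ℝ, ∫⁻ ρ in Ioi 0,
            ENNReal.ofReal ρ * F !₂[ρ * Real.cos φ, ρ * Real.sin φ, z] := by
          refine lintegral_lintegral_swap (Measurable.aemeasurable ?_)
          refine Measurable.lintegral_prod_right' (f := fun q : (ℝ × ℝ) × ℝ =>
            ENNReal.ofReal q.2 * F !₂[q.2 * Real.cos q.1.2, q.2 * Real.sin q.1.2, q.1.1]) ?_
          refine Measurable.mul (by fun_prop) (hvec.comp (by fun_prop :
            Measurable fun q : (ℝ × ℝ) × ℝ =>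
              ((q.2 * Real.cos q.1.2, q.2 * Real.sin q.1.2, q.1.1) : ℝ × ℝ × ℝ)))
      _ = _ := by
          refine lintegral_congr fun φ => ?_
          have hm : Measurable fun p : ℝ × ℝ => (Ioi (0 : ℝ)).indicator (fun ρ =>
              ENNReal.ofReal ρ * F !₂[ρ * Real.cos φ, ρ * Real.sin φ, p.1]) p.2 := by
            have : (fun p : ℝ × ℝ => (Ioi (0 : ℝ)).indicator (fun ρ =>
              ENNReal.ofReal ρ * F !₂[ρ * Real.cos φ, ρ * Real.sin φ, p.1]) p.2) =
              {p : ℝ × ℝ | 0 < p.2}.indicator fun p =>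
              ENNReal.ofReal p.2 * F !₂[p.2 * Real.cos φ, p.2 * Real.sin φ, p.1] := by
              ext p
              simp [indicator]
            rw [this]
            refine Measurable.indicator ?_ (measurableSet_lt measurable_const measurable_snd)
            exact Measurable.mul (by fun_prop) (hvec.comp (by fun_prop :
              Measurable fun p : ℝ × ℝ =>
                ((p.2 * Real.cos φ, p.2 * Real.sin φ, p.1) : ℝ × ℝ × ℝ)))
          have h1 : ∫⁻ z : ℝ, ∫⁻ ρ in Ioi 0,
              ENNReal.ofReal ρ * F !₂[ρ * Real.cos φ, ρ * Real.sin φ, z] =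
              ∫⁻ p : ℝ × ℝ, (Ioi (0 : ℝ)).indicator (fun ρ =>
              ENNReal.ofReal ρ * F !₂[ρ * Real.cos φ, ρ * Real.sin φ, p.1]) p.2 := by
            rw [Measure.volume_eq_prod, lintegral_prod _ hm.aemeasurable]
            refine lintegral_congr fun z => ?_
            rw [← lintegral_indicator measurableSet_Ioi]
          rw [h1, lintegral_polar hm, ← lintegral_indicator measurableSet_Ioo,
            ← lintegral_indicator measurableSet_Ioo]
          refine lintegral_congr fun θ => ?_
          by_cases hθ : θ ∈ Ioo 0 Real.pi
          · have hsin := Real.sin_pos_of_mem_Ioo hθ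
            have hθ' : θ ∈ Ioo (-Real.pi) Real.pi := ⟨by linarith [hθ.1, Real.pi_pos], hθ.2⟩
            rw [indicator_of_mem hθ, indicator_of_mem hθ', ← lintegral_sq_Ioo,
              ← lintegral_mul_const _ (by fun_prop), ← lintegral_indicator measurableSet_Ioi,
              ← lintegral_indicator measurableSet_Ioo]
            refine lintegral_congr fun R => ?_
            by_cases hR : 0 < R
            · rw [indicator_of_mem (by exact hR), indicator_of_mem (by exact mul_pos hR hsin)]
              have hvecEq : (!₂[R * Real.sin θ * Real.cos φ, R * Real.sin θ * Real.sin φ,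
                  R * Real.cos θ] : EuclideanSpace ℝ (Fin 3)) =
                  R • (spherePoint (θ, φ) : EuclideanSpace ℝ (Fin 3)) := by
                ext i
                fin_cases i <;> simp [spherePoint, mul_assoc]
              have hFR : F (R • (spherePoint (θ, φ) : EuclideanSpace ℝ (Fin 3))) =
                  (Iio (1 : ℝ)).indicator 1 R * D.indicator 1 (θ, φ) := by
                have hc := smul_mem_cone_iff (s := s) hR (spherePoint (θ, φ))
                have hd : (θ, φ) ∈ D ↔ spherePoint (θ, φ) ∈ s := Iff.rfl
                by_cases h1 : R < 1 <;> by_cases h2 : spherePoint (θ, φ) ∈ s <;>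
                  simp [hF, indicator, hc, hd, h1, h2]
              simp only
              rw [hvecEq, hFR]
              by_cases h1 : R < 1
              · have h2 : R ∈ Ioo (0 : ℝ) 1 := ⟨hR, h1⟩
                rw [indicator_of_mem (show R ∈ Iio (1 : ℝ) from h1), indicator_of_mem h2,
                  ENNReal.ofReal_mul hR.le, ENNReal.ofReal_mul hR.le, Pi.one_apply]
                ring
              · have h2 : R ∉ Ioo (0 : ℝ) 1 := fun h => h1 h.2
                rw [indicator_of_notMem (show R ∉ Iio (1 : ℝ) from h1), indicator_of_notMem h2]
                simp
            · rw [indicator_of_notMem (by exact hR), indicator_of_notMem (fun h => hR h.1)]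
          · rw [indicator_of_notMem hθ]
            by_cases hθ' : θ ∈ Ioo (-Real.pi) Real.pi
            · rw [indicator_of_mem hθ']
              refine setLIntegral_eq_zero measurableSet_Ioi fun R hR => ?_
              have hR : 0 < R := hR
              have hθ0 : θ ≤ 0 := by
                by_contra h
                exact hθ ⟨not_le.1 h, hθ'.2⟩
              have hsin : Real.sin θ ≤ 0 := Real.sin_nonpos_of_nonpos_of_neg_pi_le hθ0 hθ'.1.le
              have : R * Real.sin θ ∉ Ioi (0 : ℝ) := fun h =>
                absurd (mem_Ioi.1 h) (not_lt.2 (mul_nonpos_of_nonneg_of_nonpos hR.le hsin))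
              simp only
              rw [indicator_of_notMem this]
              simp
            · rw [indicator_of_notMem hθ']
  have hDi : Measurable fun p : ℝ × ℝ => D.indicator (1 : ℝ × ℝ → ℝ≥0∞) p :=
    measurable_one.indicator hDm
  rw [hvol, Measure.map_apply measurable_spherePoint hs, ← hD, ← lintegral_indicator_one hDm,
    angleMeasure, lintegral_prod_symm' _ hDi, ← lintegral_const_mul']
  · refine lintegral_congr fun φ => ?_
    rw [lintegral_const_mul' _ _ (by simp), ← mul_assoc, lintegral_withDensity_eq_lintegral_mul _
      (by fun_prop) (show Measurable fun x : ℝ => D.indicator (1 : ℝ × ℝ → ℝ≥0∞) (x, φ) from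
        hDi.comp (by fun_prop : Measurable fun x : ℝ => (x, φ)))]
    have : (((3 : ℕ) : ℝ≥0∞)) * 3⁻¹ = 1 := by
      push_cast
      exact ENNReal.mul_inv_cancel (by norm_num) (by norm_num)
    rw [this, one_mul]
    rfl
  · exact ENNReal.natCast_ne_top _

/-! ### Integrals of Legendre polynomials -/

open Polynomial in
lemma integral_derivative_eval (p : ℝ[X]) :
    ∫ x in (-1 : ℝ)..1, (derivative p).eval x = p.eval 1 - p.eval (-1) :=
  intervalIntegral.integral_eq_sub_of_hasDerivAt (fun x _ => p.hasDerivAt x)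
    ((derivative p).continuous.intervalIntegrable _ _)

open Polynomial in
lemma integral_mul_derivative_eval (f g : ℝ[X]) (h1 : (f * g).eval 1 = 0)
    (h2 : (f * g).eval (-1) = 0) :
    ∫ x in (-1 : ℝ)..1, (f * derivative g).eval x =
      -∫ x in (-1 : ℝ)..1, (derivative f * g).eval x := by
  have h := integral_derivative_eval (f * g)
  rw [derivative_mul] at h
  simp_rw [eval_add] at h
  rw [intervalIntegral.integral_add ((derivative f * g).continuous.intervalIntegrable _ _)
    ((f * derivative g).continuous.intervalIntegrable _ _), h1, h2] at h
  linarith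

open Polynomial in
/-- Repeated integration by parts when all boundary terms vanish. -/
lemma integral_mul_iterate_derivative_eval (n : ℕ) (f g : ℝ[X])
    (h : ∀ i j, i + j + 1 = n → ∀ a ∈ ({1, -1} : Set ℝ),
      (derivative^[i] f * derivative^[j] g).eval a = 0) :
    ∫ x in (-1 : ℝ)..1, (f * derivative^[n] g).eval x =
      (-1) ^ n * ∫ x in (-1 : ℝ)..1, (derivative^[n] f * g).eval x := by
  induction n generalizing f with
  | zero => simp
  | succ n ih =>
    rw [Function.iterate_succ_apply', integral_mul_derivative_eval, ih, Function.iterate_succ_apply]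
    · ring
    · intro i j hij a ha
      have := h (i + 1) j (by omega) a ha
      rwa [Function.iterate_succ_apply] at this
    · exact h 0 n (by omega) 1 (by simp)
    · exact h 0 n (by omega) (-1) (by simp)

open Polynomial in
/-- The polynomial `X² - 1`, whose powers appear in the Rodrigues formula. -/
noncomputable def sqSubOne : ℝ[X] := X ^ 2 - 1

open Polynomial in
lemma eval_sqSubOne_of_mem {a : ℝ} (ha : a ∈ ({1, -1} : Set ℝ)) : sqSubOne.eval a = 0 := by
  rcases ha with rfl | rfl <;> simp [sqSubOne]

open Polynomial in
lemma monic_sqSubOne : sqSubOne.Monic := by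
  unfold sqSubOne
  monicity!

open Polynomial in
lemma natDegree_sqSubOne : sqSubOne.natDegree = 2 := by
  unfold sqSubOne
  compute_degree!

open Polynomial in
lemma eval_iterate_derivative_eq_zero {p : ℝ[X]} {n i : ℕ} (hp : sqSubOne ^ n ∣ p) (hi : i < n)
    {a : ℝ} (ha : a ∈ ({1, -1} : Set ℝ)) : (derivative^[i] p).eval a = 0 := by
  obtain ⟨q, hq⟩ := pow_sub_dvd_iterate_derivative_of_pow_dvd i hp
  rw [hq, eval_mul, eval_pow, eval_sqSubOne_of_mem ha, zero_pow (by omega), zero_mul]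

open Polynomial in
lemma integral_mul_rodrigues (l m : ℕ) (q : ℝ[X]) :
    ∫ x in (-1 : ℝ)..1, (sqSubOne ^ m * q * derivative^[l + m] (sqSubOne ^ l)).eval x =
      (-1) ^ (l + m) *
        ∫ x in (-1 : ℝ)..1, (derivative^[l + m] (sqSubOne ^ m * q) * sqSubOne ^ l).eval x := by
  refine integral_mul_iterate_derivative_eval _ _ _ fun i j hij a ha => ?_
  rw [eval_mul]
  rcases lt_or_ge i m with hi | hi
  · rw [eval_iterate_derivative_eq_zero (dvd_mul_right _ _) hi ha, zero_mul]
  · rw [eval_iterate_derivative_eq_zero (n := l) dvd_rfl (by omega) ha, mul_zero]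

open Polynomial in
lemma natDegree_iterate_derivative_sqSubOne (l m : ℕ) :
    (derivative^[l + m] (sqSubOne ^ l)).natDegree ≤ l - m := by
  refine (natDegree_iterate_derivative _ _).trans ?_
  rw [monic_sqSubOne.natDegree_pow, natDegree_sqSubOne]
  omega

open Polynomial in
lemma coeff_iterate_derivative_sqSubOne {l m : ℕ} (hm : m ≤ l) :
    (derivative^[l + m] (sqSubOne ^ l)).coeff (l - m) =
      ((2 * l).factorial : ℝ) / ((l - m).factorial : ℝ) := by
  rw [coeff_iterate_derivative, show l - m + (l + m) = l * 2 by omega]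
  have h1 : (sqSubOne ^ l).coeff (l * 2) = 1 := by
    have := (monic_sqSubOne.pow l).coeff_natDegree
    rwa [monic_sqSubOne.natDegree_pow, natDegree_sqSubOne] at this
  rw [h1, nsmul_eq_mul, mul_one, mul_comm l 2, eq_div_iff (by positivity)]
  have := Nat.factorial_mul_descFactorial (show l + m ≤ 2 * l by omega)
  rw [show 2 * l - (l + m) = l - m by omega] at this
  rw [mul_comm]
  exact_mod_cast this

open Polynomial in
lemma iterate_derivative_eq_C {p : ℝ[X]} {n : ℕ} (hp : p.natDegree ≤ n) :
    derivative^[n] p = C ((n.factorial : ℝ) * p.coeff n) := by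
  ext k
  rw [coeff_iterate_derivative]
  rcases k with _ | k
  · rw [coeff_C_zero, zero_add, Nat.descFactorial_self, nsmul_eq_mul]
  · rw [coeff_C_succ, coeff_eq_zero_of_natDegree_lt (by omega), smul_zero]

open Polynomial in
lemma integral_sqSubOne_pow (l : ℕ) :
    ∫ x in (-1 : ℝ)..1, (sqSubOne ^ l).eval x =
      (-1) ^ l * (2 ^ (2 * l + 1) * (l.factorial : ℝ) ^ 2 / ((2 * l + 1).factorial : ℝ)) := by
  induction l with
  | zero => norm_num
  | succ l ih =>
    have h := integral_derivative_eval (X * sqSubOne ^ (l + 1))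
    have hd : derivative (X * sqSubOne ^ (l + 1)) =
        C (2 * (l : ℝ) + 3) * sqSubOne ^ (l + 1) + C (2 * (l : ℝ) + 2) * sqSubOne ^ l := by
      have h2 : derivative sqSubOne = 2 * X := by
        unfold sqSubOne
        simp [C_ofNat, one_add_one_eq_two]
      have h3 : X ^ 2 = sqSubOne + 1 := by
        unfold sqSubOne
        ring
      rw [derivative_mul, derivative_X, derivative_pow_succ, h2]
      simp only [C_mul, C_ofNat, map_natCast, map_add, map_one]
      linear_combination (2 * ((l : ℝ[X]) + 1) * sqSubOne ^ l) * h3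
    rw [hd] at h
    simp_rw [eval_add, eval_mul, eval_C] at h
    rw [intervalIntegral.integral_add
      (((sqSubOne ^ (l + 1)).continuous.intervalIntegrable _ _).const_mul _)
      (((sqSubOne ^ l).continuous.intervalIntegrable _ _).const_mul _),
      intervalIntegral.integral_const_mul, intervalIntegral.integral_const_mul, ih] at h
    simp only [eval_pow, eval_sqSubOne_of_mem (show (1 : ℝ) ∈ ({1, -1} : Set ℝ) by simp),
      eval_sqSubOne_of_mem (show (-1 : ℝ) ∈ ({1, -1} : Set ℝ) by simp), ne_eq,
      Nat.add_eq_zero_iff, one_ne_zero, and_false, not_false_eq_true, zero_pow, mul_zero,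
      sub_zero] at h
    have h4 : (2 * (l : ℝ) + 3) ≠ 0 := by positivity
    have h5 : ∫ x in (-1 : ℝ)..1, (sqSubOne ^ (l + 1)).eval x =
        -((2 * (l : ℝ) + 2) / (2 * l + 3)) * ((-1) ^ l *
          (2 ^ (2 * l + 1) * (l.factorial : ℝ) ^ 2 / ((2 * l + 1).factorial : ℝ))) := by
      simp only [eval_pow] at h ⊢
      rw [neg_mul, div_mul_eq_mul_div, ← neg_div, eq_div_iff h4]
      linear_combination h
    rw [h5, show 2 * (l + 1) + 1 = (2 * l + 1) + 1 + 1 by ring, Nat.factorial_succ (2 * l + 1 + 1),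
      Nat.factorial_succ (2 * l + 1), Nat.factorial_succ l]
    push_cast
    have h6 : ((2 * l + 1).factorial : ℝ) ≠ 0 := by positivity
    have h7 : (2 * (l : ℝ) + 1 + 1) ≠ 0 := by positivity
    have h8 : (2 * (l : ℝ) + 1 + 1 + 1) ≠ 0 := by positivity
    field_simp
    ring

open Polynomial in
lemma iterate_derivative_legendre (l m : ℕ) : derivative^[m] (legendre l) =
    C (1 / (2 ^ l * (l.factorial : ℝ))) * derivative^[l + m] (sqSubOne ^ l) := by
  unfold legendre
  rw [iterate_derivative_C_mul, ← Function.iterate_add_apply, add_comm m l]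
  rfl

open Polynomial in
lemma integral_legendre_of_lt {k l m : ℕ} (hkm : m ≤ k) (hkl : k < l) :
    ∫ x in (-1 : ℝ)..1, (1 - x ^ 2) ^ m *
      ((derivative^[m] (legendre l)).eval x * (derivative^[m] (legendre k)).eval x) = 0 := by
  have h := integral_mul_rodrigues l m (derivative^[k + m] (sqSubOne ^ k))
  rw [iterate_derivative_eq_zero (p := sqSubOne ^ m * _)] at h
  · simp only [zero_mul, eval_zero, intervalIntegral.integral_zero, mul_zero] at h
    have he : ∀ x : ℝ, (1 - x ^ 2) ^ m *
        ((derivative^[m] (legendre l)).eval x * (derivative^[m] (legendre k)).eval x) =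
        ((-1) ^ m * (1 / (2 ^ l * (l.factorial : ℝ)) * (1 / (2 ^ k * (k.factorial : ℝ))))) *
        (sqSubOne ^ m * derivative^[k + m] (sqSubOne ^ k) *
          derivative^[l + m] (sqSubOne ^ l)).eval x := by
      intro x
      have h1 : (1 - x ^ 2) ^ m = (-1) ^ m * (sqSubOne.eval x) ^ m := by
        rw [← mul_pow]
        congr 1
        simp [sqSubOne]
      rw [iterate_derivative_legendre, iterate_derivative_legendre, h1]
      simp only [eval_mul, eval_C, eval_pow]
      ring
    simp_rw [he]
    rw [intervalIntegral.integral_const_mul, h, mul_zero]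
  · refine (natDegree_mul_le.trans (add_le_add le_rfl
      (natDegree_iterate_derivative_sqSubOne k m))).trans_lt ?_
    rw [monic_sqSubOne.natDegree_pow, natDegree_sqSubOne]
    omega

open Polynomial in
/-- Orthogonality of the associated Legendre functions of fixed order. -/
theorem integral_legendre_of_ne {k l m : ℕ} (hk : m ≤ k) (hl : m ≤ l) (hkl : k ≠ l) :
    ∫ x in (-1 : ℝ)..1, (1 - x ^ 2) ^ m *
      ((derivative^[m] (legendre l)).eval x * (derivative^[m] (legendre k)).eval x) = 0 := by
  rcases lt_or_gt_of_ne hkl with h | h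
  · exact integral_legendre_of_lt hk h
  · rw [← integral_legendre_of_lt hl h]
    refine intervalIntegral.integral_congr fun x _ => ?_
    ring

open Polynomial in
/-- The norm of the associated Legendre functions. -/
theorem integral_legendre_self {l m : ℕ} (hm : m ≤ l) :
    ∫ x in (-1 : ℝ)..1, (1 - x ^ 2) ^ m *
      ((derivative^[m] (legendre l)).eval x * (derivative^[m] (legendre l)).eval x) =
    2 / (2 * l + 1) * (((l + m).factorial : ℝ) / ((l - m).factorial : ℝ)) := by
  have h := integral_mul_rodrigues l m (derivative^[l + m] (sqSubOne ^ l))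
  have hdeg : (sqSubOne ^ m * derivative^[l + m] (sqSubOne ^ l)).natDegree ≤ l + m := by
    refine (natDegree_mul_le.trans (add_le_add le_rfl
      (natDegree_iterate_derivative_sqSubOne l m))).trans ?_
    rw [monic_sqSubOne.natDegree_pow, natDegree_sqSubOne]
    omega
  have hcoeff : (sqSubOne ^ m * derivative^[l + m] (sqSubOne ^ l)).coeff (l + m) =
      ((2 * l).factorial : ℝ) / ((l - m).factorial : ℝ) := by
    have h1 : (sqSubOne ^ m).natDegree = m * 2 := by
      rw [monic_sqSubOne.natDegree_pow, natDegree_sqSubOne]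
    have h2 := coeff_mul_add_eq_of_natDegree_le h1.le (natDegree_iterate_derivative_sqSubOne l m)
    rw [show m * 2 + (l - m) = l + m by omega] at h2
    rw [h2, coeff_iterate_derivative_sqSubOne hm, ← h1, (monic_sqSubOne.pow m).coeff_natDegree,
      one_mul]
  rw [iterate_derivative_eq_C hdeg, hcoeff] at h
  simp_rw [eval_mul (p := C _), eval_C] at h
  rw [intervalIntegral.integral_const_mul, integral_sqSubOne_pow] at h
  have he : ∀ x : ℝ, (1 - x ^ 2) ^ m *
      ((derivative^[m] (legendre l)).eval x * (derivative^[m] (legendre l)).eval x) =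
      ((-1) ^ m * (1 / (2 ^ l * (l.factorial : ℝ))) ^ 2) *
      (sqSubOne ^ m * derivative^[l + m] (sqSubOne ^ l) *
        derivative^[l + m] (sqSubOne ^ l)).eval x := by
    intro x
    have h1 : (1 - x ^ 2) ^ m = (-1) ^ m * (sqSubOne.eval x) ^ m := by
      rw [← mul_pow]
      congr 1
      simp [sqSubOne]
    rw [iterate_derivative_legendre, h1]
    simp only [eval_mul, eval_C, eval_pow]
    ring
  simp_rw [he]
  rw [intervalIntegral.integral_const_mul, h, Nat.factorial_succ (2 * l)]
  have hs : ((-1 : ℝ) ^ m * (-1) ^ (l + m) * (-1) ^ l) = 1 := by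
    rw [← pow_add, ← pow_add]
    exact Even.neg_one_pow ⟨m + l, by ring⟩
  have h6 : ((2 * l).factorial : ℝ) ≠ 0 := by positivity
  have h7 : (l.factorial : ℝ) ≠ 0 := by positivity
  have h8 : ((l - m).factorial : ℝ) ≠ 0 := by positivity
  have h9 : (2 * (l : ℝ) + 1) ≠ 0 := by positivity
  push_cast
  have h10 : ∀ a b c : ℝ, ((-1 : ℝ) ^ m * a) * ((-1) ^ (l + m) * (b * ((-1) ^ l * c))) =
      a * b * c := fun a b c => by
    linear_combination (a * b * c) * hs
  rw [h10]
  rw [pow_succ 2 (2 * l), pow_mul' 2 2 l]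
  field_simp

/-! ### Orthonormality of the spherical harmonics -/

/-- The horizontal part `x₀ + i x₁` of a point of the sphere. -/
def horizontal (x : S2) : ℂ := ⟨x.1 0, x.1 1⟩

lemma continuous_coord (i : Fin 3) : Continuous fun x : S2 => x.1 i :=
  (EuclideanSpace.proj i : EuclideanSpace ℝ (Fin 3) →L[ℝ] ℝ).continuous.comp continuous_subtype_val

lemma continuous_horizontal : Continuous horizontal := by
  have : horizontal = fun x : S2 => ((x.1 0 : ℝ) : ℂ) + ((x.1 1 : ℝ) : ℂ) * Complex.I := by
    ext x
    apply Complex.ext <;> simp [horizontal]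
  rw [this]
  have h0 := continuous_coord 0
  have h1 := continuous_coord 1
  fun_prop

lemma sum_sq_coord (x : S2) : x.1 0 ^ 2 + x.1 1 ^ 2 + x.1 2 ^ 2 = 1 := by
  have h := x.2
  rw [mem_sphere_zero_iff_norm, EuclideanSpace.norm_eq, Real.sqrt_eq_one, Fin.sum_univ_three] at h
  simpa using h

lemma horizontal_mul_conj (x : S2) :
    horizontal x * conj (horizontal x) = ((1 - x.1 2 ^ 2 : ℝ) : ℂ) := by
  rw [Complex.mul_conj, Complex.normSq_apply]
  congr 1
  simp only [horizontal]
  linear_combination sum_sq_coord x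

lemma norm_horizontal (x : S2) : ‖horizontal x‖ = Real.sqrt (1 - x.1 2 ^ 2) := by
  rw [Complex.norm_def, Complex.normSq_apply]
  congr 1
  simp only [horizontal]
  linear_combination sum_sq_coord x

/-- The normalising constant of `Y_{lm}`. -/
noncomputable def harmonicNorm (l m : ℕ) : ℝ :=
  Real.sqrt ((2 * (l : ℝ) + 1) / (4 * Real.pi) *
    (((l - m).factorial : ℝ) / ((l + m).factorial : ℝ)))

open Polynomial in
/-- The derivative of the Legendre polynomial that appears in `Y_{lm}`. -/
noncomputable def legendreDeriv (l m : ℕ) : ℝ[X] := derivative^[m] (legendre l)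

lemma harmonicNonneg_eq (l m : ℕ) (x : S2) : harmonicNonneg l m x =
    (((-1) ^ m * harmonicNorm l m * (legendreDeriv l m).eval (x.1 2) : ℝ) : ℂ) *
      horizontal x ^ m := by
  have h : horizontal x = (Real.sqrt (1 - x.1 2 ^ 2) : ℂ) *
      Complex.exp (Complex.I * (longitude x : ℝ)) := by
    rw [← norm_horizontal, mul_comm Complex.I]
    exact (Complex.norm_mul_exp_arg_mul_I (horizontal x)).symm
  rw [h, mul_pow, ← Complex.exp_nat_mul]
  unfold harmonicNonneg assocLegendre harmonicNorm legendreDeriv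
  push_cast
  rw [show (m : ℂ) * (Complex.I * (longitude x : ℂ)) = Complex.I * ((m : ℂ) * (longitude x : ℂ)) by
    ring]
  ring

lemma continuous_harmonicNonneg (l m : ℕ) : Continuous (harmonicNonneg l m) := by
  have : harmonicNonneg l m = fun x => (((-1) ^ m * harmonicNorm l m *
      (legendreDeriv l m).eval (x.1 2) : ℝ) : ℂ) * horizontal x ^ m :=
    funext fun x => harmonicNonneg_eq l m x
  rw [this]
  have h2 := continuous_coord 2
  have h3 := (legendreDeriv l m).continuous.comp h2
  refine Continuous.mul ?_ (continuous_horizontal.pow m)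
  exact Complex.continuous_ofReal.comp (h3.const_mul _)

lemma continuous_harmonic (l : ℕ) (m : ℤ) : Continuous (harmonic l m) := by
  unfold harmonic
  split_ifs
  · exact continuous_harmonicNonneg _ _
  · exact continuous_const.mul (Complex.continuous_conj.comp (continuous_harmonicNonneg _ _))

lemma conj_harmonic (l : ℕ) (m : ℤ) (x : S2) :
    conj (harmonic l m x) = (-1) ^ m.natAbs * harmonic l (-m) x := by
  have hs : ((-1 : ℂ) ^ m.natAbs) * (-1) ^ m.natAbs = 1 := by
    rw [← mul_pow]; simp
  unfold harmonic
  rcases lt_trichotomy m 0 with h | h | h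
  · rw [if_neg (not_le.2 h), if_pos (by omega), Int.natAbs_neg]
    simp
  · subst h
    have : conj (harmonicNonneg l 0 x) = harmonicNonneg l 0 x := by
      rw [harmonicNonneg_eq]
      simp
    simpa using this
  · rw [if_pos h.le, if_neg (by omega), Int.natAbs_neg, ← mul_assoc, hs, one_mul]

/-- The sign of `Y_{lm}` relative to `e^{i m φ}`. -/
def harmonicSign (m : ℤ) : ℝ := if 0 ≤ m then (-1) ^ m.natAbs else 1

lemma harmonicSign_mul_self (m : ℤ) : harmonicSign m * harmonicSign m = 1 := by
  unfold harmonicSign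
  split_ifs
  · rw [← mul_pow]; simp
  · simp

lemma horizontal_spherePoint (p : ℝ × ℝ) : horizontal (spherePoint p) =
    (Real.sin p.1 : ℂ) * Complex.exp ((p.2 : ℂ) * Complex.I) := by
  rw [Complex.exp_mul_I, ← Complex.ofReal_cos, ← Complex.ofReal_sin]
  apply Complex.ext
  · simp [horizontal, spherePoint, -Complex.ofReal_sin, -Complex.ofReal_cos]
  · simp [horizontal, spherePoint, -Complex.ofReal_sin, -Complex.ofReal_cos]

lemma height_spherePoint (p : ℝ × ℝ) : (spherePoint p).1 2 = Real.cos p.1 := by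
  simp [spherePoint]

lemma harmonic_spherePoint (l : ℕ) (m : ℤ) (p : ℝ × ℝ) : harmonic l m (spherePoint p) =
    ((harmonicSign m * harmonicNorm l m.natAbs *
      ((legendreDeriv l m.natAbs).eval (Real.cos p.1) * Real.sin p.1 ^ m.natAbs) : ℝ) : ℂ) *
      Complex.exp ((m : ℂ) * p.2 * Complex.I) := by
  unfold harmonic harmonicSign
  have hs : ((-1 : ℂ) ^ m.natAbs) * (-1) ^ m.natAbs = 1 := by
    rw [← mul_pow]; simp
  split_ifs with h
  · rw [harmonicNonneg_eq, horizontal_spherePoint, height_spherePoint, mul_pow,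
      ← Complex.exp_nat_mul]
    have : ((m.natAbs : ℕ) : ℂ) = (m : ℂ) := by
      rw [← Int.cast_natCast, Int.natAbs_of_nonneg h]
    rw [this]
    push_cast
    ring_nf
  · rw [harmonicNonneg_eq, horizontal_spherePoint, height_spherePoint, mul_pow,
      ← Complex.exp_nat_mul]
    have : ((m.natAbs : ℕ) : ℂ) = -(m : ℂ) := by
      have h1 : ((m.natAbs : ℕ) : ℤ) = -m := by omega
      rw [← Int.cast_natCast, h1, Int.cast_neg]
    rw [map_mul, map_mul, ← Complex.exp_conj, this]
    simp only [Complex.conj_ofReal, map_pow, map_mul, map_neg, Complex.conj_I]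
    rw [show -(starRingEnd ℂ) (m : ℂ) * ((p.2 : ℂ) * -Complex.I) = (m : ℂ) * p.2 * Complex.I by
      rw [map_intCast]; ring]
    push_cast
    linear_combination ((harmonicNorm l m.natAbs : ℂ) *
      (((legendreDeriv l m.natAbs).eval (Real.cos p.1) : ℝ) : ℂ) *
      Complex.sin (p.1 : ℂ) ^ m.natAbs * Complex.exp ((m : ℂ) * p.2 * Complex.I)) * hs

lemma integral_exp_int_mul (n : ℤ) :
    ∫ φ in Ioo (-Real.pi) Real.pi, Complex.exp ((n : ℂ) * φ * Complex.I) =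
      if n = 0 then ((2 * Real.pi : ℝ) : ℂ) else 0 := by
  rw [← integral_Ioc_eq_integral_Ioo, ← intervalIntegral.integral_of_le (by linarith [Real.pi_pos])]
  split_ifs with h
  · subst h
    simp only [Int.cast_zero, zero_mul, Complex.exp_zero, intervalIntegral.integral_const]
    rw [Complex.real_smul, mul_one]
    congr 1
    ring
  · have hn : ((n : ℂ) * Complex.I) ≠ 0 := mul_ne_zero (by exact_mod_cast h) Complex.I_ne_zero
    have h1 := integral_exp_mul_complex (a := -Real.pi) (b := Real.pi) hn
    simp_rw [show ∀ φ : ℝ, (n : ℂ) * φ * Complex.I = (n : ℂ) * Complex.I * φ from fun φ => by ring]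
    rw [h1, div_eq_zero_iff]
    left
    rw [sub_eq_zero, Complex.exp_eq_exp_iff_exists_int]
    refine ⟨n, ?_⟩
    push_cast
    ring

lemma integral_angle_mul (f : ℝ → ℂ) (g : ℝ → ℂ) :
    ∫ p, f p.1 * g p.2 ∂angleMeasure =
      (∫ θ in Ioo 0 Real.pi, (Real.sin θ : ℂ) * f θ) * ∫ φ in Ioo (-Real.pi) Real.pi, g φ := by
  unfold angleMeasure
  rw [integral_prod_mul f g]
  congr 1
  rw [integral_withDensity_eq_integral_toReal_smul (by fun_prop)
    (ae_of_all _ fun _ => ENNReal.ofReal_lt_top)]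
  refine setIntegral_congr_fun measurableSet_Ioo fun θ hθ => ?_
  rw [ENNReal.toReal_ofReal (Real.sin_pos_of_mem_Ioo hθ).le, Complex.real_smul]

lemma integral_sin_mul_comp_cos {g : ℝ → ℝ} (hg : Continuous g) :
    ∫ θ in Ioo 0 Real.pi, Real.sin θ * g (Real.cos θ) = ∫ z in (-1 : ℝ)..1, g z := by
  rw [← integral_Ioc_eq_integral_Ioo, ← intervalIntegral.integral_of_le Real.pi_pos.le]
  have h := intervalIntegral.integral_comp_mul_deriv (a := 0) (b := Real.pi) (f := Real.cos)
    (f' := fun x => -Real.sin x) (g := g) (fun x _ => Real.hasDerivAt_cos x)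
    (by fun_prop) hg
  rw [Real.cos_zero, Real.cos_pi, intervalIntegral.integral_symm (-1) 1] at h
  rw [← neg_inj, ← h, ← intervalIntegral.integral_neg]
  refine intervalIntegral.integral_congr fun x _ => ?_
  simp only [Function.comp]
  ring

/-- The spherical harmonics are orthonormal. -/
theorem integral_harmonic_mul_conj {l k : ℕ} {m n : ℤ} (hm : m ∈ orders l) (hn : n ∈ orders k) :
    ∫ x, harmonic l m x * conj (harmonic k n x) ∂surface = if l = k ∧ m = n then 1 else 0 := by
  have hml : m.natAbs ≤ l := by
    simp only [orders, Finset.mem_Icc] at hm; omega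
  have hnk : n.natAbs ≤ k := by
    simp only [orders, Finset.mem_Icc] at hn; omega
  rw [surface_eq_map, integral_map (f := fun x => harmonic l m x * conj (harmonic k n x))
    measurable_spherePoint.aemeasurable (((continuous_harmonic l m).mul
      (Complex.continuous_conj.comp (continuous_harmonic k n))).aestronglyMeasurable)]
  let f : ℝ → ℂ := fun θ => ((harmonicSign m * harmonicNorm l m.natAbs *
    ((legendreDeriv l m.natAbs).eval (Real.cos θ) * Real.sin θ ^ m.natAbs) *
    (harmonicSign n * harmonicNorm k n.natAbs *
    ((legendreDeriv k n.natAbs).eval (Real.cos θ) * Real.sin θ ^ n.natAbs)) : ℝ) : ℂ)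
  let g : ℝ → ℂ := fun φ => Complex.exp (((m - n : ℤ) : ℂ) * φ * Complex.I)
  have h1 : ∀ p : ℝ × ℝ, harmonic l m (spherePoint p) * conj (harmonic k n (spherePoint p)) =
      f p.1 * g p.2 := by
    intro p
    simp only [f, g]
    rw [harmonic_spherePoint, harmonic_spherePoint, map_mul, Complex.conj_ofReal,
      ← Complex.exp_conj]
    simp only [map_mul, Complex.conj_I, Complex.conj_ofReal, map_intCast]
    rw [mul_mul_mul_comm, ← Complex.exp_add]
    push_cast
    congr 2
    ring
  refine (integral_congr_ae (ae_of_all _ h1)).trans ?_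
  rw [integral_angle_mul f g]
  simp only [f, g]
  rw [integral_exp_int_mul]
  by_cases hmn : m = n
  · subst hmn
    rw [sub_self, if_pos rfl]
    have h2 : ∀ θ : ℝ, (Real.sin θ : ℂ) * ((harmonicSign m * harmonicNorm l m.natAbs *
        ((legendreDeriv l m.natAbs).eval (Real.cos θ) * Real.sin θ ^ m.natAbs) *
        (harmonicSign m * harmonicNorm k m.natAbs *
        ((legendreDeriv k m.natAbs).eval (Real.cos θ) * Real.sin θ ^ m.natAbs)) : ℝ) : ℂ) =
        ((harmonicNorm l m.natAbs * harmonicNorm k m.natAbs * (Real.sin θ *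
          (fun z : ℝ => (1 - z ^ 2) ^ m.natAbs * ((legendreDeriv l m.natAbs).eval z *
            (legendreDeriv k m.natAbs).eval z)) (Real.cos θ)) : ℝ) : ℂ) := by
      intro θ
      rw [← Complex.ofReal_mul]
      congr 1
      simp only
      rw [← Real.sin_sq]
      linear_combination (harmonicNorm l m.natAbs * harmonicNorm k m.natAbs * (Real.sin θ *
          (Real.sin θ ^ 2) ^ m.natAbs * ((legendreDeriv l m.natAbs).eval (Real.cos θ) *
            (legendreDeriv k m.natAbs).eval (Real.cos θ)))) * harmonicSign_mul_self m
    simp_rw [h2]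
    rw [integral_complex_ofReal, integral_const_mul,
      integral_sin_mul_comp_cos (g := fun z : ℝ => (1 - z ^ 2) ^ m.natAbs *
        ((legendreDeriv l m.natAbs).eval z * (legendreDeriv k m.natAbs).eval z))]
    · by_cases hlk : l = k
      · subst hlk
        rw [if_pos ⟨rfl, trivial⟩]
        have h3 := integral_legendre_self hml
        unfold legendreDeriv
        rw [h3, ← Complex.ofReal_mul, ← Complex.ofReal_one]
        congr 1
        unfold harmonicNorm
        rw [Real.mul_self_sqrt (by positivity)]
        have := Real.pi_pos
        have h4 : ((l - m.natAbs).factorial : ℝ) ≠ 0 := by positivity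
        have h5 : ((l + m.natAbs).factorial : ℝ) ≠ 0 := by positivity
        have h6 : (2 * (l : ℝ) + 1) ≠ 0 := by positivity
        field_simp
        norm_num
      · rw [if_neg (fun h => hlk h.1)]
        unfold legendreDeriv
        rw [integral_legendre_of_ne hnk hml (Ne.symm hlk)]
        simp
    · exact ((by fun_prop : Continuous fun z : ℝ => (1 - z ^ 2) ^ m.natAbs)).mul
        ((legendreDeriv l m.natAbs).continuous.mul (legendreDeriv k m.natAbs).continuous)
  · rw [if_neg (sub_ne_zero.2 hmn), if_neg (fun h => hmn h.2), mul_zero]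

/-! ### Completeness of the spherical harmonics -/

/-- The horizontal part `x₀ + i x₁` as a continuous function. -/
def horizontalMap : C(S2, ℂ) := ⟨horizontal, continuous_horizontal⟩

/-- The height `x₂` as a complex-valued continuous function. -/
def heightMap : C(S2, ℂ) :=
  ⟨fun x => ((x.1 2 : ℝ) : ℂ), Complex.continuous_ofReal.comp (continuous_coord 2)⟩

/-- The spherical harmonic `Y_{lm}` as a continuous function. -/
noncomputable def harmonicMap (l : ℕ) (m : ℤ) : C(S2, ℂ) :=
  ⟨harmonic l m, continuous_harmonic l m⟩

lemma horizontalMap_mul_star : horizontalMap * star horizontalMap = 1 - heightMap ^ 2 := by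
  ext x
  have := horizontal_mul_conj x
  simpa [horizontalMap, heightMap] using this

/-- The span of the spherical harmonics. -/
noncomputable def harmonicSpan : Submodule ℂ C(S2, ℂ) :=
  Submodule.span ℂ {f | ∃ l : ℕ, ∃ m ∈ orders l, f = harmonicMap l m}

lemma coeff_legendreDeriv_ne_zero (d m : ℕ) : (legendreDeriv (m + d) m).coeff d ≠ 0 := by
  have h := coeff_iterate_derivative_sqSubOne (l := m + d) (m := m) (by omega)
  rw [Nat.add_sub_cancel_left] at h
  unfold legendreDeriv
  rw [iterate_derivative_legendre, Polynomial.coeff_C_mul, h]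
  positivity

lemma natDegree_legendreDeriv_le (d m : ℕ) : (legendreDeriv (m + d) m).natDegree ≤ d := by
  have h := natDegree_iterate_derivative_sqSubOne (m + d) m
  rw [Nat.add_sub_cancel_left] at h
  unfold legendreDeriv
  rw [iterate_derivative_legendre]
  exact (Polynomial.natDegree_C_mul_le _ _).trans h

lemma harmonicNorm_pos (l m : ℕ) : 0 < harmonicNorm l m := by
  have := Real.pi_pos
  unfold harmonicNorm
  positivity

/-- Since the derivatives of the Legendre polynomials contain one polynomial of each degree, a
space which contains their products with `w ^ m` contains all monomials. -/
lemma pow_mul_pow_mem (S : Submodule ℂ C(S2, ℂ)) (w : C(S2, ℂ)) (m : ℕ)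
    (h : ∀ d : ℕ, ∑ k ∈ Finset.range (d + 1),
      ((legendreDeriv (m + d) m).coeff k : ℂ) • (heightMap ^ k * w ^ m) ∈ S) (d : ℕ) :
    heightMap ^ d * w ^ m ∈ S := by
  induction d using Nat.strong_induction_on with
  | _ d ih =>
    have h1 := h d
    rw [Finset.sum_range_succ] at h1
    have h2 : ∑ k ∈ Finset.range d,
        ((legendreDeriv (m + d) m).coeff k : ℂ) • (heightMap ^ k * w ^ m) ∈ S :=
      S.sum_mem fun k hk => S.smul_mem _ (ih k (Finset.mem_range.1 hk))
    have h3 := (S.add_mem_iff_right h2).1 h1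
    exact (S.smul_mem_iff (Complex.ofReal_ne_zero.2 (coeff_legendreDeriv_ne_zero d m))).1 h3

lemma sum_coeff_legendreDeriv (w : C(S2, ℂ)) (m d : ℕ) (x : S2) :
    (∑ k ∈ Finset.range (d + 1),
      ((legendreDeriv (m + d) m).coeff k : ℂ) • (heightMap ^ k * w ^ m)) x =
      (((legendreDeriv (m + d) m).eval (x.1 2) : ℝ) : ℂ) * w x ^ m := by
  rw [Polynomial.eval_eq_sum_range' (Nat.lt_succ_of_le (natDegree_legendreDeriv_le d m))]
  simp [heightMap, Finset.sum_mul, mul_assoc]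

lemma height_pow_mul_horizontal_pow_mem (m d : ℕ) :
    heightMap ^ d * horizontalMap ^ m ∈ harmonicSpan := by
  refine pow_mul_pow_mem _ _ _ (fun d => ?_) d
  have h : harmonicMap (m + d) m ∈ harmonicSpan :=
    Submodule.subset_span ⟨m + d, m, by simp only [orders, Finset.mem_Icc]; omega, rfl⟩
  have hc : (((-1) ^ m * harmonicNorm (m + d) m : ℝ) : ℂ) ≠ 0 :=
    Complex.ofReal_ne_zero.2
      (mul_ne_zero (pow_ne_zero _ (by norm_num)) (harmonicNorm_pos _ _).ne')
  refine (Submodule.smul_mem_iff _ hc).1 ?_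
  convert h using 1
  ext x
  rw [ContinuousMap.smul_apply, sum_coeff_legendreDeriv]
  change _ = harmonic (m + d) m x
  unfold harmonic
  rw [if_pos (by omega), Int.natAbs_natCast, harmonicNonneg_eq]
  simp [horizontalMap, mul_assoc]

lemma height_pow_mul_star_horizontal_pow_mem (m d : ℕ) :
    heightMap ^ d * star horizontalMap ^ m ∈ harmonicSpan := by
  refine pow_mul_pow_mem _ _ _ (fun d => ?_) d
  have h : harmonicMap (m + d) (-m) ∈ harmonicSpan :=
    Submodule.subset_span ⟨m + d, -m, by simp only [orders, Finset.mem_Icc]; omega, rfl⟩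
  have hc : ((harmonicNorm (m + d) m : ℝ) : ℂ) ≠ 0 :=
    Complex.ofReal_ne_zero.2 (harmonicNorm_pos _ _).ne'
  refine (Submodule.smul_mem_iff _ hc).1 ?_
  convert h using 1
  ext x
  rw [ContinuousMap.smul_apply, sum_coeff_legendreDeriv]
  change _ = harmonic (m + d) (-m) x
  have hs : ((-1 : ℂ) ^ m) * (-1) ^ m = 1 := by
    rw [← mul_pow]; simp
  have h1 : harmonic (m + d) (-m) x = (-1) ^ m * conj (harmonicNonneg (m + d) m x) := by
    have h2 : harmonicNonneg (m + d) m x = harmonic (m + d) m x := by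
      unfold harmonic
      rw [if_pos (by omega), Int.natAbs_natCast]
    rw [h2, conj_harmonic, Int.natAbs_natCast, ← mul_assoc, hs, one_mul]
  rw [h1, harmonicNonneg_eq]
  simp only [horizontalMap, map_mul, Complex.conj_ofReal, map_pow, map_neg, map_one,
    Complex.ofReal_mul, Complex.ofReal_pow, Complex.ofReal_neg, Complex.ofReal_one,
    ContinuousMap.star_apply, ContinuousMap.coe_mk, smul_eq_mul, Complex.star_def]
  linear_combination (-((harmonicNorm (m + d) m : ℝ) : ℂ) *
    (((legendreDeriv (m + d) m).eval (x.1 2) : ℝ) : ℂ) * conj (horizontal x) ^ m) * hs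

lemma monomial_mem_harmonicSpan (a b c : ℕ) :
    horizontalMap ^ a * star horizontalMap ^ b * heightMap ^ c ∈ harmonicSpan := by
  induction a generalizing b c with
  | zero => simpa [mul_comm] using height_pow_mul_star_horizontal_pow_mem b c
  | succ a ih =>
    cases b with
    | zero => simpa [mul_comm] using height_pow_mul_horizontal_pow_mem (a + 1) c
    | succ b =>
      have : horizontalMap ^ (a + 1) * star horizontalMap ^ (b + 1) * heightMap ^ c =
          horizontalMap ^ a * star horizontalMap ^ b * heightMap ^ c -
          horizontalMap ^ a * star horizontalMap ^ b * heightMap ^ (c + 2) := by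
        linear_combination (horizontalMap ^ a * star horizontalMap ^ b * heightMap ^ c) *
          horizontalMap_mul_star
      rw [this]
      exact harmonicSpan.sub_mem (ih b c) (ih b (c + 2))

lemma star_heightMap : star heightMap = heightMap := by
  ext x
  simp [heightMap]

lemma dense_harmonicSpan : Dense (harmonicSpan : Set C(S2, ℂ)) := by
  set A : StarSubalgebra ℂ C(S2, ℂ) := StarAlgebra.adjoin ℂ {horizontalMap, heightMap} with hA
  have hsep : A.SeparatesPoints := by
    intro x y hxy
    by_contra! hcon
    have h1 : horizontal x = horizontal y :=
      hcon _ ⟨horizontalMap, StarAlgebra.subset_adjoin ℂ _ (by simp), rfl⟩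
    have h2 : ((x.1 2 : ℝ) : ℂ) = ((y.1 2 : ℝ) : ℂ) :=
      hcon _ ⟨heightMap, StarAlgebra.subset_adjoin ℂ _ (by simp), rfl⟩
    refine hxy (Subtype.ext ?_)
    ext i
    fin_cases i
    · exact congrArg Complex.re h1
    · exact congrArg Complex.im h1
    · exact Complex.ofReal_injective h2
  have hdense := ContinuousMap.starSubalgebra_topologicalClosure_eq_top_of_separatesPoints A hsep
  have hsub : (A : Set C(S2, ℂ)) ⊆ harmonicSpan := by
    intro f hf
    have hf' : f ∈ Subalgebra.toSubmodule A.toSubalgebra := hf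
    rw [hA, StarAlgebra.adjoin_toSubalgebra, Algebra.adjoin_eq_span] at hf'
    refine Submodule.span_le.2 ?_ hf'
    intro g hg
    have : ∃ a b c : ℕ, g = horizontalMap ^ a * star horizontalMap ^ b * heightMap ^ c := by
      refine Submonoid.closure_induction (fun g hg => ?_) ?_ ?_ hg
      · rcases hg with (rfl | rfl) | hg
        · exact ⟨1, 0, 0, by simp⟩
        · exact ⟨0, 0, 1, by simp⟩
        · rcases hg with hg | hg
          · exact ⟨0, 1, 0, by simp [← hg]⟩
          · refine ⟨0, 0, 1, ?_⟩
            have : g = star heightMap := by rw [← hg, star_star]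
            simp [this, star_heightMap]
      · exact ⟨0, 0, 0, by simp⟩
      · rintro _ _ _ _ ⟨a, b, c, rfl⟩ ⟨a', b', c', rfl⟩
        exact ⟨a + a', b + b', c + c', by ring⟩
    obtain ⟨a, b, c, rfl⟩ := this
    exact monomial_mem_harmonicSpan a b c
  have h3 : Dense (A : Set C(S2, ℂ)) := by
    rw [dense_iff_closure_eq, ← StarSubalgebra.topologicalClosure_coe, hdense]
    rfl
  exact h3.mono hsub

/-- The spherical harmonics are complete in `L²`. -/
theorem ae_eq_zero_of_coeff_eq_zero {f : S2 → ℂ} (hf : MemLp f 2 surface)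
    (h : ∀ l, ∀ m ∈ orders l, coeff f l m = 0) : f =ᵐ[surface] 0 := by
  set F : Lp ℂ 2 surface := hf.toLp f
  have hinner : ∀ g : C(S2, ℂ), inner ℂ (ContinuousMap.toLp 2 surface ℂ g) F =
      ∫ x, f x * conj (g x) ∂surface := by
    intro g
    rw [L2.inner_def]
    refine integral_congr_ae ?_
    filter_upwards [hf.coeFn_toLp, ContinuousMap.coeFn_toLp (p := 2) (𝕜 := ℂ) surface g]
      with x h1 h2
    rw [h1, h2, RCLike.inner_apply]
  have hclosed : IsClosed {g : C(S2, ℂ) | inner ℂ (ContinuousMap.toLp 2 surface ℂ g) F = 0} :=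
    isClosed_eq (by fun_prop) continuous_const
  have hspan : (harmonicSpan : Set C(S2, ℂ)) ⊆
      {g : C(S2, ℂ) | inner ℂ (ContinuousMap.toLp 2 surface ℂ g) F = 0} := by
    intro g hg
    refine Submodule.span_induction ?_ ?_ ?_ ?_ hg
    · rintro _ ⟨l, m, hm, rfl⟩
      exact (hinner _).trans (h l m hm)
    · simp
    · intro a b _ _ ha hb
      simp only [mem_ofPred_eq] at ha hb ⊢
      rw [map_add, inner_add_left, ha, hb, add_zero]
    · intro c a _ ha
      simp only [mem_ofPred_eq] at ha ⊢
      rw [map_smul, inner_smul_left, ha, mul_zero]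
  have hall : ∀ g : C(S2, ℂ), inner ℂ (ContinuousMap.toLp 2 surface ℂ g) F = 0 := fun g =>
    (closure_minimal hspan hclosed) (dense_harmonicSpan g)
  have hF : F = 0 := by
    have hd : Dense ((ContinuousMap.toLp 2 surface ℂ : C(S2, ℂ) →L[ℂ] Lp ℂ 2 surface).range :
        Set (Lp ℂ 2 surface)) :=
      ContinuousMap.toLp_denseRange ℂ surface ℂ (by norm_num)
    refine hd.eq_zero_of_inner_right (𝕜 := ℂ) fun v hv => ?_
    obtain ⟨g, rfl⟩ := LinearMap.mem_range.1 hv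
    exact hall g
  have := hf.coeFn_toLp
  rw [show hf.toLp f = 0 from hF] at this
  exact this.symm.trans (Lp.coeFn_zero _ _ _)

section Expansion

/-! ### Expansion of `L²(dP × dλ)` in spherical harmonics -/

/-- The pairs `(l, m)` with `|m| ≤ l`. -/
abbrev HarmonicIndex : Type := Σ l : ℕ, orders l

/-- The spherical harmonic with index `i = (l, m)`. -/
noncomputable def indexedHarmonic (i : HarmonicIndex) : S2 → ℂ := harmonic i.1 i.2

lemma continuous_indexedHarmonic (i : HarmonicIndex) : Continuous (indexedHarmonic i) :=
  continuous_harmonic _ _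

lemma exists_norm_indexedHarmonic_le (i : HarmonicIndex) : ∃ C, ∀ x, ‖indexedHarmonic i x‖ ≤ C := by
  obtain ⟨C, hC⟩ := isCompact_univ.exists_bound_of_continuousOn
    (continuous_indexedHarmonic i).continuousOn
  exact ⟨C, fun x => hC x (mem_univ x)⟩

lemma integral_indexedHarmonic_mul_conj (i j : HarmonicIndex) [Decidable (i = j)] :
    ∫ x, indexedHarmonic i x * conj (indexedHarmonic j x) ∂surface = if i = j then 1 else 0 := by
  unfold indexedHarmonic
  rw [integral_harmonic_mul_conj i.2.2 j.2.2]
  obtain ⟨l, m, hm⟩ := i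
  obtain ⟨k, n, hn⟩ := j
  refine if_congr ⟨?_, ?_⟩ rfl rfl
  · rintro ⟨h1, h2⟩
    simp only at h1 h2
    subst h1 h2
    rfl
  · rintro h
    cases h
    exact ⟨rfl, rfl⟩

variable {Ω : Type*} [MeasurableSpace Ω] {P : Measure Ω}

lemma pairing_eq_inner {U V : Ω × S2 → ℂ} (hU : MemLp U 2 (P.prod surface))
    (hV : MemLp V 2 (P.prod surface)) :
    pairing P U V = inner ℂ (hV.toLp V) (hU.toLp U) := by
  rw [L2.inner_def]
  refine integral_congr_ae ?_
  filter_upwards [hU.coeFn_toLp, hV.coeFn_toLp] with p h1 h2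
  rw [h1, h2, RCLike.inner_apply]

lemma pairing_congr {U U' : Ω × S2 → ℂ} (h : U =ᵐ[P.prod surface] U') (V : Ω × S2 → ℂ) :
    pairing P U V = pairing P U' V := by
  refine integral_congr_ae ?_
  filter_upwards [h] with p hp
  rw [hp]

lemma memLp_mul_indexedHarmonic {h : Ω → ℂ} (hh : MemLp h 2 P) (i : HarmonicIndex) :
    MemLp (fun p : Ω × S2 => h p.1 * indexedHarmonic i p.2) 2 (P.prod surface) := by
  obtain ⟨C, hC⟩ := exists_norm_indexedHarmonic_le i
  have h1 := hh.comp_fst surface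
  refine h1.of_le_mul (c := C) (h1.1.mul
    ((continuous_indexedHarmonic i).measurable.comp measurable_snd).aestronglyMeasurable)
    (ae_of_all _ fun p => ?_)
  rw [norm_mul, mul_comm]
  exact mul_le_mul_of_nonneg_right (hC _) (norm_nonneg _)

variable [IsProbabilityMeasure P]

/-- The isometry `h ↦ h ⊗ Y_i` from `L²(P)` to `L²(dP × dλ)`, as a linear map. -/
noncomputable def tensorHarmonicLin (P : Measure Ω) [IsProbabilityMeasure P] (i : HarmonicIndex) :
    Lp ℂ 2 P →ₗ[ℂ] Lp ℂ 2 (P.prod surface) where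
  toFun h := (memLp_mul_indexedHarmonic (Lp.memLp h) i).toLp _
  map_add' h k := by
    rw [← MemLp.toLp_add]
    refine MemLp.toLp_congr _ _ ?_
    have := Measure.quasiMeasurePreserving_fst (ν := surface).ae_eq_comp (Lp.coeFn_add h k)
    filter_upwards [this] with p hp
    simp only [Function.comp, Pi.add_apply] at hp ⊢
    rw [hp, add_mul]
  map_smul' c h := by
    rw [RingHom.id_apply, ← MemLp.toLp_const_smul c (memLp_mul_indexedHarmonic (Lp.memLp h) i)]
    refine MemLp.toLp_congr _ _ ?_
    have := Measure.quasiMeasurePreserving_fst (ν := surface).ae_eq_comp (Lp.coeFn_smul c h)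
    filter_upwards [this] with p hp
    simp only [Function.comp, Pi.smul_apply, smul_eq_mul] at hp ⊢
    rw [hp, mul_assoc]

lemma coeFn_tensorHarmonicLin (i : HarmonicIndex) (h : Lp ℂ 2 P) :
    tensorHarmonicLin P i h =ᵐ[P.prod surface] fun p => h p.1 * indexedHarmonic i p.2 :=
  MemLp.coeFn_toLp (memLp_mul_indexedHarmonic (Lp.memLp h) i)

lemma inner_tensorHarmonicLin (i j : HarmonicIndex) [Decidable (j = i)] (h k : Lp ℂ 2 P) :
    inner ℂ (tensorHarmonicLin P i h) (tensorHarmonicLin P j k) =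
      if j = i then inner ℂ h k else 0 := by
  have h1 : inner ℂ (tensorHarmonicLin P i h) (tensorHarmonicLin P j k) =
      ∫ p : Ω × S2, (inner ℂ (h p.1) (k p.1)) *
        (indexedHarmonic j p.2 * conj (indexedHarmonic i p.2)) ∂(P.prod surface) := by
    rw [L2.inner_def]
    refine integral_congr_ae ?_
    filter_upwards [coeFn_tensorHarmonicLin i h, coeFn_tensorHarmonicLin j k] with p h1 h2
    rw [h1, h2, RCLike.inner_apply, RCLike.inner_apply, map_mul]
    ring
  rw [h1, integral_prod_mul (fun ω => (inner ℂ (h ω) (k ω) : ℂ))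
    (fun x => indexedHarmonic j x * conj (indexedHarmonic i x)),
    integral_indexedHarmonic_mul_conj, ← L2.inner_def]
  split_ifs <;> simp

/-- The isometry `h ↦ h ⊗ Y_i` from `L²(P)` to `L²(dP × dλ)`. -/
noncomputable def tensorHarmonic (P : Measure Ω) [IsProbabilityMeasure P] (i : HarmonicIndex) :
    Lp ℂ 2 P →ₗᵢ[ℂ] Lp ℂ 2 (P.prod surface) :=
  (tensorHarmonicLin P i).isometryOfInner fun h k => by
    classical
    rw [inner_tensorHarmonicLin, if_pos rfl]

lemma coeFn_tensorHarmonic (i : HarmonicIndex) (h : Lp ℂ 2 P) :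
    tensorHarmonic P i h =ᵐ[P.prod surface] fun p => h p.1 * indexedHarmonic i p.2 :=
  coeFn_tensorHarmonicLin i h

/-- The random Fourier coefficient `∫ U(·, y) Y_i^*(y) λ(dy)`. -/
noncomputable def randomCoeff (U : Ω × S2 → ℂ) (i : HarmonicIndex) (ω : Ω) : ℂ :=
  coeff (fun y => U (ω, y)) i.1 i.2

lemma integrable_mul_conj_indexedHarmonic {U : Ω × S2 → ℂ} (hU : MemLp U 2 (P.prod surface))
    (i : HarmonicIndex) :
    Integrable (fun p : Ω × S2 => U p * conj (indexedHarmonic i p.2)) (P.prod surface) := by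
  obtain ⟨C, hC⟩ := exists_norm_indexedHarmonic_le i
  refine (hU.integrable (by norm_num)).mul_bdd (c := C) ?_ (ae_of_all _ fun p => ?_)
  · exact (Complex.continuous_conj.measurable.comp
      ((continuous_indexedHarmonic i).measurable.comp measurable_snd)).aestronglyMeasurable
  · rw [RCLike.norm_conj]
    exact hC _

lemma integrable_randomCoeff {U : Ω × S2 → ℂ} (hU : MemLp U 2 (P.prod surface))
    (i : HarmonicIndex) : Integrable (randomCoeff U i) P :=
  (integrable_mul_conj_indexedHarmonic hU i).integral_prod_left

lemma inner_tensorHarmonic_indicator {U : Ω × S2 → ℂ} (hU : MemLp U 2 (P.prod surface))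
    (i : HarmonicIndex) {A : Set Ω} (hA : MeasurableSet A) :
    inner ℂ (tensorHarmonic P i (indicatorConstLp 2 hA (measure_ne_top P A) (1 : ℂ)))
      (hU.toLp U) = ∫ ω in A, randomCoeff U i ω ∂P := by
  have hint := (integrable_mul_conj_indexedHarmonic hU i).indicator
    (hA.prod (MeasurableSet.univ (α := S2)))
  have h1 : inner ℂ (tensorHarmonic P i (indicatorConstLp 2 hA (measure_ne_top P A) (1 : ℂ)))
      (hU.toLp U) = ∫ p, (A ×ˢ univ).indicator
        (fun p : Ω × S2 => U p * conj (indexedHarmonic i p.2)) p ∂(P.prod surface) := by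
    rw [L2.inner_def]
    refine integral_congr_ae ?_
    have := Measure.quasiMeasurePreserving_fst (ν := surface).ae_eq_comp
      (indicatorConstLp_coeFn (p := 2) (hs := hA) (hμs := measure_ne_top P A) (c := (1 : ℂ)))
    filter_upwards [coeFn_tensorHarmonic i (indicatorConstLp 2 hA (measure_ne_top P A) (1 : ℂ)),
      hU.coeFn_toLp, this] with p h1 h2 h3
    simp only [Function.comp] at h3
    rw [h1, h2, h3, RCLike.inner_apply]
    by_cases hp : p.1 ∈ A <;> simp [hp, indicator]
  rw [h1, integral_prod _ hint, ← integral_indicator hA]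
  refine integral_congr_ae (ae_of_all _ fun ω => ?_)
  by_cases hω : ω ∈ A
  · simp [hω, indicator, randomCoeff, coeff, indexedHarmonic]
  · simp [hω, indicator]

/-- `L²(dP × dλ)` is the Hilbert sum of the copies `L²(P) ⊗ Y_i` of `L²(P)`. -/
theorem isHilbertSum_tensorHarmonic :
    IsHilbertSum ℂ (fun _ : HarmonicIndex => Lp ℂ 2 P) (tensorHarmonic P) := by
  classical
  refine IsHilbertSum.mk (fun i j hij h k => ?_) ?_
  · change inner ℂ (tensorHarmonicLin P i h) (tensorHarmonicLin P j k) = 0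
    rw [inner_tensorHarmonicLin, if_neg hij.symm]
  · rw [top_le_iff, Submodule.topologicalClosure_eq_top_iff, eq_bot_iff]
    intro F hF
    rw [Submodule.mem_bot]
    have hU : MemLp F 2 (P.prod surface) := Lp.memLp F
    have hFU : hU.toLp F = F := Lp.toLp_coeFn F hU
    have hcoeff : ∀ i, randomCoeff F i =ᵐ[P] 0 := by
      intro i
      refine (integrable_randomCoeff hU i).ae_eq_zero_of_forall_setIntegral_eq_zero
        fun A hA _ => ?_
      rw [← inner_tensorHarmonic_indicator hU i hA, hFU]
      refine (Submodule.mem_orthogonal _ _).1 hF _ ?_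
      exact Submodule.mem_iSup_of_mem i (LinearMap.mem_range_self _ _)
    have hsec : ∀ᵐ ω ∂P, MemLp (fun y => F (ω, y)) 2 surface := by
      have h1 : Integrable (fun p => ‖F p‖ ^ 2) (P.prod surface) := hU.integrable_norm_pow
        (by norm_num)
      filter_upwards [h1.prod_right_ae, hU.1.prodMk_left] with ω h2 h3
      exact (memLp_two_iff_integrable_sq_norm h3).2 h2
    have hzero : ∀ᵐ ω ∂P, ∀ᵐ y ∂surface, F (ω, y) = 0 := by
      filter_upwards [hsec, ae_all_iff.2 hcoeff] with ω h1 h2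
      exact ae_eq_zero_of_coeff_eq_zero h1 fun l m hm => h2 ⟨l, m, hm⟩
    have : ∀ᵐ p ∂(P.prod surface), F p = 0 := by
      exact (Measure.ae_prod_iff_ae_ae ((Lp.stronglyMeasurable F).measurable
        (measurableSet_singleton 0))).2 hzero
    exact Lp.eq_zero_iff_ae_eq_zero.2 this

/-- The unitary map which sends an element of `L²(dP × dλ)` to the family of its random Fourier
coefficients. -/
noncomputable def coord (P : Measure Ω) [IsProbabilityMeasure P] :
    Lp ℂ 2 (P.prod surface) ≃ₗᵢ[ℂ] lp (fun _ : HarmonicIndex => Lp ℂ 2 P) 2 :=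
  isHilbertSum_tensorHarmonic.linearIsometryEquiv

lemma hasSum_coord_symm (w : lp (fun _ : HarmonicIndex => Lp ℂ 2 P) 2) :
    HasSum (fun i => tensorHarmonic P i (w i)) ((coord P).symm w) :=
  isHilbertSum_tensorHarmonic.hasSum_linearIsometryEquiv_symm w

lemma inner_tensorHarmonic_left (i : HarmonicIndex) (h : Lp ℂ 2 P)
    (F : Lp ℂ 2 (P.prod surface)) : inner ℂ (tensorHarmonic P i h) F = inner ℂ h (coord P F i) := by
  classical
  have h1 : tensorHarmonic P i h = (coord P).symm (lp.single 2 i h) :=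
    (isHilbertSum_tensorHarmonic.linearIsometryEquiv_symm_apply_single h).symm
  rw [h1, ← LinearIsometryEquiv.inner_map_map (coord P), LinearIsometryEquiv.apply_symm_apply]
  exact lp.inner_single_left (G := fun _ : HarmonicIndex => Lp ℂ 2 P) i h _

lemma coord_toLp_ae {U : Ω × S2 → ℂ} (hU : MemLp U 2 (P.prod surface)) (i : HarmonicIndex) :
    coord P (hU.toLp U) i =ᵐ[P] randomCoeff U i := by
  refine Integrable.ae_eq_of_forall_setIntegral_eq _ _
    ((Lp.memLp _).integrable (by norm_num)) (integrable_randomCoeff hU i) fun A hA _ => ?_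
  rw [← inner_tensorHarmonic_indicator hU i hA, inner_tensorHarmonic_left,
    L2.inner_indicatorConstLp_one]

/-- Parseval's identity. -/
lemma hasSum_inner_coord (F G : Lp ℂ 2 (P.prod surface)) :
    HasSum (fun i => inner ℂ (coord P F i) (coord P G i)) (inner ℂ F G) := by
  rw [← LinearIsometryEquiv.inner_map_map (coord P)]
  exact lp.hasSum_inner _ _

lemma hasSum_norm_sq_coord (F : Lp ℂ 2 (P.prod surface)) :
    HasSum (fun i => ‖coord P F i‖ ^ 2) (‖F‖ ^ 2) := by
  have h := (hasSum_inner_coord F F).mapL Complex.reCLM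
  simpa [inner_self_eq_norm_sq_to_K, ← Complex.ofReal_pow] using h

end Expansion

section Semigroup

variable {Ω : Type*} [MeasurableSpace Ω] {P : Measure Ω} [IsProbabilityMeasure P]

lemma coord_ext {F G : Lp ℂ 2 (P.prod surface)} (h : ∀ i, coord P F i = coord P G i) : F = G :=
  (coord P).injective (lp.ext (funext h))

lemma norm_coord_le (F : Lp ℂ 2 (P.prod surface)) (i : HarmonicIndex) : ‖coord P F i‖ ≤ ‖F‖ := by
  rw [← (coord P).norm_map F]
  exact lp.norm_apply_le_norm (by norm_num) _ i

/-- A sequence of multipliers acts on the random Fourier coefficients as soon as the resulting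
sequence is square summable. -/
lemma exists_coord_eq {c : HarmonicIndex → ℝ} {F : Lp ℂ 2 (P.prod surface)}
    (hc : Summable fun i => c i ^ 2 * ‖coord P F i‖ ^ 2) :
    ∃ G : Lp ℂ 2 (P.prod surface), ∀ i, coord P G i = (c i : ℂ) • coord P F i := by
  have hm : Memℓp (fun i => (c i : ℂ) • coord P F i) 2 := by
    refine memℓp_gen ?_
    convert hc using 2 with i
    rw [norm_smul, ENNReal.toReal_ofNat, Real.rpow_ofNat, mul_pow, Complex.norm_real,
      Real.norm_eq_abs, sq_abs]
  refine ⟨(coord P).symm ⟨_, hm⟩, fun i => ?_⟩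
  rw [LinearIsometryEquiv.apply_symm_apply]

lemma exists_coord_eq_of_abs_le_one {c : HarmonicIndex → ℝ} (hc : ∀ i, |c i| ≤ 1)
    (F : Lp ℂ 2 (P.prod surface)) :
    ∃ G : Lp ℂ 2 (P.prod surface), ∀ i, coord P G i = (c i : ℂ) • coord P F i := by
  refine exists_coord_eq ((hasSum_norm_sq_coord F).summable.of_nonneg_of_le
    (fun i => by positivity) fun i => ?_)
  have : c i ^ 2 ≤ 1 := (sq_le_one_iff_abs_le_one _).2 (hc i)
  nlinarith [sq_nonneg ‖coord P F i‖]

lemma tendsto_sum_tensorHarmonic (G : Lp ℂ 2 (P.prod surface)) :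
    Tendsto (fun N => ∑ l ∈ Finset.range N, ∑ m : orders l,
      tensorHarmonic P ⟨l, m⟩ (coord P G ⟨l, m⟩)) atTop (𝓝 G) := by
  have h := hasSum_coord_symm (coord P G)
  rw [LinearIsometryEquiv.symm_apply_apply] at h
  exact (h.sigma fun l => hasSum_fintype _).tendsto_sum_nat

lemma coeFn_sum {ι α : Type*} [MeasurableSpace α] {μ : Measure α} (s : Finset ι)
    (f : ι → Lp ℂ 2 μ) : (∑ i ∈ s, f i : Lp ℂ 2 μ) =ᵐ[μ] fun x => ∑ i ∈ s, f i x := by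
  classical
  induction s using Finset.induction_on with
  | empty =>
    filter_upwards [Lp.coeFn_zero ℂ 2 μ] with x hx
    simpa using hx
  | insert a s ha ih =>
    rw [Finset.sum_insert ha]
    filter_upwards [Lp.coeFn_add (f a) (∑ i ∈ s, f i), ih] with x h1 h2
    rw [h1, Pi.add_apply, h2, Finset.sum_insert ha]

/-- The partial sums of the expansion, as functions. -/
lemma coeFn_sum_tensorHarmonic {U : Ω × S2 → ℂ} (hU : MemLp U 2 (P.prod surface)) {c : ℕ → ℝ}
    {G : Lp ℂ 2 (P.prod surface)}
    (hG : ∀ i, coord P G i = (c i.1 : ℂ) • coord P (hU.toLp U) i) (N : ℕ) :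
    (∑ l ∈ Finset.range N, ∑ m : orders l, tensorHarmonic P ⟨l, m⟩ (coord P G ⟨l, m⟩) :
      Lp ℂ 2 (P.prod surface)) =ᵐ[P.prod surface] fun p => ∑ l ∈ Finset.range N,
        ∑ m ∈ orders l, coeff (fun y => U (p.1, y)) l m * (c l : ℂ) * harmonic l m p.2 := by
  have h1 : ∀ l, ∀ᵐ p ∂(P.prod surface),
      (∑ m : orders l, tensorHarmonic P ⟨l, m⟩ (coord P G ⟨l, m⟩) : Lp ℂ 2 (P.prod surface)) p =
      ∑ m ∈ orders l, coeff (fun y => U (p.1, y)) l m * (c l : ℂ) * harmonic l m p.2 := by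
    intro l
    have h2 : ∀ m : orders l, ∀ᵐ p ∂(P.prod surface),
        tensorHarmonic P ⟨l, m⟩ (coord P G ⟨l, m⟩) p =
          coeff (fun y => U (p.1, y)) l m * (c l : ℂ) * harmonic l m p.2 := by
      intro m
      have h3 := Lp.coeFn_smul (c l : ℂ) (coord P (hU.toLp U) ⟨l, m⟩)
      have h4 := coord_toLp_ae hU ⟨l, m⟩
      have h5 : ∀ᵐ ω ∂P, coord P G ⟨l, m⟩ ω = coeff (fun y => U (ω, y)) l m * (c l : ℂ) := by
        filter_upwards [h3, h4] with ω h6 h7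
        rw [hG, h6, Pi.smul_apply, h7, smul_eq_mul, mul_comm]
        rfl
      filter_upwards [coeFn_tensorHarmonic ⟨l, m⟩ (coord P G ⟨l, m⟩),
        Measure.quasiMeasurePreserving_fst.ae h5] with p h6 h7
      rw [h6, h7]
      rfl
    filter_upwards [coeFn_sum Finset.univ fun m : orders l =>
      tensorHarmonic P ⟨l, m⟩ (coord P G ⟨l, m⟩), ae_all_iff.2 h2] with p h3 h4
    rw [h3, Finset.sum_congr rfl fun m _ => h4 m]
    exact Finset.sum_coe_sort (orders l)
      fun m => coeff (fun y => U (p.1, y)) l m * (c l : ℂ) * harmonic l m p.2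
  filter_upwards [coeFn_sum (Finset.range N) fun l => (∑ m : orders l,
    tensorHarmonic P ⟨l, m⟩ (coord P G ⟨l, m⟩) : Lp ℂ 2 (P.prod surface)),
    ae_all_iff.2 h1] with p h2 h3
  rw [h2]
  exact Finset.sum_congr rfl fun l _ => h3 l

/-- If the expansion converges pointwise almost everywhere, its pointwise sum is its sum in
`L²(dP × dλ)`. -/
lemma ae_eq_of_hasSum {U : Ω × S2 → ℂ} (hU : MemLp U 2 (P.prod surface)) {c : ℕ → ℝ}
    {G : Lp ℂ 2 (P.prod surface)}
    (hG : ∀ i, coord P G i = (c i.1 : ℂ) • coord P (hU.toLp U) i) {f : Ω × S2 → ℂ}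
    (hf : ∀ᵐ p ∂(P.prod surface), HasSum (fun l => ∑ m ∈ orders l,
      coeff (fun y => U (p.1, y)) l m * (c l : ℂ) * harmonic l m p.2) (f p)) :
    f =ᵐ[P.prod surface] G := by
  obtain ⟨ns, hns, hlim⟩ :=
    (tendstoInMeasure_of_tendsto_Lp (tendsto_sum_tensorHarmonic G)).exists_seq_tendsto_ae
  filter_upwards [hf, hlim, ae_all_iff.2 fun N => coeFn_sum_tensorHarmonic hU hG N]
    with p h1 h2 h3
  refine tendsto_nhds_unique (h1.tendsto_sum_nat.comp hns.tendsto_atTop) ?_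
  refine h2.congr fun n => ?_
  rw [h3]
  rfl

/-! ### The transition semigroup on the sphere -/

lemma le_mu (l : ℕ) : (l : ℝ) ≤ mu l := by
  unfold mu
  nlinarith [sq_nonneg (l : ℝ)]

lemma mu_nonneg (l : ℕ) : 0 ≤ mu l := l.cast_nonneg.trans (le_mu l)

lemma card_orders (l : ℕ) : (orders l).card = 2 * l + 1 := by
  unfold orders
  rw [Int.card_Icc]
  omega

lemma summable_exp_neg_mul_mu {s : ℝ} (hs : 0 < s) :
    Summable fun i : HarmonicIndex => Real.exp (-(s * mu i.1)) := by
  rw [summable_sigma_of_nonneg fun _ => (Real.exp_pos _).le]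
  refine ⟨fun l => (hasSum_fintype _).summable, ?_⟩
  have h0 := Real.summable_pow_mul_exp_neg_nat_mul 0 hs
  have h1 := Real.summable_pow_mul_exp_neg_nat_mul 1 hs
  refine ((h1.mul_left 2).add h0).of_nonneg_of_le
    (fun l => tsum_nonneg fun _ => (Real.exp_pos _).le) fun l => ?_
  simp only [tsum_fintype, Finset.sum_const, Finset.card_univ, Fintype.card_coe, card_orders,
    nsmul_eq_mul]
  have h2 : Real.exp (-(s * mu l)) ≤ Real.exp (-s * l) :=
    Real.exp_le_exp.2 (by nlinarith [le_mu l])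
  push_cast
  nlinarith [(Nat.cast_nonneg l : (0 : ℝ) ≤ l)]

lemma memLp_indexedHarmonic (i : HarmonicIndex) : MemLp (indexedHarmonic i) 2 surface := by
  obtain ⟨C, hC⟩ := exists_norm_indexedHarmonic_le i
  exact MemLp.of_bound (continuous_indexedHarmonic i).aestronglyMeasurable C (ae_of_all _ hC)

lemma integral_norm_sq_indexedHarmonic (i : HarmonicIndex) :
    ∫ x, ‖indexedHarmonic i x‖ ^ 2 ∂surface = 1 := by
  classical
  have h := integral_indexedHarmonic_mul_conj i i
  rw [if_pos rfl] at h
  simp_rw [Complex.mul_conj'] at h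
  exact_mod_cast h

lemma integral_norm_indexedHarmonic_le (i : HarmonicIndex) :
    ∫ x, ‖indexedHarmonic i x‖ ∂surface ≤ 1 + surface.real univ := by
  have h1 : Integrable (fun x => ‖indexedHarmonic i x‖ ^ 2 + 1) surface :=
    ((memLp_indexedHarmonic i).integrable_norm_pow (by norm_num)).add (integrable_const _)
  refine (integral_mono ((memLp_indexedHarmonic i).integrable (by norm_num)).norm h1
    fun x => ?_).trans_eq ?_
  · nlinarith [sq_nonneg (‖indexedHarmonic i x‖ - 1), norm_nonneg (indexedHarmonic i x)]
  · rw [integral_add ((memLp_indexedHarmonic i).integrable_norm_pow (by norm_num))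
      (integrable_const _), integral_norm_sq_indexedHarmonic]
    simp

lemma memLp_indexedHarmonic_snd (i : HarmonicIndex) :
    MemLp (fun p : Ω × S2 => indexedHarmonic i p.2) 2 (P.prod surface) := by
  simpa using memLp_mul_indexedHarmonic (memLp_const (1 : ℂ) : MemLp (fun _ => (1 : ℂ)) 2 P) i

lemma integral_norm_mul_indexedHarmonic_le {U : Ω × S2 → ℂ} (hU : MemLp U 2 (P.prod surface))
    (i : HarmonicIndex) :
    ∫ p : Ω × S2, ‖U p‖ * ‖indexedHarmonic i p.2‖ ∂(P.prod surface) ≤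
      ∫ p, ‖U p‖ ^ 2 ∂(P.prod surface) + 1 := by
  have h1 : Integrable (fun p => ‖U p‖ ^ 2) (P.prod surface) :=
    hU.integrable_norm_pow (by norm_num)
  have h2 : Integrable (fun p : Ω × S2 => ‖indexedHarmonic i p.2‖ ^ 2) (P.prod surface) :=
    (memLp_indexedHarmonic_snd i).integrable_norm_pow (by norm_num)
  have h3 : ∫ p : Ω × S2, ‖indexedHarmonic i p.2‖ ^ 2 ∂(P.prod surface) = 1 := by
    have := integral_prod_mul (μ := P) (ν := surface) (fun _ => (1 : ℝ))
      (fun y => ‖indexedHarmonic i y‖ ^ 2)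
    simpa [integral_norm_sq_indexedHarmonic] using this
  refine le_trans ?_ ((integral_add h1 h2).trans_le (add_le_add_right h3.le _))
  refine integral_mono (hU.norm.integrable_mul (memLp_indexedHarmonic_snd i).norm)
    (h1.add h2) fun p => ?_
  beta_reduce
  nlinarith [sq_nonneg (‖U p‖ - ‖indexedHarmonic i p.2‖), sq_nonneg ‖U p‖,
    sq_nonneg ‖indexedHarmonic i p.2‖]

/-- The term of index `i` in a bound for the integral which defines `heatOp s U p`. -/
noncomputable def heatBound (s : ℝ) (U : Ω × S2 → ℂ) (i : HarmonicIndex) (p : Ω × S2) : ℝ :=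
  (∫ y, ‖U (p.1, y)‖ * ‖indexedHarmonic i y‖ ∂surface) *
    (Real.exp (-(s * mu i.1)) * ‖indexedHarmonic i p.2‖)

lemma heatBound_nonneg {Ω : Type*} (s : ℝ) (U : Ω × S2 → ℂ) (i : HarmonicIndex) (p : Ω × S2) :
    0 ≤ heatBound s U i p := by
  unfold heatBound
  exact mul_nonneg (integral_nonneg fun _ => by positivity) (by positivity)

lemma ae_summable_heatBound {U : Ω × S2 → ℂ} (hU : MemLp U 2 (P.prod surface)) {s : ℝ}
    (hs : 0 < s) : ∀ᵐ p ∂(P.prod surface), Summable fun i => heatBound s U i p := by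
  have hint : ∀ i, Integrable (fun p : Ω × S2 => ‖U p‖ * ‖indexedHarmonic i p.2‖)
      (P.prod surface) := fun i =>
    hU.norm.integrable_mul (memLp_indexedHarmonic_snd i).norm
  have hY : ∀ i, Integrable (fun x => Real.exp (-(s * mu i.1)) * ‖indexedHarmonic i x‖)
      surface := fun i =>
    ((memLp_indexedHarmonic i).integrable (by norm_num)).norm.const_mul _
  have hF : ∀ i, Integrable (heatBound s U i) (P.prod surface) := fun i =>
    Integrable.mul_prod (hint i).integral_prod_left (hY i)
  have hI : ∀ i, ∫ p, heatBound s U i p ∂(P.prod surface) =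
      (∫ p : Ω × S2, ‖U p‖ * ‖indexedHarmonic i p.2‖ ∂(P.prod surface)) *
        (Real.exp (-(s * mu i.1)) * ∫ x, ‖indexedHarmonic i x‖ ∂surface) := by
    intro i
    rw [integral_prod _ (hint i), ← integral_const_mul]
    exact integral_prod_mul (fun ω => ∫ y, ‖U (ω, y)‖ * ‖indexedHarmonic i y‖ ∂surface)
      (fun x => Real.exp (-(s * mu i.1)) * ‖indexedHarmonic i x‖)
  have h := (integrable_tsum_of_summable_integral_norm (fun i => (hF i).ofReal (𝕜 := ℂ)) ?_).2
  · filter_upwards [h] with p hp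
    simpa [abs_of_nonneg (heatBound_nonneg _ _ _ _)] using hp
  · set K := (∫ p, ‖U p‖ ^ 2 ∂(P.prod surface) + 1) * (1 + surface.real univ)
    refine ((summable_exp_neg_mul_mu hs).mul_left K).of_nonneg_of_le
      (fun i => integral_nonneg fun _ => norm_nonneg _) fun i => ?_
    have h1 : ∫ p, ‖((heatBound s U i p : ℝ) : ℂ)‖ ∂(P.prod surface) =
        ∫ p, heatBound s U i p ∂(P.prod surface) := by
      simp [abs_of_nonneg (heatBound_nonneg _ _ _ _)]
    refine h1.trans_le ?_
    rw [hI]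
    calc _ = (∫ p : Ω × S2, ‖U p‖ * ‖indexedHarmonic i p.2‖ ∂(P.prod surface)) *
          (∫ x, ‖indexedHarmonic i x‖ ∂surface) * Real.exp (-(s * mu i.1)) := by ring
      _ ≤ _ := by
        refine mul_le_mul_of_nonneg_right ?_ (Real.exp_pos _).le
        exact mul_le_mul (integral_norm_mul_indexedHarmonic_le hU i)
          (integral_norm_indexedHarmonic_le i) (integral_nonneg fun _ => norm_nonneg _)
          (by positivity)

/-- Addition of the terms of orders `m` and `-m`: in the kernel the conjugation may be moved from
one variable to the other. -/
lemma sum_orders_harmonic (l : ℕ) (x : S2) (g : S2 → ℂ) :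
    ∑ m ∈ orders l, conj (harmonic l m x) * ∫ y, g y * harmonic l m y ∂surface =
      ∑ m ∈ orders l, coeff g l m * harmonic l m x := by
  refine Finset.sum_nbij' (fun m => -m) (fun m => -m) ?_ ?_ ?_ ?_ ?_
  · intro m hm
    simp only [orders, Finset.mem_Icc] at hm ⊢
    omega
  · intro m hm
    simp only [orders, Finset.mem_Icc] at hm ⊢
    omega
  · simp
  · simp
  · intro m _
    have hs : ((-1 : ℂ) ^ m.natAbs) * (-1) ^ m.natAbs = 1 := by
      rw [← mul_pow]; simp
    unfold coeff
    simp_rw [conj_harmonic l (-m), neg_neg, Int.natAbs_neg]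
    rw [conj_harmonic]
    have : ∀ y, g y * ((-1) ^ m.natAbs * harmonic l m y) =
        (-1) ^ m.natAbs * (g y * harmonic l m y) := fun y => by ring
    simp_rw [this]
    rw [integral_const_mul]
    ring

/-- The heat operator multiplies the random Fourier coefficients by `e^{-s μ_l}`. -/
theorem heatOp_ae_eq {U : Ω × S2 → ℂ} (hU : MemLp U 2 (P.prod surface)) {s : ℝ} (hs : 0 < s)
    {G : Lp ℂ 2 (P.prod surface)}
    (hG : ∀ i, coord P G i = (Real.exp (-(s * mu i.1)) : ℂ) • coord P (hU.toLp U) i) :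
    heatOp s U =ᵐ[P.prod surface] G := by
  refine ae_eq_of_hasSum hU (c := fun l => Real.exp (-(s * mu l))) hG ?_
  have hsec : ∀ᵐ p ∂(P.prod surface), Integrable (fun y => U (p.1, y)) surface :=
    Measure.quasiMeasurePreserving_fst.ae (hU.integrable (by norm_num)).prod_right_ae
  filter_upwards [hsec, ae_summable_heatBound hU hs] with p h1 h2
  have hint : ∀ l m, Integrable (fun y => U (p.1, y) * harmonic l m y) surface := by
    intro l m
    obtain ⟨C, hC⟩ := isCompact_univ.exists_bound_of_continuousOn
      (continuous_harmonic l m).continuousOn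
    exact h1.mul_bdd (c := C) (continuous_harmonic l m).aestronglyMeasurable
      (ae_of_all _ fun x => hC x (mem_univ x))
  set F : ℕ → S2 → ℂ := fun l y => ∑ m ∈ orders l,
    (Real.exp (-(s * mu l)) : ℂ) * conj (harmonic l m p.2) * (U (p.1, y) * harmonic l m y)
    with hF
  have hFint : ∀ l, Integrable (F l) surface := fun l =>
    integrable_finsetSum _ fun m _ => (hint l m).const_mul _
  have hFsum : Summable fun l => ∫ y, ‖F l y‖ ∂surface := by
    refine h2.sigma.of_nonneg_of_le (fun l => integral_nonneg fun _ => norm_nonneg _) fun l => ?_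
    rw [tsum_fintype]
    have h3 : ∀ m ∈ orders l, Integrable (fun y => ‖U (p.1, y)‖ * ‖harmonic l m y‖ *
        (Real.exp (-(s * mu l)) * ‖harmonic l m p.2‖)) surface := fun m _ => by
      have := (hint l m).norm.mul_const (Real.exp (-(s * mu l)) * ‖harmonic l m p.2‖)
      simpa only [norm_mul] using this
    have h4 : ∑ m : orders l, heatBound s U ⟨l, m⟩ p = ∫ y, ∑ m ∈ orders l,
        ‖U (p.1, y)‖ * ‖harmonic l m y‖ *
          (Real.exp (-(s * mu l)) * ‖harmonic l m p.2‖) ∂surface := by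
      rw [integral_finsetSum _ h3]
      simp_rw [integral_mul_const]
      exact Finset.sum_coe_sort (orders l) fun m =>
        (∫ y, ‖U (p.1, y)‖ * ‖harmonic l m y‖ ∂surface) *
          (Real.exp (-(s * mu l)) * ‖harmonic l m p.2‖)
    rw [h4]
    refine integral_mono (hFint l).norm (integrable_finsetSum _ h3) fun y => ?_
    refine (norm_sum_le _ _).trans (Finset.sum_le_sum fun m _ => le_of_eq ?_)
    rw [norm_mul, norm_mul, norm_mul, RCLike.norm_conj, Complex.norm_real, Real.norm_eq_abs,
      abs_of_pos (Real.exp_pos _)]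
    ring
  have h3 := hasSum_integral_of_summable_integral_norm hFint hFsum
  have h4 : ∫ y, ∑' l, F l y ∂surface = heatOp s U p := by
    unfold heatOp heatKernel
    refine integral_congr_ae (ae_of_all _ fun y => ?_)
    simp only [hF]
    rw [← tsum_mul_left]
    refine tsum_congr fun l => ?_
    rw [Finset.mul_sum]
    refine Finset.sum_congr rfl fun m _ => ?_
    ring
  rw [h4] at h3
  have h5 : ∀ l, ∫ y, F l y ∂surface = ∑ m ∈ orders l, coeff (fun y => U (p.1, y)) l m *
      (Real.exp (-(s * mu l)) : ℂ) * harmonic l m p.2 := by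
    intro l
    simp only [hF]
    rw [integral_finsetSum _ fun m _ => (hint l m).const_mul _]
    simp_rw [integral_const_mul, mul_assoc]
    rw [← Finset.mul_sum, sum_orders_harmonic, Finset.mul_sum]
    refine Finset.sum_congr rfl fun m _ => ?_
    ring
  simpa only [h5] using h3

end Semigroup

section Operators

/-! ### The Laplacian and the subordinate operator in terms of Fourier coefficients -/

variable {Ω : Type*} [MeasurableSpace Ω] {P : Measure Ω} [IsProbabilityMeasure P]

lemma coord_sub_apply (F G : Lp ℂ 2 (P.prod surface)) (i : HarmonicIndex) :
    coord P (F - G) i = coord P F i - coord P G i := by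
  rw [map_sub]
  rfl

lemma coord_smul_apply (c : ℂ) (F : Lp ℂ 2 (P.prod surface)) (i : HarmonicIndex) :
    coord P (c • F) i = c • coord P F i := by
  rw [map_smul]
  rfl

lemma coord_zero_apply (i : HarmonicIndex) : coord P 0 i = 0 := by
  rw [map_zero]
  rfl

lemma tendsto_coord {α : Type*} {L : Filter α} {F : α → Lp ℂ 2 (P.prod surface)}
    {G : Lp ℂ 2 (P.prod surface)} (h : Tendsto F L (𝓝 G)) (i : HarmonicIndex) :
    Tendsto (fun a => coord P (F a) i) L (𝓝 (coord P G i)) := by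
  rw [tendsto_iff_norm_sub_tendsto_zero] at h ⊢
  refine squeeze_zero (fun _ => norm_nonneg _) (fun a => ?_) h
  rw [← coord_sub_apply]
  exact norm_coord_le _ i

lemma exists_heatOp_ae_eq {U : Ω × S2 → ℂ} (hU : MemLp U 2 (P.prod surface)) {s : ℝ}
    (hs : 0 < s) : ∃ G : Lp ℂ 2 (P.prod surface), heatOp s U =ᵐ[P.prod surface] G ∧
      ∀ i, coord P G i = (Real.exp (-(s * mu i.1)) : ℂ) • coord P (hU.toLp U) i := by
  obtain ⟨G, hG⟩ := exists_coord_eq_of_abs_le_one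
    (c := fun i : HarmonicIndex => Real.exp (-(s * mu i.1))) (fun i => by
      rw [abs_of_pos (Real.exp_pos _), Real.exp_le_one_iff]
      have := mul_nonneg hs.le (mu_nonneg i.1)
      linarith) (hU.toLp U)
  exact ⟨G, heatOp_ae_eq hU hs hG, hG⟩

lemma tendsto_inv_mul_exp_sub_one (x : ℝ) :
    Tendsto (fun h : ℝ => h⁻¹ * (Real.exp (-(h * x)) - 1)) (𝓝[>] 0) (𝓝 (-x)) := by
  have h1 : HasDerivAt (fun h : ℝ => Real.exp (-(h * x))) (-x) 0 := by
    have h2 : HasDerivAt (fun h : ℝ => -(h * x)) (-x) 0 := by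
      simpa using ((hasDerivAt_id (0 : ℝ)).mul_const x).fun_neg
    simpa using h2.exp
  have hle : 𝓝[>] (0 : ℝ) ≤ 𝓝[≠] 0 := nhdsWithin_mono _ fun y hy => (mem_Ioi.1 hy).ne'
  simpa using h1.tendsto_slope_zero.mono_left hle

lemma abs_inv_mul_exp_sub_one_add_le {x h : ℝ} (hx : 0 ≤ x) (hh : 0 < h) :
    |h⁻¹ * (Real.exp (-(h * x)) - 1) + x| ≤ x := by
  have h1 : Real.exp (-(h * x)) ≤ 1 := Real.exp_le_one_iff.2 (by nlinarith)
  have h2 := Real.add_one_le_exp (-(h * x))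
  have h3 : h⁻¹ * (Real.exp (-(h * x)) - 1) ≤ 0 :=
    mul_nonpos_of_nonneg_of_nonpos (inv_nonneg.2 hh.le) (by linarith)
  have h4 : h⁻¹ * (-(h * x)) ≤ h⁻¹ * (Real.exp (-(h * x)) - 1) :=
    mul_le_mul_of_nonneg_left (by linarith) (inv_nonneg.2 hh.le)
  rw [mul_neg, inv_mul_cancel_left₀ hh.ne'] at h4
  rw [abs_of_nonneg (by linarith)]
  linarith

/-- The `L²`-generator of the transition semigroup multiplies the random Fourier coefficients by
`-μ_l`. -/
theorem hasLaplacian_iff {U D : Ω × S2 → ℂ} (hU : MemLp U 2 (P.prod surface))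
    (hD : MemLp D 2 (P.prod surface)) : HasLaplacian P U D ↔
      ∀ i, coord P (hD.toLp D) i = ((-mu i.1 : ℝ) : ℂ) • coord P (hU.toLp U) i := by
  have key : ∀ h : ℝ, 0 < h → ∃ R : Lp ℂ 2 (P.prod surface),
      (fun p => ((h⁻¹ : ℝ) : ℂ) * (heatOp h U p - U p) - D p) =ᵐ[P.prod surface] R ∧
      ∀ i, coord P R i = ((h⁻¹ * (Real.exp (-(h * mu i.1)) - 1) : ℝ) : ℂ) •
        coord P (hU.toLp U) i - coord P (hD.toLp D) i := by
    intro h hh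
    obtain ⟨G, h1, h2⟩ := exists_heatOp_ae_eq hU hh
    refine ⟨((h⁻¹ : ℝ) : ℂ) • (G - hU.toLp U) - hD.toLp D, ?_, fun i => ?_⟩
    · filter_upwards [h1, hU.coeFn_toLp, hD.coeFn_toLp, Lp.coeFn_sub G (hU.toLp U),
        Lp.coeFn_smul ((h⁻¹ : ℝ) : ℂ) (G - hU.toLp U),
        Lp.coeFn_sub (((h⁻¹ : ℝ) : ℂ) • (G - hU.toLp U)) (hD.toLp D)] with p e1 e2 e3 e4 e5 e6
      rw [e6, Pi.sub_apply, e5, Pi.smul_apply, e4, Pi.sub_apply, e1, e2, e3, smul_eq_mul]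
    · rw [coord_sub_apply, coord_smul_apply, coord_sub_apply, h2]
      push_cast
      module
  choose! R hR hRc using key
  have hpos : ∀ᶠ h : ℝ in 𝓝[>] 0, 0 < h := self_mem_nhdsWithin
  have hiff : HasLaplacian P U D ↔ Tendsto R (𝓝[>] 0) (𝓝 0) := by
    rw [tendsto_zero_iff_enorm_tendsto_zero]
    refine tendsto_congr' ?_
    filter_upwards [hpos] with h hh
    rw [eLpNorm_congr_ae (hR h hh), Lp.enorm_def]
  rw [hiff]
  constructor
  · intro h i
    have h1 : Tendsto (fun h => coord P (R h) i) (𝓝[>] 0) (𝓝 0) := by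
      simpa only [coord_zero_apply] using tendsto_coord h i
    have h2 : Tendsto (fun h : ℝ => ((h⁻¹ * (Real.exp (-(h * mu i.1)) - 1) : ℝ) : ℂ) •
        coord P (hU.toLp U) i - coord P (hD.toLp D) i) (𝓝[>] 0)
        (𝓝 (((-mu i.1 : ℝ) : ℂ) • coord P (hU.toLp U) i - coord P (hD.toLp D) i)) :=
      ((((Complex.continuous_ofReal.tendsto _).comp
        (tendsto_inv_mul_exp_sub_one (mu i.1))).smul_const _).sub_const _)
    have h3 := h1.congr' (by filter_upwards [hpos] with h hh using hRc h hh i)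
    exact (sub_eq_zero.1 (tendsto_nhds_unique h2 h3)).symm
  · intro h
    have hnorm : ∀ a : ℝ, 0 < a → ∀ i, ‖coord P (R a) i‖ ^ 2 =
        (a⁻¹ * (Real.exp (-(a * mu i.1)) - 1) + mu i.1) ^ 2 * ‖coord P (hU.toLp U) i‖ ^ 2 := by
      intro a ha i
      rw [hRc a ha, h i, ← sub_smul, ← Complex.ofReal_sub, norm_smul, mul_pow, Complex.norm_real,
        Real.norm_eq_abs, sq_abs, sub_neg_eq_add]
    have h1 : Tendsto (fun a : ℝ => ∑' i, (a⁻¹ * (Real.exp (-(a * mu i.1)) - 1) + mu i.1) ^ 2 *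
        ‖coord P (hU.toLp U) i‖ ^ 2) (𝓝[>] 0) (𝓝 (∑' _ : HarmonicIndex, (0 : ℝ))) := by
      refine tendsto_tsum_of_dominated_convergence
        (bound := fun i => ‖coord P (hD.toLp D) i‖ ^ 2)
        (hasSum_norm_sq_coord _).summable (fun i => ?_) ?_
      · have h2 := (((tendsto_inv_mul_exp_sub_one (mu i.1)).add_const (mu i.1)).pow 2).mul_const
          (‖coord P (hU.toLp U) i‖ ^ 2)
        simpa using h2
      · filter_upwards [hpos] with a ha i
        rw [h i, norm_smul, mul_pow, Complex.norm_real, norm_neg, Real.norm_of_nonneg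
          (mu_nonneg _), Real.norm_of_nonneg (by positivity)]
        refine mul_le_mul_of_nonneg_right ?_ (by positivity)
        rw [← sq_abs]
        exact pow_le_pow_left₀ (abs_nonneg _)
          (abs_inv_mul_exp_sub_one_add_le (mu_nonneg _) ha) 2
    rw [tsum_zero] at h1
    have h2 : Tendsto (fun a => ‖R a‖ ^ 2) (𝓝[>] 0) (𝓝 0) := by
      refine h1.congr' ?_
      filter_upwards [hpos] with a ha
      rw [← (hasSum_norm_sq_coord (R a)).tsum_eq]
      exact tsum_congr fun i => (hnorm a ha i).symm
    have h3 := h2.sqrt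
    simp only [Real.sqrt_zero, Real.sqrt_sq (norm_nonneg _)] at h3
    exact tendsto_zero_iff_norm_tendsto_zero.2 h3

lemma hasSum_pairing_heatOp_sub {U V : Ω × S2 → ℂ} (hU : MemLp U 2 (P.prod surface))
    (hV : MemLp V 2 (P.prod surface)) {s : ℝ} (hs : 0 < s) :
    HasSum (fun i => ((Real.exp (-(s * mu i.1)) - 1 : ℝ) : ℂ) *
      inner ℂ (coord P (hV.toLp V) i) (coord P (hU.toLp U) i))
      (pairing P (fun p => heatOp s U p - U p) V) := by
  obtain ⟨G, h1, h2⟩ := exists_heatOp_ae_eq hU hs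
  have h3 : (fun p => heatOp s U p - U p) =ᵐ[P.prod surface] (G - hU.toLp U :
      Lp ℂ 2 (P.prod surface)) := by
    filter_upwards [h1, hU.coeFn_toLp, Lp.coeFn_sub G (hU.toLp U)] with p e1 e2 e3
    rw [e3, Pi.sub_apply, e1, e2]
  rw [pairing_congr h3, pairing_eq_inner (Lp.memLp _) hV, Lp.toLp_coeFn]
  convert hasSum_inner_coord (hV.toLp V) (G - hU.toLp U) using 2 with i
  rw [coord_sub_apply, h2, inner_sub_right, inner_smul_right]
  push_cast
  ring

lemma pairing_tensorHarmonic {U : Ω × S2 → ℂ} (hU : MemLp U 2 (P.prod surface))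
    (i : HarmonicIndex) (h : Lp ℂ 2 P) :
    pairing P U (tensorHarmonic P i h) = inner ℂ h (coord P (hU.toLp U) i) := by
  rw [pairing_eq_inner hU (Lp.memLp _), Lp.toLp_coeFn, inner_tensorHarmonic_left]

lemma pairing_heatOp_sub_tensorHarmonic {U : Ω × S2 → ℂ} (hU : MemLp U 2 (P.prod surface))
    (i : HarmonicIndex) (h : Lp ℂ 2 P) {s : ℝ} (hs : 0 < s) :
    pairing P (fun p => heatOp s U p - U p) (tensorHarmonic P i h) =
      ((Real.exp (-(s * mu i.1)) - 1 : ℝ) : ℂ) * inner ℂ h (coord P (hU.toLp U) i) := by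
  obtain ⟨G, h1, h2⟩ := exists_heatOp_ae_eq hU hs
  have h3 : (fun p => heatOp s U p - U p) =ᵐ[P.prod surface] (G - hU.toLp U :
      Lp ℂ 2 (P.prod surface)) := by
    filter_upwards [h1, hU.coeFn_toLp, Lp.coeFn_sub G (hU.toLp U)] with p e1 e2 e3
    rw [e3, Pi.sub_apply, e1, e2]
  rw [pairing_congr h3, pairing_tensorHarmonic (Lp.memLp _), Lp.toLp_coeFn, coord_sub_apply, h2,
    inner_sub_right, inner_smul_right]
  push_cast
  ring

lemma integral_exp_sub_one_mul {M : Measure ℝ} (b : ℝ) (l : ℕ) (w : ℂ) :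
    ∫ s in Ioi (0 : ℝ), ((Real.exp (-(s * mu l)) - 1 : ℝ) : ℂ) * w ∂M =
      (b * mu l - laplaceExponent b M (mu l) : ℝ) * w := by
  rw [integral_mul_const, integral_complex_ofReal]
  congr 2
  unfold laplaceExponent
  rw [sub_add_cancel_left, ← integral_neg]
  refine integral_congr_ae (ae_of_all _ fun s => ?_)
  simp only [neg_sub, mul_comm]

/-- The subordinate operator multiplies the random Fourier coefficients by `-Ψ(μ_l)`. -/
theorem HasSubordinateLaplacian.coord_eq {b : ℝ} {M : Measure ℝ} {U A : Ω × S2 → ℂ}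
    (hA : HasSubordinateLaplacian b M P U A) (hU : MemLp U 2 (P.prod surface))
    (i : HarmonicIndex) : coord P (hA.1.toLp A) i =
      ((-laplaceExponent b M (mu i.1) : ℝ) : ℂ) • coord P (hU.toLp U) i := by
  obtain ⟨D, hD, hlap, hweak⟩ := hA.2
  refine ext_inner_left ℂ fun h => ?_
  have h1 := (hweak (tensorHarmonic P i h) (Lp.memLp _)).2
  rw [pairing_tensorHarmonic hA.1, pairing_tensorHarmonic hD,
    setIntegral_congr_fun measurableSet_Ioi
      fun s hs => pairing_heatOp_sub_tensorHarmonic hU i h hs, integral_exp_sub_one_mul b] at h1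
  rw [h1, inner_smul_right]
  by_cases hb : b = 0
  · subst hb
    simp
  · rw [(hasLaplacian_iff hU hD).1 (hlap hb) i, inner_smul_right]
    push_cast
    ring

/-- Conversely, the subordinate operator is defined wherever these multipliers yield an element of
`L²(dP × dλ)`. -/
theorem hasSubordinateLaplacian_of_coord_eq {b : ℝ} (hb : 0 ≤ b) {M : Measure ℝ}
    (hM : IsSubordinatorLevyMeasure M) {U A : Ω × S2 → ℂ} (hU : MemLp U 2 (P.prod surface))
    (hA : MemLp A 2 (P.prod surface))
    (hUA : ∀ i, coord P (hA.toLp A) i =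
      ((-laplaceExponent b M (mu i.1) : ℝ) : ℂ) • coord P (hU.toLp U) i) :
    HasSubordinateLaplacian b M P U A := by
  have hΨ : ∀ l, 0 ≤ laplaceExponent b M (mu l) := fun l =>
    hM.laplaceExponent_nonneg hb (mu_nonneg l)
  have hjump : ∀ l, 0 ≤ laplaceExponent b M (mu l) - b * mu l := fun l => by
    have h := hM.laplaceExponent_nonneg (b := 0) le_rfl (mu_nonneg l)
    unfold laplaceExponent at h ⊢
    linarith
  have hbmu : ∀ l, 0 ≤ b * mu l := fun l => mul_nonneg hb (mu_nonneg l)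
  have hnormA : ∀ i, ‖coord P (hA.toLp A) i‖ =
      laplaceExponent b M (mu i.1) * ‖coord P (hU.toLp U) i‖ := fun i => by
    rw [hUA, norm_smul, Complex.norm_real, Real.norm_eq_abs, abs_neg, abs_of_nonneg (hΨ _)]
  refine ⟨hA, ?_⟩
  have hD : ∃ D : Lp ℂ 2 (P.prod surface), (b ≠ 0 → ∀ i, coord P D i =
      ((-mu i.1 : ℝ) : ℂ) • coord P (hU.toLp U) i) := by
    by_cases hb0 : b = 0
    · exact ⟨0, fun h => absurd hb0 h⟩
    · have hbpos : 0 < b := lt_of_le_of_ne hb (Ne.symm hb0)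
      obtain ⟨D, hD⟩ := exists_coord_eq (P := P) (c := fun i => -mu i.1) (F := hU.toLp U) (by
        refine ((hasSum_norm_sq_coord (hA.toLp A)).summable.mul_left
          (b⁻¹ ^ 2)).of_nonneg_of_le (fun i => by positivity) fun i => ?_
        have h1 : mu i.1 ≤ b⁻¹ * laplaceExponent b M (mu i.1) := by
          rw [← div_eq_inv_mul, le_div_iff₀ hbpos]
          linarith [hjump i.1]
        rw [hnormA, neg_sq]
        calc _ ≤ (b⁻¹ * laplaceExponent b M (mu i.1)) ^ 2 * ‖coord P (hU.toLp U) i‖ ^ 2 :=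
              mul_le_mul_of_nonneg_right (pow_le_pow_left₀ (mu_nonneg _) h1 2) (sq_nonneg _)
          _ = _ := by ring)
      exact ⟨D, fun _ => hD⟩
  obtain ⟨D, hD⟩ := hD
  refine ⟨D, Lp.memLp D, fun hb0 => ?_, fun V hV => ?_⟩
  · rw [hasLaplacian_iff hU (Lp.memLp D), Lp.toLp_coeFn]
    exact hD hb0
  set w : HarmonicIndex → ℂ := fun i => inner ℂ (coord P (hV.toLp V) i) (coord P (hU.toLp U) i)
    with hw
  set f : HarmonicIndex → ℝ → ℂ := fun i s => ((Real.exp (-(s * mu i.1)) - 1 : ℝ) : ℂ) * w i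
    with hf
  have hpair : ∀ s ∈ Ioi (0 : ℝ), pairing P (fun p => heatOp s U p - U p) V = ∑' i, f i s :=
    fun s hs => (hasSum_pairing_heatOp_sub hU hV hs).tsum_eq.symm
  have hint1 : ∀ l, Integrable (fun s => Real.exp (-(s * mu l)) - 1) (M.restrict (Ioi 0)) := by
    intro l
    have := (hM.integrable_one_sub_exp (mu_nonneg l)).restrict (s := Ioi 0) |>.neg
    refine this.congr (ae_of_all _ fun s => ?_)
    simp only [Pi.neg_apply, neg_sub, mul_comm]
  have hint : ∀ i, Integrable (f i) (M.restrict (Ioi 0)) := fun i =>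
    ((hint1 i.1).ofReal (𝕜 := ℂ)).mul_const _
  have hfint : ∀ i, ∫ s in Ioi (0 : ℝ), f i s ∂M =
      (b * mu i.1 - laplaceExponent b M (mu i.1) : ℝ) * w i := fun i =>
    integral_exp_sub_one_mul b i.1 (w i)
  have hnorm : ∀ i, ∫ s in Ioi (0 : ℝ), ‖f i s‖ ∂M =
      (laplaceExponent b M (mu i.1) - b * mu i.1) * ‖w i‖ := by
    intro i
    have h1 : ∀ s ∈ Ioi (0 : ℝ), ‖f i s‖ = (1 - Real.exp (-(mu i.1 * s))) * ‖w i‖ := by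
      intro s hs
      have h2 : Real.exp (-(mu i.1 * s)) ≤ 1 := Real.exp_le_one_iff.2 (by
        have := mul_nonneg (mu_nonneg i.1) (le_of_lt hs)
        linarith)
      rw [hf]
      simp only
      rw [norm_mul, Complex.norm_real, Real.norm_eq_abs, abs_sub_comm, mul_comm s,
        abs_of_nonneg (by linarith)]
    rw [setIntegral_congr_fun measurableSet_Ioi h1, integral_mul_const]
    unfold laplaceExponent
    ring
  have hsum : Summable fun i => ∫ s in Ioi (0 : ℝ), ‖f i s‖ ∂M := by
    refine ((hasSum_norm_sq_coord (hV.toLp V)).summable.add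
      (hasSum_norm_sq_coord (hA.toLp A)).summable).of_nonneg_of_le
      (fun i => integral_nonneg fun _ => norm_nonneg _) fun i => ?_
    rw [hnorm]
    have h1 : ‖w i‖ ≤ ‖coord P (hV.toLp V) i‖ * ‖coord P (hU.toLp U) i‖ := norm_inner_le_norm _ _
    have h2 : (laplaceExponent b M (mu i.1) - b * mu i.1) * ‖w i‖ ≤
        laplaceExponent b M (mu i.1) *
          (‖coord P (hV.toLp V) i‖ * ‖coord P (hU.toLp U) i‖) :=
      mul_le_mul (by linarith [hbmu i.1]) h1 (norm_nonneg _) (hΨ _)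
    have h3 : laplaceExponent b M (mu i.1) *
        (‖coord P (hV.toLp V) i‖ * ‖coord P (hU.toLp U) i‖) =
        ‖coord P (hV.toLp V) i‖ * ‖coord P (hA.toLp A) i‖ := by
      rw [hnormA]; ring
    nlinarith [sq_nonneg (‖coord P (hV.toLp V) i‖ - ‖coord P (hA.toLp A) i‖),
      sq_nonneg ‖coord P (hV.toLp V) i‖, sq_nonneg ‖coord P (hA.toLp A) i‖]
  have h1 := integrable_tsum_of_summable_integral_norm hint hsum
  have h2 := hasSum_integral_of_summable_integral_norm hint hsum
  refine ⟨h1.1.congr ?_, ?_⟩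
  · filter_upwards [ae_restrict_mem measurableSet_Ioi] with s hs using (hpair s hs).symm
  rw [setIntegral_congr_fun measurableSet_Ioi hpair]
  simp_rw [hfint] at h2
  have h3 : HasSum (fun i => (b : ℂ) * inner ℂ (coord P (hV.toLp V) i) (coord P D i))
      (b * pairing P D V) := by
    rw [pairing_eq_inner (Lp.memLp D) hV, Lp.toLp_coeFn]
    exact (hasSum_inner_coord _ _).mul_left _
  have h4 : HasSum (fun i => inner ℂ (coord P (hV.toLp V) i) (coord P (hA.toLp A) i))
      (pairing P A V) := by
    rw [pairing_eq_inner hA hV]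
    exact hasSum_inner_coord _ _
  refine h4.unique ?_
  convert h3.add h2 using 2 with i
  rw [hUA, inner_smul_right]
  by_cases hb0 : b = 0
  · subst hb0
    simp [hw]
  · rw [hD hb0, inner_smul_right]
    simp only [hw]
    push_cast
    ring

end Operators

section Field

/-! ### Square integrability of isotropic fields -/

/-- The rotation by `π` about the axis spanned by `v ≠ 0`. -/
noncomputable def halfTurn (v : Fin 3 → ℝ) : Matrix (Fin 3) (Fin 3) ℝ :=
  (2 / (v ⬝ᵥ v)) • Matrix.vecMulVec v v - 1

lemma halfTurn_mem {v : Fin 3 → ℝ} (hv : v ⬝ᵥ v ≠ 0) :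
    halfTurn v ∈ Matrix.specialOrthogonalGroup (Fin 3) ℝ := by
  rw [Matrix.mem_specialOrthogonalGroup_iff, Matrix.mem_orthogonalGroup_iff]
  have hc : 2 / (v ⬝ᵥ v) * (v ⬝ᵥ v) = 2 := div_mul_cancel₀ _ hv
  unfold halfTurn
  set c := 2 / (v ⬝ᵥ v) with hcdef
  constructor
  · have hstar : (c • Matrix.vecMulVec v v - 1)ᵀ = c • Matrix.vecMulVec v v - 1 := by
      ext i j
      simp [Matrix.transpose_apply, Matrix.vecMulVec_apply, Matrix.one_apply, mul_comm (v i),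
        eq_comm (a := i)]
    have hsq : Matrix.vecMulVec v v * Matrix.vecMulVec v v = (v ⬝ᵥ v) • Matrix.vecMulVec v v := by
      rw [Matrix.vecMulVec_mul_vecMulVec, Matrix.vecMulVec_smul]
    rw [hstar, sub_mul, mul_sub, one_mul, mul_one, smul_mul_smul_comm, hsq, smul_smul,
      mul_assoc, hc]
    module
  · have h3 : v ⬝ᵥ v = v 0 * v 0 + v 1 * v 1 + v 2 * v 2 := by
      simp [dotProduct, Fin.sum_univ_three]
    rw [h3] at hc
    rw [Matrix.det_fin_three]
    simp [Matrix.vecMulVec_apply]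
    linear_combination hc

lemma halfTurn_mulVec (v x : Fin 3 → ℝ) :
    halfTurn v *ᵥ x = (2 / (v ⬝ᵥ v) * (v ⬝ᵥ x)) • v - x := by
  unfold halfTurn
  rw [Matrix.sub_mulVec, Matrix.one_mulVec, Matrix.smul_mulVec, Matrix.vecMulVec_mulVec]
  ext i
  simp
  ring

lemma dotProduct_self_eq_one (x : S2) : x.1.ofLp ⬝ᵥ x.1.ofLp = 1 := by
  have := sum_sq_coord x
  simp only [dotProduct, Fin.sum_univ_three]
  linarith

lemma exists_dotProduct_eq_zero (x : Fin 3 → ℝ) : ∃ v : Fin 3 → ℝ, v ⬝ᵥ v ≠ 0 ∧ v ⬝ᵥ x = 0 := by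
  by_cases h : x 0 = 0 ∧ x 1 = 0
  · exact ⟨![1, 0, 0], by simp [dotProduct, Fin.sum_univ_three],
      by simp [dotProduct, Fin.sum_univ_three, h.1]⟩
  · refine ⟨![-x 1, x 0, 0], ?_, ?_⟩
    · intro h0
      simp only [dotProduct, Fin.sum_univ_three, Matrix.cons_val_zero, Matrix.cons_val_one,
        Matrix.cons_val] at h0
      refine h ⟨?_, ?_⟩ <;> nlinarith [sq_nonneg (x 0), sq_nonneg (x 1)]
    · simp only [dotProduct, Fin.sum_univ_three, Matrix.cons_val_zero, Matrix.cons_val_one,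
        Matrix.cons_val]
      ring

/-- The rotation group acts transitively on the sphere. -/
lemma exists_rotation (x y : S2) :
    ∃ g ∈ Matrix.specialOrthogonalGroup (Fin 3) ℝ, y.1.ofLp = g *ᵥ x.1.ofLp := by
  have hx := dotProduct_self_eq_one x
  have hy := dotProduct_self_eq_one y
  set a := x.1.ofLp
  set c := y.1.ofLp
  by_cases h : (a + c) ⬝ᵥ (a + c) = 0
  · have hac : c = -a := by
      rw [dotProduct_self_eq_zero] at h
      exact (neg_eq_of_add_eq_zero_right h).symm
    obtain ⟨v, hv, hva⟩ := exists_dotProduct_eq_zero a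
    refine ⟨halfTurn v, halfTurn_mem hv, ?_⟩
    rw [halfTurn_mulVec, hva, hac]
    simp
  · refine ⟨halfTurn (a + c), halfTurn_mem h, ?_⟩
    have h1 : 2 / ((a + c) ⬝ᵥ (a + c)) * ((a + c) ⬝ᵥ a) = 1 := by
      rw [div_mul_eq_mul_div, div_eq_one_iff_eq h, add_dotProduct, add_dotProduct,
        dotProduct_add, dotProduct_add, hx, hy, dotProduct_comm c a]
      ring
    rw [halfTurn_mulVec, h1, one_smul, add_sub_cancel_left]

variable {Ω : Type*} [MeasurableSpace Ω] {P : Measure Ω} [IsProbabilityMeasure P]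

/-- By isotropy the variance of the field does not depend on the point of the sphere. -/
lemma IsIsotropicGaussianField.memLp_prod {T : Ω → S2 → ℝ} (hT : IsIsotropicGaussianField P T) :
    MemLp (fun p : Ω × S2 => (T p.1 p.2 : ℂ)) 2 (P.prod surface) := by
  have hvar : ∀ x y : S2, ∫ ω, T ω x * T ω x ∂P = ∫ ω, T ω y * T ω y ∂P := by
    intro x y
    obtain ⟨g, hg, hxy⟩ := exists_rotation y x
    exact hT.isotropic g hg y y x x hxy hxy
  have hreal : MemLp (fun p : Ω × S2 => T p.1 p.2) 2 (P.prod surface) := by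
    rw [memLp_two_iff_integrable_sq hT.measurable.aestronglyMeasurable,
      integrable_prod_iff' (hT.measurable.pow_const 2).aestronglyMeasurable]
    refine ⟨ae_of_all _ fun x => (hT.memLp x).integrable_sq, ?_⟩
    let x₀ : S2 := spherePoint 0
    have h : (fun x => ∫ ω, ‖T ω x ^ 2‖ ∂P) = fun _ => ∫ ω, T ω x₀ * T ω x₀ ∂P := by
      funext x
      rw [← hvar x x₀]
      refine integral_congr_ae (ae_of_all _ fun ω => ?_)
      simp only [norm_pow, Real.norm_eq_abs, sq_abs]
      ring
    rw [h]
    exact integrable_const _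
  exact hreal.ofReal

end Field

section Solutions

/-! ### Solutions of the space-time equation -/

variable {Ω : Type*} [MeasurableSpace Ω] {P : Measure Ω} [IsProbabilityMeasure P]
  {Ω' : Type*} [MeasurableSpace Ω'] {Q : Measure Ω'} {H : ℝ≥0 → Ω' → ℝ} {M Lm : Measure ℝ}
  {γ b : ℝ} {T : Ω → S2 → ℝ} {X : ℝ → Ω × S2 → ℂ}

lemma toLp_add_smul_sub_eq_zero {U A D : Ω × S2 → ℂ} (hU : MemLp U 2 (P.prod surface))
    (hA : MemLp A 2 (P.prod surface)) (hD : MemLp D 2 (P.prod surface)) (c : ℂ) :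
    (fun p => c * U p - A p + D p) =ᵐ[P.prod surface] (fun _ => 0) ↔
      ∀ i, coord P (hD.toLp D) i = coord P (hA.toLp A) i - c • coord P (hU.toLp U) i := by
  have h1 : (hD.toLp D = hA.toLp A - c • hU.toLp U) ↔
      (fun p => c * U p - A p + D p) =ᵐ[P.prod surface] (fun _ => 0) := by
    rw [← MemLp.toLp_const_smul c hU, ← MemLp.toLp_sub hA (hU.const_smul c), MemLp.toLp_eq_toLp_iff]
    refine ⟨fun h => ?_, fun h => ?_⟩
    · filter_upwards [h] with p hp
      rw [hp]
      simp
    · filter_upwards [h] with p hp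
      simp only [Pi.sub_apply, Pi.smul_apply, smul_eq_mul]
      linear_combination hp
  rw [← h1]
  refine ⟨fun h i => ?_, fun h => coord_ext fun i => ?_⟩
  · rw [h, coord_sub_apply, coord_smul_apply]
  · rw [h, coord_sub_apply, coord_smul_apply]

/-- The series representation, in terms of the random Fourier coefficients. -/
lemma hasSeriesRepresentation_iff
    (hT : MemLp (fun p : Ω × S2 => (T p.1 p.2 : ℂ)) 2 (P.prod surface)) {t : ℝ}
    (hu : ∀ l, |inverseLaplace H Q t (γ + laplaceExponent b M (mu l))| ≤ 1) {Z : Ω × S2 → ℂ} :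
    HasSeriesRepresentation γ b M P T H Q t Z ↔ ∃ hZ : MemLp Z 2 (P.prod surface),
      ∀ i, coord P (hZ.toLp Z) i =
        (inverseLaplace H Q t (γ + laplaceExponent b M (mu i.1)) : ℂ) •
          coord P (hT.toLp _) i := by
  obtain ⟨G, hG⟩ := exists_coord_eq_of_abs_le_one (P := P)
    (c := fun i : HarmonicIndex => inverseLaplace H Q t (γ + laplaceExponent b M (mu i.1)))
    (fun i => hu i.1) (hT.toLp _)
  have key : ∀ hZ : MemLp Z 2 (P.prod surface), Tendsto (fun N : ℕ =>
      eLpNorm (fun p => Z p - seriesPartialSum γ b M T H Q t N p) 2 (P.prod surface))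
      atTop (𝓝 0) ↔ hZ.toLp Z = G := by
    intro hZ
    have hS := tendsto_sum_tensorHarmonic G
    set S : ℕ → Lp ℂ 2 (P.prod surface) := fun N => ∑ l ∈ Finset.range N, ∑ m : orders l,
      tensorHarmonic P ⟨l, m⟩ (coord P G ⟨l, m⟩)
    have hnorm : ∀ N, eLpNorm (fun p => Z p - seriesPartialSum γ b M T H Q t N p) 2
        (P.prod surface) = ‖hZ.toLp Z - S N‖ₑ := by
      intro N
      rw [Lp.enorm_def]
      refine eLpNorm_congr_ae ?_
      filter_upwards [Lp.coeFn_sub (hZ.toLp Z) (S N), hZ.coeFn_toLp,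
        coeFn_sum_tensorHarmonic hT
          (c := fun l => inverseLaplace H Q t (γ + laplaceExponent b M (mu l))) hG N]
        with p h1 h2 h3
      rw [h1, Pi.sub_apply, h2, h3]
      rfl
    simp_rw [hnorm]
    rw [← tendsto_zero_iff_enorm_tendsto_zero]
    have hlim : Tendsto (fun N => hZ.toLp Z - S N) atTop (𝓝 (hZ.toLp Z - G)) := hS.const_sub _
    refine ⟨fun h => sub_eq_zero.1 (tendsto_nhds_unique hlim h), fun h => ?_⟩
    rw [h, sub_self] at hlim
    rwa [h]
  constructor
  · rintro ⟨hZ, h⟩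
    refine ⟨hZ, fun i => ?_⟩
    rw [(key hZ).1 h, hG]
  · rintro ⟨hZ, h⟩
    exact ⟨hZ, (key hZ).2 (coord_ext fun i => by rw [h, hG])⟩

/-- The terms of order `|m| ≤ l` of the expansion of a real function have a real sum. -/
lemma conj_sum_orders_harmonic (g : S2 → ℝ) (l : ℕ) (x : S2) :
    conj (∑ m ∈ orders l, coeff (fun y => (g y : ℂ)) l m * harmonic l m x) =
      ∑ m ∈ orders l, coeff (fun y => (g y : ℂ)) l m * harmonic l m x := by
  rw [← sum_orders_harmonic, map_sum, sum_orders_harmonic]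
  refine Finset.sum_congr rfl fun m _ => ?_
  rw [map_mul, Complex.conj_conj, mul_comm, ← integral_conj]
  simp only [map_mul, Complex.conj_ofReal]
  rfl

lemma conj_seriesPartialSum {Ω : Type*} {T : Ω → S2 → ℝ} (t : ℝ) (N : ℕ) (p : Ω × S2) :
    conj (seriesPartialSum γ b M T H Q t N p) = seriesPartialSum γ b M T H Q t N p := by
  have h : seriesPartialSum γ b M T H Q t N p = ∑ l ∈ Finset.range N,
      (inverseLaplace H Q t (γ + laplaceExponent b M (mu l)) : ℂ) *
        ∑ m ∈ orders l, coeff (fun y => (T p.1 y : ℂ)) l m * harmonic l m p.2 := by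
    unfold seriesPartialSum fieldCoeff
    refine Finset.sum_congr rfl fun l _ => ?_
    rw [Finset.mul_sum]
    refine Finset.sum_congr rfl fun m _ => ?_
    ring
  rw [h, map_sum]
  refine Finset.sum_congr rfl fun l _ => ?_
  rw [map_mul, Complex.conj_ofReal, conj_sum_orders_harmonic]

variable [IsProbabilityMeasure Q]

/-- A solution has the expected random Fourier coefficients: paired with an element of
`L²(P) ⊗ Y_i`, it solves the scalar equation. -/
lemma IsSolution.coord_eq (hX : IsSolution γ b M Lm P T X)
    (S : IsDiffuseSubordinator H Q Lm) (hr : ∀ l, 0 < γ + laplaceExponent b M (mu l))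
    (hT : MemLp (fun p : Ω × S2 => (T p.1 p.2 : ℂ)) 2 (P.prod surface)) {t : ℝ} (ht : 0 ≤ t)
    (i : HarmonicIndex) : coord P ((hX.memLp t ht).toLp (X t)) i =
      (inverseLaplace H Q t (γ + laplaceExponent b M (mu i.1)) : ℂ) • coord P (hT.toLp _) i := by
  refine ext_inner_left ℂ fun h => ?_
  have hpair : ∀ s (hs : 0 ≤ s), pairing P (X s) (tensorHarmonic P i h) =
      inner ℂ h (coord P ((hX.memLp s hs).toLp (X s)) i) := fun s hs =>
    pairing_tensorHarmonic (hX.memLp s hs) i h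
  have h0 : pairing P (X 0) (tensorHarmonic P i h) = inner ℂ h (coord P (hT.toLp _) i) := by
    rw [pairing_congr hX.initial, pairing_tensorHarmonic hT]
  have hode : ∀ s, 0 < s → HasConvDeriv Lm (fun a => pairing P (X a) (tensorHarmonic P i h)) s
      (-((γ + laplaceExponent b M (mu i.1) : ℝ) *
        pairing P (X s) (tensorHarmonic P i h))) := by
    intro s hs
    obtain ⟨A, D, hA, hD, heq⟩ := hX.equation s hs
    have h1 := hD.2 _ (Lp.memLp (tensorHarmonic P i h))
    have h2 := (toLp_add_smul_sub_eq_zero (hX.memLp s hs.le) hA.1 hD.1 γ).1 heq i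
    rw [pairing_tensorHarmonic hD.1, h2, hA.coord_eq (hX.memLp s hs.le), inner_sub_right,
      inner_smul_right, inner_smul_right, ← hpair s hs.le] at h1
    convert h1 using 1
    push_cast
    ring
  have := S.eq_of_hasConvDeriv (hr i.1) hode ht
  rw [← hpair t ht, this, h0, inner_smul_right, mul_comm]

/-- The expected random Fourier coefficients yield a solution. -/
lemma isSolution_of_coord_eq (hγ : 0 < γ) (hb : 0 ≤ b) (hM : IsSubordinatorLevyMeasure M)
    (S : IsDiffuseSubordinator H Q Lm)
    (hT : MemLp (fun p : Ω × S2 => (T p.1 p.2 : ℂ)) 2 (P.prod surface))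
    (hX : ∀ t, 0 ≤ t → ∃ hX : MemLp (X t) 2 (P.prod surface), ∀ i,
      coord P (hX.toLp (X t)) i =
        (inverseLaplace H Q t (γ + laplaceExponent b M (mu i.1)) : ℂ) •
          coord P (hT.toLp _) i) : IsSolution γ b M Lm P T X := by
  have hΨ : ∀ l, 0 ≤ laplaceExponent b M (mu l) := fun l =>
    hM.laplaceExponent_nonneg hb (mu_nonneg l)
  have hr : ∀ l, 0 < γ + laplaceExponent b M (mu l) := fun l => by linarith [hΨ l]
  choose hmem hcoord using hX
  refine ⟨hmem, ?_, fun t ht => ?_⟩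
  · have h : (hmem 0 le_rfl).toLp (X 0) = hT.toLp _ := coord_ext fun i => by
      rw [hcoord 0 le_rfl, S.inverseLaplace_zero (hr i.1), Complex.ofReal_one, one_smul]
    exact (MemLp.toLp_eq_toLp_iff _ _).1 h
  · set F := hT.toLp (fun p : Ω × S2 => (T p.1 p.2 : ℂ)) with hF
    set u : ℝ → HarmonicIndex → ℝ := fun s i =>
      inverseLaplace H Q s (γ + laplaceExponent b M (mu i.1)) with hu
    have hu0 : ∀ s i, 0 ≤ u s i := fun s i => inverseLaplace_nonneg H Q s _
    -- The multipliers of `A` and `D` are bounded, uniformly over the degrees.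
    set C := laplaceExponent 0 Lm 1 / (1 - Real.exp (-t)) with hC
    have hru : ∀ i, (γ + laplaceExponent b M (mu i.1)) * u t i ≤ C := fun i =>
      S.mul_inverseLaplace_le (hr i.1) ht
    have hsummable : ∀ c : HarmonicIndex → ℝ,
        (∀ i, |c i| ≤ γ + laplaceExponent b M (mu i.1)) →
        Summable fun i => c i ^ 2 * ‖coord P ((hmem t ht.le).toLp (X t)) i‖ ^ 2 := by
      intro c hc
      refine ((hasSum_norm_sq_coord F).summable.mul_left (C ^ 2)).of_nonneg_of_le
        (fun i => by positivity) fun i => ?_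
      rw [hcoord t ht.le, norm_smul, Complex.norm_real, Real.norm_of_nonneg (hu0 t i), mul_pow,
        ← mul_assoc, ← mul_pow]
      refine mul_le_mul_of_nonneg_right ?_ (sq_nonneg _)
      rw [← sq_abs, abs_mul, abs_of_nonneg (hu0 t i)]
      exact pow_le_pow_left₀ (mul_nonneg (abs_nonneg _) (hu0 t i))
        ((mul_le_mul_of_nonneg_right (hc i) (hu0 t i)).trans (hru i)) 2
    obtain ⟨A, hA⟩ := exists_coord_eq (P := P) (F := (hmem t ht.le).toLp (X t))
      (hsummable (fun i => -laplaceExponent b M (mu i.1)) fun i => by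
        rw [abs_neg, abs_of_nonneg (hΨ i.1)]
        linarith)
    obtain ⟨D, hD⟩ := exists_coord_eq (P := P) (F := (hmem t ht.le).toLp (X t))
      (hsummable (fun i => -(γ + laplaceExponent b M (mu i.1))) fun i => by
        rw [abs_neg, abs_of_pos (hr i.1)])
    have hA' : (Lp.memLp A).toLp A = A := Lp.toLp_coeFn A (Lp.memLp A)
    have hD' : (Lp.memLp D).toLp D = D := Lp.toLp_coeFn D (Lp.memLp D)
    refine ⟨A, D, hasSubordinateLaplacian_of_coord_eq hb hM (hmem t ht.le) (Lp.memLp A)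
      (by rwa [hA']), ⟨Lp.memLp D, fun V hV => ?_⟩, ?_⟩
    · have hsum : Summable fun i => ‖(inner ℂ (coord P (hV.toLp V) i) (coord P F i) : ℂ)‖ :=
        (hasSum_inner_coord (hV.toLp V) F).summable.norm
      have h1 := S.hasConvDeriv_tsum (c := fun i => inner ℂ (coord P (hV.toLp V) i) (coord P F i))
        (r := fun i => γ + laplaceExponent b M (mu i.1)) hsum (fun i => hr i.1) ht
        (f := fun s => pairing P (X s) V) (fun s hs => by
          rw [pairing_eq_inner (hmem s hs) hV, ← (hasSum_inner_coord _ _).tsum_eq]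
          refine tsum_congr fun i => ?_
          rw [hcoord s hs, inner_smul_right, mul_comm])
      convert h1 using 1
      rw [pairing_eq_inner (Lp.memLp D) hV, hD', ← (hasSum_inner_coord _ _).tsum_eq, ← tsum_neg]
      refine tsum_congr fun i => ?_
      rw [hD, hcoord t ht.le, inner_smul_right, inner_smul_right]
      push_cast
      ring
    · rw [toLp_add_smul_sub_eq_zero (hmem t ht.le) (Lp.memLp A) (Lp.memLp D)]
      intro i
      rw [hA', hD', hA, hD]
      push_cast
      module

end Solutions

end SphereField

theorem theorem1
    {Ω : Type*} [MeasurableSpace Ω] (P : Measure Ω) [IsProbabilityMeasure P]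
    {Ω' : Type*} [MeasurableSpace Ω'] (Q : Measure Ω') [IsProbabilityMeasure Q]
    (γ : ℝ) (hγ : 0 < γ)
    (b : ℝ) (hb : 0 ≤ b)
    (M : Measure ℝ) (hM : IsSubordinatorLevyMeasure M)
    (Lm : Measure ℝ) (hLm : IsSubordinatorLevyMeasure Lm)
    (hLm_top : Lm (Ioi 0) = ∞)
    (hLm_tail : ∀ r s : ℝ, 0 < r → r ≤ s → AbsolutelyContinuousOnInterval (levyTail Lm) r s)
    (H : ℝ≥0 → Ω' → ℝ) (hH : IsSubordinator H Q (laplaceExponent 0 Lm))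
    (T : Ω → S2 → ℝ) (hT : IsIsotropicGaussianField P T) :
    (∃ X : ℝ → Ω × S2 → ℝ, IsSolution γ b M Lm P T (fun t p => (X t p : ℂ))) ∧
    ∀ X : ℝ → Ω × S2 → ℂ,
      IsSolution γ b M Lm P T X ↔
        ∀ t : ℝ, 0 ≤ t → HasSeriesRepresentation γ b M P T H Q t (X t) := by
  have S : IsDiffuseSubordinator H Q Lm :=
    ⟨hLm, hLm_top, hLm.absolutelyContinuous hLm_tail, hH⟩
  have hr : ∀ l, 0 < γ + laplaceExponent b M (mu l) := fun l =>
    add_pos_of_pos_of_nonneg hγ (hM.laplaceExponent_nonneg hb (mu_nonneg l))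
  have hu : ∀ t, 0 ≤ t → ∀ l,
      |inverseLaplace H Q t (γ + laplaceExponent b M (mu l))| ≤ 1 := fun t ht l => by
    rw [abs_of_nonneg (inverseLaplace_nonneg H Q t _)]
    exact S.inverseLaplace_le_one (hr l) ht
  have hT2 := hT.memLp_prod
  constructor
  · have hex : ∀ t, 0 ≤ t → ∃ G : Lp ℂ 2 (P.prod surface), ∀ i, coord P G i =
        (inverseLaplace H Q t (γ + laplaceExponent b M (mu i.1)) : ℂ) •
          coord P (hT2.toLp _) i := fun t ht =>
      exists_coord_eq_of_abs_le_one (fun i => hu t ht i.1) _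
    choose! G hG using hex
    -- The partial sums are real, hence so is their limit.
    have hreal : ∀ t, 0 ≤ t →
        (fun p => ((G t p).re : ℂ)) =ᵐ[P.prod surface] G t := by
      intro t ht
      obtain ⟨ns, -, hlim⟩ := (tendstoInMeasure_of_tendsto_Lp
        (tendsto_sum_tensorHarmonic (G t))).exists_seq_tendsto_ae
      filter_upwards [hlim, ae_all_iff.2 fun N => coeFn_sum_tensorHarmonic hT2
        (c := fun l => inverseLaplace H Q t (γ + laplaceExponent b M (mu l))) (hG t ht) N]
        with p h1 h2
      have h3 : Tendsto (fun n => seriesPartialSum γ b M T H Q t (ns n) p) atTop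
          (𝓝 (G t p)) := h1.congr fun n => h2 (ns n)
      have h4 := (Complex.continuous_conj.tendsto _).comp h3
      have h5 : conj (G t p) = G t p := tendsto_nhds_unique h4
        (h3.congr fun n => (conj_seriesPartialSum t (ns n) p).symm)
      exact Complex.conj_eq_iff_re.1 h5
    refine ⟨fun t p => (G t p).re, isSolution_of_coord_eq hγ hb hM S hT2 fun t ht => ?_⟩
    have hmem : MemLp (fun p => ((G t p).re : ℂ)) 2 (P.prod surface) :=
      (memLp_congr_ae (hreal t ht)).2 (Lp.memLp _)
    refine ⟨hmem, fun i => ?_⟩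
    have : hmem.toLp _ = G t :=
      ((MemLp.toLp_eq_toLp_iff hmem (Lp.memLp _)).2 (hreal t ht)).trans (Lp.toLp_coeFn _ _)
    rw [this, hG t ht]
  · intro X
    constructor
    · intro hX t ht
      exact (hasSeriesRepresentation_iff hT2 (hu t ht)).2
        ⟨hX.memLp t ht, fun i => hX.coord_eq S hr hT2 ht i⟩
    · intro hX
      exact isSolution_of_coord_eq hγ hb hM S hT2 fun t ht =>
        (hasSeriesRepresentation_iff hT2 (hu t ht)).1 (hX t ht)
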